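/- **Grid diagrams.** A grid diagram $G$ of size $n$ has one $X$ and one $O$, in different cells, in every row and every column. It gives an oriented link: segments run from $X$ to $O$ in each column and from $O$ to $X$ in each row, and vertical segments cross over horizontal ones. Choose one of the two kinds of markings, $p\in\{X,O\}$. The *$p$-bends* are the pairs (horizontal segment, vertical segment) meeting at a marking of kind $p$, called the vertex of the bend. A $p$-bend is *twisted* if it passes over some segment and also passes under some segment. To *stabilize* at a marking of kind $p$ means to double its row and its column, and to put into the resulting $2\times2$ block two markings of kind $p$ on a diagonal and one marking of the other kind in one of the two remaining corners. **Marked cubes and cube diagrams.** In $[0,N]^3$, divided into unit cubes, a *flat* is a layer of thickness $1$ perpendicular to a coordinate axis. A *marked cube* of size $N$ has unit cubes marked $X$, $Y$ or $Z$ so that every flat contains exactly one marking of each label and these three form a right angle with sides parallel to coordinate axes, whose vertex is the $X$, $Y$, $Z$ marking in flats perpendicular to the $x$-, $y$-, $z$-axis respectively. It carries the oriented link made of the axis-parallel segments $X\to Y\to Z\to X$ between markings that agree in two coordinates. The *crossing conditions* are: at every crossing of the $(x,y)$-projection, the $x$-parallel segment has smaller $z$-coordinate than the $y$-parallel one; and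 likewise after cyclic permutation of $(x,y,z)$, for the $(y,z)$- and the $(z,x)$-projection. A *cube diagram* is a marked cube satisfying all three crossing conditions. A crossing of the $(y,z)$- or $(z,x)$-projection of a marked cube is *bad* if it violates its crossing condition. **Statement.** Let $G$ be a grid diagram of size $n$ of an oriented knot $K$, let $p\in\{X,O\}$, and let $t$ be the number of twisted $p$-bends of $G$. 1. One can stabilize successively at vertices of twisted $p$-bends until no $p$-bend is twisted. However this is done, the resulting grid diagram $G'$ has size $n+t$ and is a diagram of $K$. 2. The bends of $G'$ can be stacked: the $n+t$ $p$-bends of $G'$ can be assigned pairwise different levels $0,\dots,n+t-1$ so that, whenever one bend crosses over another, it has the higher level (that is, the levels are a linear extension of a partial order in which a bend is greater than every bend it crosses over). 3. For every such assignment of levels, let $L$ be the marked cube of size $n+t$ obtained by placing each bend of $G'$ horizontally at its level, with the vertex of the bend marked $Z$ and the ends of its vertical and its horizontal segment marked $X$ and $Y$ respectively, so that bends are joined by segments parallel to the $z$-axis. Then $L$ represents $K$ (with the opposite orientation if $p=O$) and satisfies the crossing condition of the $(x,y)$-projection. If $b$ is the number of bad crossings of $L$ in its $(y,z)$- and $(z,x)$-projections,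 then there is a cube diagram of the oriented knot $K$ of size at most $$n+2b+t .$$ -/

import Mathlib

/-! ### Polygonal knots in three-space -/

/-- Points of three-space; the coordinates `0`, `1`, `2` are `x`, `y`, `z`. -/
abbrev Point3 : Type := Fin 3 → ℝ

/-- `a → b` is one of the directed edges of the closed polygon whose vertices are listed, in cyclic
order, by `l`: up to a cyclic rotation, `l` begins with `a, b`. -/
def IsPolygonEdge (l : List Point3) (a b : Point3) : Prop :=
  ∃ t : List Point3, l ~r a :: b :: t

/-- An oriented polygonal knot: a simple closed polygon in three-space. -/
structure PolygonalKnot where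
  /-- the vertices, in cyclic order along the orientation -/
  vertices : List Point3
  three_le : 3 ≤ vertices.length
  nodup : vertices.Nodup
  /-- two different edges meet at most in a common end point -/
  simple : ∀ a b c d : Point3, IsPolygonEdge vertices a b → IsPolygonEdge vertices c d →
    (a, b) ≠ (c, d) → segment ℝ a b ∩ segment ℝ c d ⊆ {a, b} ∩ {c, d}

namespace PolygonalKnot

/-- The set of directed edges. -/
def edges (K : PolygonalKnot) : Set (Point3 × Point3) :=
  {e | IsPolygonEdge K.vertices e.1 e.2}

/-- The underlying point set. -/
def carrier (K : PolygonalKnot) : Set Point3 :=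
  {x | ∃ e ∈ K.edges, x ∈ segment ℝ e.1 e.2}

/-- Elementary deformations: renaming the starting vertex, and the triangle move, which replaces an
edge `a → b` by the two edges `a → q → b` when the triangle `a, q, b` meets the knot in no
point outside that edge. (A degenerate triangle only occurs when `q` subdivides the edge, as
both polygons are simple.) -/
inductive Move : PolygonalKnot → PolygonalKnot → Prop
  | rotate (K K' : PolygonalKnot) (h : K.vertices ~r K'.vertices) : Move K K'
  | triangle (K K' : PolygonalKnot) (a b q : Point3) (l : List Point3)
      (hK : K.vertices = a :: b :: l) (hK' : K'.vertices = a :: q :: b :: l)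
      (h : convexHull ℝ {a, q, b} ∩ K.carrier ⊆ segment ℝ a b) : Move K K'

/-- Equivalence of oriented polygonal knots: `K` and `K'` are the same oriented knot when a finite
sequence of elementary deformations and their inverses turns one into the other. -/
def Equiv (K K' : PolygonalKnot) : Prop := Relation.EqvGen Move K K'

theorem isPolygonEdge_reverse {l : List Point3} {a b : Point3}
    (h : IsPolygonEdge l.reverse a b) : IsPolygonEdge l b a := by
  obtain ⟨t, ht⟩ := h
  refine ⟨t.reverse, ?_⟩
  have h1 := ht.reverse
  rw [List.reverse_reverse] at h1
  refine h1.trans ?_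
  have h2 : (a :: b :: t).reverse = t.reverse ++ [b, a] := by simp
  rw [h2]
  exact List.isRotated_append

/-- The same polygon with the opposite orientation. -/
def reverse (K : PolygonalKnot) : PolygonalKnot where
  vertices := K.vertices.reverse
  three_le := by simpa using K.three_le
  nodup := by simpa using K.nodup
  simple := by
    intro a b c d h1 h2 hne
    have h := K.simple b a d c (isPolygonEdge_reverse h1) (isPolygonEdge_reverse h2) (by
      intro h
      apply hne
      simp only [Prod.mk.injEq] at h ⊢
      exact ⟨h.2, h.1⟩)
    rw [segment_symm ℝ a b, segment_symm ℝ c d, Set.pair_comm a b, Set.pair_comm c d]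
    exact h

end PolygonalKnot

/-- The directed segments in `E` are, together, the edges of one polygonal knot, and this knot is
the oriented knot `K`. -/
def EdgesRepresent (E : Set (Point3 × Point3)) (K : PolygonalKnot) : Prop :=
  ∃ P : PolygonalKnot, P.edges = E ∧ P.Equiv K

/-- `k` lies strictly between `i` and `j`. -/
def StrictlyBetween {n : ℕ} (k i j : Fin n) : Prop :=
  (i < k ∧ k < j) ∨ (j < k ∧ k < i)

/-! ### Grid diagrams -/

/-- A grid diagram of size `n`: the `X` and the `O` marking of column `i` are in the rows `X i`
and `O i`. -/
structure GridDiagram (n : ℕ) where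
  X : Equiv.Perm (Fin n)
  O : Equiv.Perm (Fin n)
  ne : ∀ i, X i ≠ O i

/-- The two kinds of markings of a grid diagram. -/
inductive Marker
  | X
  | O

/-- The other kind of marking. -/
def Marker.other : Marker → Marker
  | .X => .O
  | .O => .X

namespace GridDiagram

variable {n m : ℕ}

/-- `G.mark p i` is the row of the marking of kind `p` in column `i`. -/
def mark (G : GridDiagram n) : Marker → Equiv.Perm (Fin n)
  | .X => G.X
  | .O => G.O

/-- The centre of the cell in column `i` and row `j`, at height `h`. -/
noncomputable def cell (i j : Fin n) (h : ℝ) : Point3 :=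
  ![(i : ℝ) + 1 / 2, (j : ℝ) + 1 / 2, h]

/-- The oriented link of a grid diagram, as a set of directed segments: in every column a segment
from `X` to `O` at height `1`, in every row a segment from `O` to `X` at height `0` (so that
vertical segments cross over horizontal ones), joined by unit segments above the markings. -/
def edges (G : GridDiagram n) : Set (Point3 × Point3) :=
  {e | ∃ i, e = (cell i (G.X i) 1, cell i (G.O i) 1)} ∪
  {e | ∃ i, e = (cell i (G.O i) 1, cell i (G.O i) 0)} ∪
  {e | ∃ j, e = (cell (G.O.symm j) j 0, cell (G.X.symm j) j 0)} ∪
  {e | ∃ i, e = (cell i (G.X i) 0, cell i (G.X i) 1)}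

/-- `G` is a grid diagram of the oriented knot `K`. -/
def Represents (G : GridDiagram n) (K : PolygonalKnot) : Prop :=
  EdgesRepresent G.edges K

/-- The vertical segment in column `i` crosses the horizontal segment in row `j`. -/
def Crossing (G : GridDiagram n) (i j : Fin n) : Prop :=
  StrictlyBetween j (G.X i) (G.O i) ∧ StrictlyBetween i (G.X.symm j) (G.O.symm j)

/-- For a kind of marking `p`, the bends of the corresponding partition are indexed by their column:
bend `c` consists of the vertical segment in column `c` and the horizontal segment in row
`G.mark p c`, which meet at the marking of kind `p` in column `c`. The bend is twisted when it
passes over some segment and also passes under some segment. -/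
def Twisted (G : GridDiagram n) (p : Marker) (c : Fin n) : Prop :=
  (∃ j, G.Crossing c j) ∧ (∃ i, G.Crossing i (G.mark p c))

/-- The number of twisted bends in the partition into bends with vertices of kind `p`. -/
noncomputable def numTwisted (G : GridDiagram n) (p : Marker) : ℕ :=
  {c | G.Twisted p c}.ncard

/-- `G'` is obtained from `G` by stabilizing at the marking of kind `p` in column `c`: the row and
the column of this marking are doubled, and its cell becomes a `2 × 2` block with two markings
of kind `p` on a diagonal and one marking of the other kind, in column `a`, in one of the two
remaining corners. The maps `c.predAbove` and `(G.mark p c).predAbove` from `Fin (n + 1)` to `Fin n`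
merge the doubled columns and rows again; away from the block, all markings stay where they
were. -/
def IsStabilization (G : GridDiagram n) (p : Marker) (c : Fin n) (G' : GridDiagram (n + 1)) :
    Prop :=
  (∀ i, (G.mark p c).predAbove (G'.mark p i) = G.mark p (c.predAbove i)) ∧
  ∃ a, c.predAbove a = c ∧ (G.mark p c).predAbove (G'.mark p.other a) = G.mark p c ∧
    ∀ i, i ≠ a →
      (G.mark p c).predAbove (G'.mark p.other i) = G.mark p.other (c.predAbove i)

/-- `Untwists p G G'`: `G'` is obtained from `G` by stabilizing, one after the other, at vertices of
twisted bends (of the partition into bends with vertices of kind `p`), until no such bend is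
twisted. -/
inductive Untwists (p : Marker) : {n m : ℕ} → GridDiagram n → GridDiagram m → Prop
  | done {n : ℕ} (G : GridDiagram n) (h : ∀ c, ¬ G.Twisted p c) : Untwists p G G
  | step {n m : ℕ} (G : GridDiagram n) (G₁ : GridDiagram (n + 1)) (G' : GridDiagram m)
      (c : Fin n) (hc : G.Twisted p c) (h₁ : G.IsStabilization p c G₁)
      (h : Untwists p G₁ G') : Untwists p G G'

/-- An order in which the bends with vertices of kind `p` can be stacked (`ζ c` is the level of bend
`c`): whenever a bend crosses over another one, it is the higher of the two. -/
def IsStacking (G : GridDiagram n) (p : Marker) (ζ : Equiv.Perm (Fin n)) : Prop :=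
  ∀ c d, G.Crossing c (G.mark p d) → ζ d < ζ c

end GridDiagram

/-! ### Marked cubes and cube diagrams -/

/-- `u` and `v` are different and lie on a line parallel to the coordinate axis `b`. -/
def Along {n : ℕ} (b : Fin 3) (u v : Fin 3 → Fin n) : Prop :=
  u b ≠ v b ∧ ∀ i, i ≠ b → u i = v i

/-- A cube of size `n` with unit cubes marked by `X`, `Y`, `Z` (the labels `0`, `1`, `2`) such that
the marking conditions hold. The flat `{u | u a = k}` is the `k`-th flat perpendicular to the
axis `a`. -/
structure MarkedCube (n : ℕ) where
  mark : Fin 3 → Set (Fin 3 → Fin n)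
  /-- every flat contains exactly one marking of each label -/
  flat_unique : ∀ (l a : Fin 3) (k : Fin n), ∃! u, u ∈ mark l ∧ u a = k
  /-- the markings in each flat form a right angle with sides parallel to coordinate axes; its
  vertex is the `X`, `Y`, `Z` marking in `x`-, `y`-, `z`-flats, respectively -/
  right_angle : ∀ (a : Fin 3) (u v w : Fin 3 → Fin n), u ∈ mark a → v ∈ mark (a + 1) →
    w ∈ mark (a + 2) → v a = u a → w a = u a → ∃ b c, b ≠ c ∧ Along b u v ∧ Along c u w

namespace MarkedCube

variable {n : ℕ}

/-- The centre of a unit cube. -/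
noncomputable def center (u : Fin 3 → Fin n) : Point3 := fun i => (u i : ℝ) + 1 / 2

/-- `u` and `v` are markings joined by a segment oriented from `u` to `v` (from `X` to `Y`, from `Y`
to `Z`, or from `Z` to `X`) that is parallel to the axis `b`. -/
def EdgeAlong (C : MarkedCube n) (b : Fin 3) (u v : Fin 3 → Fin n) : Prop :=
  (∃ l, u ∈ C.mark l ∧ v ∈ C.mark (l + 1)) ∧ Along b u v

/-- The oriented link embedded in the cube, as a set of directed segments. -/
def edges (C : MarkedCube n) : Set (Point3 × Point3) :=
  {e | ∃ b u v, C.EdgeAlong b u v ∧ e = (center u, center v)}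

/-- The oriented link embedded in the cube is the oriented knot `K`. -/
def Represents (C : MarkedCube n) (K : PolygonalKnot) : Prop :=
  EdgesRepresent C.edges K

/-- The segments `u v`, parallel to the axis `a + 1`, and `u' v'`, parallel to the axis `a + 2`,
cross in the projection along the axis `a`. For `a = 0`, `1`, `2` this is the `(y,z)`-, `(z,x)`-,
`(x,y)`-projection, respectively. -/
def Cross (C : MarkedCube n) (a : Fin 3) (u v u' v' : Fin 3 → Fin n) : Prop :=
  C.EdgeAlong (a + 1) u v ∧ C.EdgeAlong (a + 2) u' v' ∧
    StrictlyBetween (u (a + 2)) (u' (a + 2)) (v' (a + 2)) ∧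
    StrictlyBetween (u' (a + 1)) (u (a + 1)) (v (a + 1))

/-- The crossing condition for the projection along the axis `a`: at every crossing, the segment
parallel to the axis `a + 1` has smaller `a`-coordinate than the one parallel to the axis
`a + 2`. -/
def CrossingCondition (C : MarkedCube n) (a : Fin 3) : Prop :=
  ∀ u v u' v', C.Cross a u v u' v' → u a < u' a

/-- The number of crossings (double points) of the projection along `a` that violate the crossing
condition. -/
noncomputable def numBad (C : MarkedCube n) (a : Fin 3) : ℕ :=
  {x : Fin n × Fin n | ∃ u v u' v', C.Cross a u v u' v' ∧ ¬ u a < u' a ∧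
    x = (u' (a + 1), u (a + 2))}.ncard

/-- A cube diagram: all three crossing conditions hold. -/
def IsCubeDiagram (C : MarkedCube n) : Prop := ∀ a, C.CrossingCondition a

end MarkedCube

/-- The lattice link obtained by stacking the bends of `G` with vertices of kind `p`: bend `c` lies
at level `ζ c`, its vertex is a `Z` marking, the other end of its vertical segment is an `X`
marking, and the other end of its horizontal segment is a `Y` marking. Ends of different bends
that lie over the same marking of `G` are joined by segments parallel to the `z`-axis. -/
def GridDiagram.stack {n : ℕ} (G : GridDiagram n) (p : Marker) (ζ : Equiv.Perm (Fin n)) :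
    MarkedCube n where
  mark := ![
    {u | ∃ c, u = ![c, G.mark p.other c, ζ c]},
    {u | ∃ c, u = ![(G.mark p.other).symm (G.mark p c), G.mark p c, ζ c]},
    {u | ∃ c, u = ![c, G.mark p c, ζ c]}]
  flat_unique := by
    have key : ∀ (f g h : Equiv.Perm (Fin n)) (a : Fin 3) (k : Fin n),
        ∃! u : Fin 3 → Fin n, u ∈ {u | ∃ c, u = ![f c, g c, h c]} ∧ u a = k := by
      intro f g h a k
      have hb : Function.Bijective (fun c => (![f c, g c, h c] : Fin 3 → Fin n) a) := by
        fin_cases a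
        · exact f.bijective
        · exact g.bijective
        · exact h.bijective
      obtain ⟨c, hc⟩ := hb.2 k
      refine ⟨_, ⟨⟨c, rfl⟩, hc⟩, ?_⟩
      rintro _ ⟨⟨d, rfl⟩, hd⟩
      rw [hb.1 (hd.trans hc.symm)]
    intro l
    fin_cases l
    · exact key (Equiv.refl _) (G.mark p.other) ζ
    · exact key ((G.mark p).trans (G.mark p.other).symm) (G.mark p) ζ
    · exact key (Equiv.refl _) (G.mark p) ζ
  right_angle := by
    have hne : ∀ i, G.mark p i ≠ G.mark p.other i := by
      intro i
      cases p
      · exact G.ne i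
      · exact (G.ne i).symm
    generalize G.mark p = v at *
    generalize G.mark p.other = w at *
    have hw : ∀ d, w.symm (v d) ≠ d := fun d h => hne d (by rw [← w.symm_apply_eq, h])
    intro a u₁ u₂ u₃ h₁ h₂ h₃ e₂ e₃
    fin_cases a
    · obtain ⟨c, rfl⟩ := h₁
      obtain ⟨d, rfl⟩ := h₂
      obtain ⟨e, rfl⟩ := h₃
      have e₂' : w.symm (v d) = c := e₂
      have e₃' : e = c := e₃
      subst e₃'
      have e₄ : v d = w e := by rw [← e₂', w.apply_symm_apply]
      have hde : ζ e ≠ ζ d := fun h => hne d (by rw [e₄, ζ.injective h])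
      refine ⟨2, 1, by decide, ⟨hde, fun i hi => ?_⟩, ⟨(hne e).symm, fun i hi => ?_⟩⟩ <;>
        fin_cases i <;> simp_all
    · obtain ⟨c, rfl⟩ := h₁
      obtain ⟨d, rfl⟩ := h₂
      obtain ⟨e, rfl⟩ := h₃
      have e₂' : v d = v c := e₂
      have e₃' : w e = v c := e₃
      have e₅ : d = c := v.injective e₂'
      subst e₅
      have e₄ : w.symm (v d) = e := by rw [← e₃', w.symm_apply_apply]
      have hde : ζ d ≠ ζ e := fun h => hw d (by rw [e₄, ζ.injective h])
      refine ⟨0, 2, by decide, ⟨hw d, fun i hi => ?_⟩, ⟨hde, fun i hi => ?_⟩⟩ <;>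
        fin_cases i <;> simp_all
    · obtain ⟨c, rfl⟩ := h₁
      obtain ⟨d, rfl⟩ := h₂
      obtain ⟨e, rfl⟩ := h₃
      have e₂' : d = c := ζ.injective e₂
      have e₃' : e = c := ζ.injective e₃
      subst e₂'
      subst e₃'
      refine ⟨1, 0, by decide, ⟨hne e, fun i hi => ?_⟩, ⟨(hw e).symm, fun i hi => ?_⟩⟩ <;>
        fin_cases i <;> simp_all

/-- With vertices of kind `X`, the orientation of the stacked link (from `X` to `Y` to `Z` to `X`) is
that of the grid diagram; with vertices of kind `O`, it is the opposite one. -/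
def Marker.orient : Marker → PolygonalKnot → PolygonalKnot
  | .X, K => K
  | .O, K => K.reverse

/-!
Every identification of knots rests on one principle, `EdgesRepresent.of_path`: a continuous family
of simple closed polygons with a fixed number of vertices consists of polygons of one knot.
Simplicity is an open condition (`isOpen_robustLoop`), and near a simple polygon the vertices may be
moved one at a time, by way of points in general position, so that each motion is a composition of
two triangle moves (`IsCyclicList.equiv_update`). Together with the subdivision of edges this turns
the isotopies of the argument into explicit families of polygons with straight edges.

*Untwisting.* Merging the doubled column and row of a stabilization, while the five segments inside
the block are straightened, is such a family (`IsStabilization.represents`). Outside the block the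
crossings stay the same. Of the two bends in the block, one passes over nothing and the other one
passes under nothing, so each stabilization at a twisted bend lowers the number of twisted bends by
exactly one (`IsStabilization.numTwisted_add_one`). This gives the existence of untwistings and the
size of their result.

*Stacking.* If no bend is twisted, all bends that pass over something can be placed above all others
(`exists_isStacking`). Given any admissible levels, the vertical and horizontal segments of the grid
diagram are moved to their levels along straight lines; a vertical segment stays above the horizontal
segments that it crosses, so the polygons stay simple (`simpleLoop_collapsePath`).

*Removal of bad crossings.* A stack is a lattice link: a cyclic sequence of points in which
consecutive points are joined by a segment in `z`-direction, one in `x`-direction and one in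
`y`-direction. If a `y`-segment and a `z`-segment form a bad crossing of the `(y,z)`-projection, both
are interrupted near that crossing by one new point, such that the crossing disappears
(`LatticeLink.fix`). Only small neighbourhoods of old segments are swept out, so the knot does not
change (`Represents.fix`), and mapping each new segment to the old one it came from is an injection
of the new bad crossings into the remaining old ones (`ncard_bad0_fix_lt` and its analogues). The
other projections are reduced to this one by the cyclic symmetry of the coordinates, so `b` bad
crossings are removed at the cost of `2 * b` points (`exists_isGood`). Replacing the coordinates by
their ranks yields a cube diagram.

For vertices of kind `O` the stack is the knot with the opposite orientation. The rotation
`(x, y, z) ↦ (-y, -x, -z)` takes a lattice link without bad crossings to such a link with the opposite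
orientation (`IsGood.reverse`), which restores the orientation at the end.
-/

/-! ### Edges of cyclic lists -/

/-- Without reference to rotations: the edges of `l` are the pairs of consecutive entries, and the
pair of the last and the first entry. -/
theorem isPolygonEdge_iff {l : List Point3} {x y : Point3} :
    IsPolygonEdge l x y ↔ [x, y] <:+: l ∨ ∃ m, l = y :: m ++ [x] := by
  constructor
  · rintro ⟨t, h⟩
    obtain ⟨n, hn, h⟩ := List.isRotated_iff_mod.1 h.symm
    rw [List.rotate_eq_drop_append_take hn] at h
    match n, h with
    | 0, h => exact Or.inl ⟨[], t, by simpa using h⟩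
    | 1, h => exact Or.inr ⟨t, by simpa using h.symm⟩
    | n + 2, h => exact Or.inl ⟨t.drop n, t.take n, by simpa using h⟩
  · rintro (⟨s, t, rfl⟩ | ⟨m, rfl⟩)
    · refine ⟨t ++ s, ?_⟩
      have := @List.isRotated_append _ s ([x, y] ++ t)
      simpa using this
    · refine ⟨m, ?_⟩
      have := @List.isRotated_append _ (y :: m) [x]
      simpa using this

theorem IsPolygonEdge.of_isRotated {l l' : List Point3} (h : l ~r l') {x y : Point3}
    (hl : IsPolygonEdge l x y) : IsPolygonEdge l' x y := by
  obtain ⟨t, ht⟩ := hl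
  exact ⟨t, h.symm.trans ht⟩

theorem isPolygonEdge_congr {l l' : List Point3} (h : l ~r l') {x y : Point3} :
    IsPolygonEdge l x y ↔ IsPolygonEdge l' x y :=
  ⟨.of_isRotated h, .of_isRotated h.symm⟩

theorem pair_infix_cons {α : Type*} {x y a b : α} {l : List α} :
    [x, y] <:+: a :: b :: l ↔ (x = a ∧ y = b) ∨ [x, y] <:+: b :: l := by
  rw [List.infix_cons_iff]
  simp [List.cons_prefix_cons]

theorem cons_eq_cons_append_singleton_iff {α : Type*} {a x y : α} {l : List α} (hl : l ≠ []) :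
    (∃ m, a :: l = y :: m ++ [x]) ↔ a = y ∧ l.getLast hl = x := by
  constructor
  · rintro ⟨m, hm⟩
    simp only [List.cons_append, List.cons.injEq] at hm
    obtain ⟨rfl, rfl⟩ := hm
    simp
  · rintro ⟨rfl, rfl⟩
    exact ⟨l.dropLast, by rw [List.cons_append, List.dropLast_append_getLast]⟩

theorem isPolygonEdge_insert_iff {a q b x y : Point3} {l : List Point3} :
    IsPolygonEdge (a :: q :: b :: l) x y ↔ (x = a ∧ y = q) ∨ (x = q ∧ y = b) ∨
      ([x, y] <:+: b :: l ∨ (a = y ∧ (b :: l).getLast (by simp) = x)) := by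
  rw [isPolygonEdge_iff, pair_infix_cons, pair_infix_cons,
    cons_eq_cons_append_singleton_iff (by simp)]
  simp only [List.getLast_cons (List.cons_ne_nil b l)]
  tauto

theorem isPolygonEdge_cons_cons_iff {a b x y : Point3} {l : List Point3} :
    IsPolygonEdge (a :: b :: l) x y ↔ (x = a ∧ y = b) ∨
      ([x, y] <:+: b :: l ∨ (a = y ∧ (b :: l).getLast (by simp) = x)) := by
  rw [isPolygonEdge_iff, pair_infix_cons, cons_eq_cons_append_singleton_iff (by simp)]
  tauto

theorem IsPolygonEdge.left_mem {l : List Point3} {a b : Point3} (h : IsPolygonEdge l a b) :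
    a ∈ l := by
  obtain ⟨t, ht⟩ := h
  simp [ht.mem_iff]

theorem IsPolygonEdge.right_mem {l : List Point3} {a b : Point3} (h : IsPolygonEdge l a b) :
    b ∈ l := by
  obtain ⟨t, ht⟩ := h
  simp [ht.mem_iff]

theorem List.Nodup.eq_of_isRotated_cons {α : Type*} {a : α} {l l' : List α}
    (hn : (a :: l).Nodup) (h : a :: l ~r a :: l') : l = l' := by
  obtain ⟨n, hn', h⟩ := List.isRotated_iff_mod.1 h
  rw [List.rotate_eq_drop_append_take hn'] at h
  match n, h with
  | 0, h => simpa using h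
  | n + 1, h =>
    by_cases hd : l.drop n = []
    · have : l.take n = l := List.take_of_length_le (List.drop_eq_nil_iff.1 hd)
      simpa [hd, this] using h
    · exfalso
      have h1 : a ∈ l.drop n := by
        obtain ⟨c, r, hc⟩ := List.exists_cons_of_ne_nil hd
        rw [List.drop_succ_cons, hc] at h
        simp only [List.take_succ_cons, List.cons_append, List.cons.injEq] at h
        rw [hc, h.1]; simp
      exact (List.nodup_cons.1 hn).1 (List.mem_of_mem_drop h1)

theorem IsPolygonEdge.right_unique {l : List Point3} (hl : l.Nodup) {a b c : Point3}
    (h : IsPolygonEdge l a b) (h' : IsPolygonEdge l a c) : b = c := by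
  obtain ⟨t, ht⟩ := h
  obtain ⟨t', ht'⟩ := h'
  have := (ht.nodup_iff.1 hl).eq_of_isRotated_cons (ht.symm.trans ht')
  simp only [List.cons.injEq] at this
  exact this.1

theorem IsPolygonEdge.left_unique {l : List Point3} (hl : l.Nodup) {a b c : Point3}
    (h : IsPolygonEdge l a c) (h' : IsPolygonEdge l b c) : a = b := by
  have key : ∀ {u v}, IsPolygonEdge l u v → IsPolygonEdge l.reverse v u := fun {u v} h =>
    PolygonalKnot.isPolygonEdge_reverse (by rwa [List.reverse_reverse])
  exact (key h).right_unique (List.nodup_reverse.2 hl) (key h')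

theorem exists_isPolygonEdge_of_mem {l : List Point3} (hl : 2 ≤ l.length) {a : Point3}
    (ha : a ∈ l) : ∃ b, IsPolygonEdge l a b := by
  obtain ⟨s, t, rfl⟩ := List.append_of_mem ha
  have h : s ++ a :: t ~r a :: (t ++ s) := by
    simpa using @List.isRotated_append _ s (a :: t)
  match hts : t ++ s, h with
  | [], h => have := h.perm.length_eq; simp only [List.length_cons, List.length_nil] at this; omega
  | b :: r, h => exact ⟨b, r, h⟩

theorem isPolygonEdge_map_iff {α : Type*} {L : List α} {f : α → Point3} {x y : Point3} :
    IsPolygonEdge (L.map f) x y ↔ ∃ a b, (∃ t, L ~r a :: b :: t) ∧ x = f a ∧ y = f b := by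
  constructor
  · rintro ⟨t, n, hn⟩
    rw [← List.map_rotate, List.map_eq_cons_iff] at hn
    obtain ⟨a, r, h1, rfl, h2⟩ := hn
    rw [List.map_eq_cons_iff] at h2
    obtain ⟨b, r', rfl, rfl, -⟩ := h2
    exact ⟨a, b, ⟨r', n, h1⟩, rfl, rfl⟩
  · rintro ⟨a, b, ⟨t, ht⟩, rfl, rfl⟩
    exact ⟨t.map f, by simpa using ht.map f⟩

theorem Set.inter_subset_inter_comm {α : Type*} {s t u v : Set α} (h : s ∩ t ⊆ u ∩ v) :
    t ∩ s ⊆ v ∩ u := fun _ hx => ⟨(h ⟨hx.2, hx.1⟩).2, (h ⟨hx.2, hx.1⟩).1⟩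

/-! ### Elementary moves and sets of edges -/

namespace PolygonalKnot

theorem Equiv.refl (K : PolygonalKnot) : K.Equiv K := Relation.EqvGen.refl K

theorem Equiv.symm {K K' : PolygonalKnot} (h : K.Equiv K') : K'.Equiv K :=
  Relation.EqvGen.symm _ _ h

theorem Equiv.trans {K K' K'' : PolygonalKnot} (h : K.Equiv K') (h' : K'.Equiv K'') :
    K.Equiv K'' :=
  Relation.EqvGen.trans _ _ _ h h'

theorem Move.equiv {K K' : PolygonalKnot} (h : Move K K') : K.Equiv K' :=
  Relation.EqvGen.rel _ _ h

theorem ext_vertices {K K' : PolygonalKnot} (h : K.vertices = K'.vertices) : K = K' := by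
  cases K; cases K'; congr

theorem mem_edges {K : PolygonalKnot} {a b : Point3} :
    (a, b) ∈ K.edges ↔ IsPolygonEdge K.vertices a b := Iff.rfl

theorem exists_of_isRotated (K : PolygonalKnot) {l : List Point3} (h : K.vertices ~r l) :
    ∃ K' : PolygonalKnot, K'.vertices = l ∧ K.Equiv K' ∧ K'.edges = K.edges :=
  ⟨{ vertices := l
     three_le := by rw [← h.perm.length_eq]; exact K.three_le
     nodup := h.nodup_iff.1 K.nodup
     simple := fun a b c d hab hcd =>
      K.simple a b c d (hab.of_isRotated h.symm) (hcd.of_isRotated h.symm) },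
    rfl, Move.equiv (.rotate _ _ h), by
      ext ⟨x, y⟩; exact isPolygonEdge_congr h.symm⟩

theorem subset_carrier {K : PolygonalKnot} {a b : Point3} (h : IsPolygonEdge K.vertices a b) :
    segment ℝ a b ⊆ K.carrier := fun _ hx => ⟨(a, b), h, hx⟩

theorem mem_carrier_of_mem {K : PolygonalKnot} {a : Point3} (h : a ∈ K.vertices) :
    a ∈ K.carrier := by
  obtain ⟨b, hb⟩ := exists_isPolygonEdge_of_mem (by have := K.three_le; omega) h
  exact subset_carrier hb (left_mem_segment ℝ a b)

theorem ne_of_edge {K : PolygonalKnot} {a b : Point3} (h : IsPolygonEdge K.vertices a b) :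
    a ≠ b := by
  obtain ⟨t, ht⟩ := h
  have := ht.nodup_iff.1 K.nodup
  simp only [List.nodup_cons, List.mem_cons, not_or] at this
  exact this.1.1

/-- Inserting a vertex replaces one edge by two. -/
theorem insert_edges {a q b : Point3} {l : List Point3} {K K' : PolygonalKnot}
    (hK : K.vertices = a :: b :: l) (hK' : K'.vertices = a :: q :: b :: l) :
    K'.edges = {(a, q), (q, b)} ∪ (K.edges \ {(a, b)}) := by
  ext ⟨x, y⟩
  have hn := K.nodup
  rw [hK] at hn
  have key : ([x, y] <:+: b :: l ∨ (a = y ∧ (b :: l).getLast (by simp) = x)) → ¬ (x = a ∧ y = b) := by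
    rintro (h | ⟨rfl, h⟩) ⟨rfl, rfl⟩
    · exact (List.nodup_cons.1 hn).1 (h.mem (by simp))
    · simp at hn
  simp only [Set.mem_union, Set.mem_insert_iff, Set.mem_singleton_iff, Set.mem_sdiff,
    Prod.mk.injEq, mem_edges, hK, hK', isPolygonEdge_insert_iff]
  rw [isPolygonEdge_cons_cons_iff]
  tauto

/-- An edge `a → b` may be replaced by `a → q → b` as soon as the triangle `a, q, b` meets the knot
only in that edge: simplicity of the new polygon is automatic. -/
theorem exists_insert {K : PolygonalKnot} {a q b : Point3} {l : List Point3}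
    (hK : K.vertices = a :: b :: l) (hqa : q ≠ a) (hqb : q ≠ b)
    (hq : segment ℝ a q ∩ segment ℝ q b ⊆ {q})
    (h : convexHull ℝ {a, q, b} ∩ K.carrier ⊆ segment ℝ a b) :
    ∃ K' : PolygonalKnot, K'.vertices = a :: q :: b :: l ∧ K.Equiv K' := by
  have hab : IsPolygonEdge K.vertices a b := ⟨l, by rw [hK]⟩
  have hqK : q ∉ K.vertices := by
    intro hm
    have h1 : q ∈ segment ℝ a b :=
      h ⟨subset_convexHull ℝ _ (by simp), mem_carrier_of_mem hm⟩
    obtain ⟨d, hd⟩ := exists_isPolygonEdge_of_mem (by have := K.three_le; omega) hm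
    have := K.simple a b q d hab hd (by simp [hqa.symm]) ⟨h1, left_mem_segment ℝ _ _⟩
    rcases this.1 with h2 | h2
    · exact hqa h2
    · exact hqb h2
  have hnd : (a :: q :: b :: l).Nodup := by
    have hn := K.nodup
    rw [hK] at hn hqK
    simp only [List.nodup_cons, List.mem_cons, not_or] at hn hqK ⊢
    refine ⟨⟨hqa.symm, hn.1⟩, ⟨hqK.2.1, hqK.2.2⟩, hn.2⟩
  have haq : segment ℝ a q ⊆ convexHull ℝ {a, q, b} := by
    rw [← convexHull_pair]; exact convexHull_mono (by intro x; simp; tauto)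
  have hqb' : segment ℝ q b ⊆ convexHull ℝ {a, q, b} := by
    rw [← convexHull_pair]; exact convexHull_mono (by intro x; simp; tauto)
  have hE : ∀ x y, IsPolygonEdge (a :: q :: b :: l) x y →
      (x = a ∧ y = q) ∨ (x = q ∧ y = b) ∨ (IsPolygonEdge K.vertices x y ∧ (x, y) ≠ (a, b)) := by
    intro x y hxy
    rw [isPolygonEdge_insert_iff] at hxy
    rcases hxy with h1 | h1 | h1
    · exact Or.inl h1
    · exact Or.inr (Or.inl h1)
    · refine Or.inr (Or.inr ⟨?_, ?_⟩)
      · rw [hK, isPolygonEdge_cons_cons_iff]; exact Or.inr h1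
      · have hn := K.nodup
        rw [hK] at hn
        simp only [ne_eq, Prod.mk.injEq]
        rintro ⟨rfl, rfl⟩
        rcases h1 with h1 | ⟨rfl, -⟩
        · exact (List.nodup_cons.1 hn).1 (h1.mem (by simp))
        · simp at hn
  -- an old edge can meet the two new ones only inside the triangle, hence on `a → b`
  have haq_old : ∀ c d, IsPolygonEdge K.vertices c d → (c, d) ≠ (a, b) →
      segment ℝ a q ∩ segment ℝ c d ⊆ {a, q} ∩ {c, d} := by
    rintro c d hcd hne p ⟨hp, hp'⟩
    have h1 := h ⟨haq hp, subset_carrier hcd hp'⟩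
    have h2 := K.simple a b c d hab hcd hne.symm ⟨h1, hp'⟩
    refine ⟨?_, h2.2⟩
    rcases h2.1 with rfl | h3
    · simp
    · rw [Set.mem_singleton_iff] at h3
      subst h3
      exact absurd (hq ⟨hp, right_mem_segment ℝ _ _⟩) (fun h => hqb h.symm)
  have hqb_old : ∀ c d, IsPolygonEdge K.vertices c d → (c, d) ≠ (a, b) →
      segment ℝ q b ∩ segment ℝ c d ⊆ {q, b} ∩ {c, d} := by
    rintro c d hcd hne p ⟨hp, hp'⟩
    have h1 := h ⟨hqb' hp, subset_carrier hcd hp'⟩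
    have h2 := K.simple a b c d hab hcd hne.symm ⟨h1, hp'⟩
    refine ⟨?_, h2.2⟩
    rcases h2.1 with rfl | h3
    · exact absurd (hq ⟨left_mem_segment ℝ _ _, hp⟩) (fun h => hqa h.symm)
    · simp only [Set.mem_singleton_iff] at h3
      simp [h3]
  have hq2 : segment ℝ a q ∩ segment ℝ q b ⊆ {a, q} ∩ {q, b} := by
    intro p hp
    have := hq hp
    simp only [Set.mem_singleton_iff] at this
    simp [this]
  let K' : PolygonalKnot :=
    { vertices := a :: q :: b :: l
      three_le := by simp
      nodup := hnd
      simple := by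
        intro x y c d hxy hcd hne
        rcases hE x y hxy with ⟨rfl, rfl⟩ | ⟨rfl, rfl⟩ | ⟨h1, h1'⟩ <;>
          rcases hE c d hcd with ⟨rfl, rfl⟩ | ⟨rfl, rfl⟩ | ⟨h2, h2'⟩
        · exact absurd rfl hne
        · exact hq2
        · exact haq_old _ _ h2 h2'
        · exact Set.inter_subset_inter_comm hq2
        · exact absurd rfl hne
        · exact hqb_old _ _ h2 h2'
        · exact Set.inter_subset_inter_comm (haq_old _ _ h1 h1')
        · exact Set.inter_subset_inter_comm (hqb_old _ _ h1 h1')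
        · exact K.simple _ _ _ _ h1 h2 hne }
  exact ⟨K', rfl, Move.equiv (.triangle K K' a b q l hK rfl h)⟩

theorem Equiv.reverse {K K' : PolygonalKnot} (h : K.Equiv K') : K.reverse.Equiv K'.reverse := by
  induction h with
  | rel K K' h =>
    cases h with
    | rotate h => exact Move.equiv (.rotate _ _ h.reverse)
    | triangle a b q l hK hK' h =>
      have h1 : K.reverse.vertices ~r b :: a :: l.reverse := by
        simpa [PolygonalKnot.reverse, hK] using @List.isRotated_append _ l.reverse [b, a]
      have h2 : K'.reverse.vertices ~r b :: q :: a :: l.reverse := by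
        simpa [PolygonalKnot.reverse, hK'] using @List.isRotated_append _ l.reverse [b, q, a]
      obtain ⟨K1, hK1, e1, -⟩ := K.reverse.exists_of_isRotated h1
      obtain ⟨K2, hK2, e2, -⟩ := K'.reverse.exists_of_isRotated h2
      refine e1.trans (Equiv.trans (Move.equiv ?_) e2.symm)
      refine .triangle K1 K2 b a q l.reverse hK1 hK2 ?_
      have hc : K1.carrier = K.carrier := by
        have hrev : ∀ x y, IsPolygonEdge K1.vertices x y ↔ IsPolygonEdge K.vertices y x := by
          intro x y
          rw [hK1, ← isPolygonEdge_congr h1]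
          refine ⟨isPolygonEdge_reverse, fun h => isPolygonEdge_reverse ?_⟩
          simpa [PolygonalKnot.reverse] using h
        ext p
        constructor
        · rintro ⟨⟨x, y⟩, hxy, hp⟩
          exact ⟨(y, x), (hrev _ _).1 hxy, by rwa [segment_symm]⟩
        · rintro ⟨⟨x, y⟩, hxy, hp⟩
          exact ⟨(y, x), (hrev _ _).2 hxy, by rwa [segment_symm]⟩
      have ht : ({b, q, a} : Set Point3) = {a, q, b} := by ext; simp; tauto
      rw [hc, ht, segment_symm]
      exact h
  | refl K => exact Equiv.refl _
  | symm K K' _ ih => exact ih.symm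
  | trans K K' K'' _ _ ih1 ih2 => exact ih1.trans ih2

theorem reverse_reverse (K : PolygonalKnot) : K.reverse.reverse = K :=
  ext_vertices (List.reverse_reverse _)

theorem mem_edges_reverse {K : PolygonalKnot} {a b : Point3} :
    (a, b) ∈ K.reverse.edges ↔ (b, a) ∈ K.edges := by
  refine ⟨isPolygonEdge_reverse, fun h => isPolygonEdge_reverse ?_⟩
  simpa [PolygonalKnot.reverse] using mem_edges.1 h

end PolygonalKnot

open PolygonalKnot

theorem EdgesRepresent.reverse {E : Set (Point3 × Point3)} {K : PolygonalKnot}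
    (h : EdgesRepresent E K) : EdgesRepresent (Prod.swap ⁻¹' E) K.reverse := by
  obtain ⟨P, rfl, hP⟩ := h
  refine ⟨P.reverse, ?_, hP.reverse⟩
  ext ⟨x, y⟩
  exact mem_edges_reverse

theorem exists_ne_of_segment {a q b : Point3} (hq : q ∈ openSegment ℝ a b) (hab : a ≠ b) :
    q ≠ a ∧ q ≠ b := by
  obtain ⟨s, t, hs, ht, hst, rfl⟩ := hq
  constructor
  · intro h
    apply hab
    have : t • (a - b) = 0 := by
      have h2 : s = 1 - t := by linarith
      subst h2
      linear_combination (norm := module) (-1 : ℝ) • h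
    rcases smul_eq_zero.1 this with h | h
    · exact absurd h ht.ne'
    · exact sub_eq_zero.1 h
  · intro h
    apply hab
    have : s • (a - b) = 0 := by
      have h2 : t = 1 - s := by linarith
      subst h2
      linear_combination (norm := module) (1 : ℝ) • h
    rcases smul_eq_zero.1 this with h | h
    · exact absurd h hs.ne'
    · exact sub_eq_zero.1 h

theorem segment_inter_of_mem_openSegment {a q b : Point3} (hq : q ∈ openSegment ℝ a b)
    (hab : a ≠ b) : segment ℝ a q ∩ segment ℝ q b ⊆ {q} := by
  obtain ⟨s, t, hs, ht, hst, rfl⟩ := hq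
  rintro p ⟨⟨u, v, hu, hv, huv, rfl⟩, ⟨u', v', hu', hv', huv', h⟩⟩
  have hs' : s = 1 - t := by linarith
  have hv1 : u = 1 - v := by linarith
  have hv2 : u' = 1 - v' := by linarith
  subst hs' hv1 hv2
  have h1 : ((1 - v) * t + v' * (1 - t)) • (a - b) = 0 := by
    linear_combination (norm := module) (-1 : ℝ) • h
  rcases smul_eq_zero.1 h1 with h2 | h2
  · have h3 : (1 - v) * t = 0 := by nlinarith [mul_nonneg hu ht.le, mul_nonneg hv' hs.le]
    have h4 : v = 1 := by
      rcases mul_eq_zero.1 h3 with h | h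
      · linarith
      · exact absurd h ht.ne'
    subst h4
    simp
  · exact absurd (sub_eq_zero.1 h2) hab

theorem triangle_subset_segment {a q b : Point3} (hq : q ∈ segment ℝ a b) :
    convexHull ℝ {a, q, b} ⊆ segment ℝ a b := by
  refine convexHull_min ?_ (convex_segment a b)
  rintro x (rfl | rfl | rfl)
  · exact left_mem_segment ℝ _ _
  · exact hq
  · exact right_mem_segment ℝ _ _

/-- Subdividing an edge does not change the knot. -/
theorem EdgesRepresent.subdivide {E : Set (Point3 × Point3)} {K : PolygonalKnot} {a q b : Point3}
    (hE : (a, b) ∉ E) (hq : q ∈ openSegment ℝ a b)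
    (h : EdgesRepresent (insert (a, b) E) K) :
    EdgesRepresent (insert (a, q) (insert (q, b) E)) K := by
  obtain ⟨P, hP, hPK⟩ := h
  obtain ⟨t, ht⟩ : IsPolygonEdge P.vertices a b := by
    rw [← mem_edges, hP]; simp
  obtain ⟨P1, hP1, e1, hE1⟩ := P.exists_of_isRotated ht
  have hab : a ≠ b := P1.ne_of_edge ⟨t, by rw [hP1]⟩
  obtain ⟨hqa, hqb⟩ := exists_ne_of_segment hq hab
  obtain ⟨P2, hP2, e2⟩ := exists_insert hP1 hqa hqb (segment_inter_of_mem_openSegment hq hab)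
    (Set.inter_subset_left.trans (triangle_subset_segment (openSegment_subset_segment ℝ _ _ hq)))
  refine ⟨P2, ?_, (e1.trans e2).symm.trans hPK⟩
  rw [insert_edges hP1 hP2, hE1, hP]
  ext ⟨x, y⟩
  simp only [Set.mem_union, Set.mem_insert_iff, Set.mem_sdiff, Set.mem_singleton_iff]
  constructor
  · tauto
  · rintro (h | h | h)
    · tauto
    · tauto
    · exact Or.inr ⟨Or.inr h, fun h' => hE (h' ▸ h)⟩

theorem segment_subset_union {a q b : Point3} (hq : q ∈ segment ℝ a b) :
    segment ℝ a b ⊆ segment ℝ a q ∪ segment ℝ q b := by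
  obtain ⟨s, t, hs, ht, hst, rfl⟩ := hq
  rintro p ⟨u, v, hu, hv, huv, rfl⟩
  have hs' : s = 1 - t := by linarith
  have hu' : u = 1 - v := by linarith
  subst hs' hu'
  rcases le_total v t with hvt | hvt
  · left
    rcases eq_or_lt_of_le ht with rfl | ht0
    · have : v = 0 := le_antisymm hvt hv
      subst this
      simp
    · refine ⟨1 - v / t, v / t, by rw [sub_nonneg, div_le_one ht0]; exact hvt, by positivity,
        by ring, ?_⟩
      have : v / t * t = v := by field_simp
      linear_combination (norm := module) this • (b - a)
  · right
    rcases eq_or_lt_of_le hs with h0 | ht0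
    · have h1 : t = 1 := by linarith
      have : v = 1 := by linarith
      subst h1 this
      simp
    · refine ⟨(1 - v) / (1 - t), (v - t) / (1 - t), by positivity,
        div_nonneg (by linarith) ht0.le, ?_, ?_⟩
      · field_simp; ring
      · have h2 : (1 - v) / (1 - t) * (1 - t) = 1 - v := by field_simp
        have h3 : (v - t) / (1 - t) = 1 - (1 - v) / (1 - t) := by field_simp; ring
        rw [h3]
        linear_combination (norm := module) h2 • (a - b)

/-- Removing a vertex at which the polygon is straight does not change the knot. -/
theorem EdgesRepresent.unsubdivide {E : Set (Point3 × Point3)} {K : PolygonalKnot}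
    {a q b : Point3} (hab : a ≠ b) (hE : (a, q) ∉ E) (hE' : (q, b) ∉ E)
    (hq : q ∈ openSegment ℝ a b)
    (h : EdgesRepresent (insert (a, q) (insert (q, b) E)) K) :
    EdgesRepresent (insert (a, b) E) K := by
  obtain ⟨P, hP, hPK⟩ := h
  have hq' := openSegment_subset_segment ℝ _ _ hq
  obtain ⟨hqa, hqb⟩ := exists_ne_of_segment hq hab
  have haq : IsPolygonEdge P.vertices a q := by
    rw [← mem_edges, hP]; simp
  have hqb1 : IsPolygonEdge P.vertices q b := by
    rw [← mem_edges, hP]; simp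
  obtain ⟨t, ht⟩ := id haq
  obtain ⟨P1, hP1, e1, hE1⟩ := P.exists_of_isRotated ht
  have hqb2 : IsPolygonEdge P1.vertices q b := by rw [← mem_edges, hE1]; exact hqb1
  have haq2 : IsPolygonEdge P1.vertices a q := by rw [← mem_edges, hE1]; exact haq
  obtain ⟨l, rfl⟩ : ∃ l, t = b :: l := by
    have h3 := P1.three_le
    rw [hP1] at h3
    match t, hP1, h3 with
    | c :: l, hP1, _ =>
      refine ⟨l, ?_⟩
      have : IsPolygonEdge P1.vertices q c := by
        rw [hP1, isPolygonEdge_insert_iff]; simp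
      rw [this.right_unique P1.nodup hqb2]
  have hnd := P1.nodup
  rw [hP1] at hnd
  -- at least three vertices remain, as otherwise `b → a` would run back through `q`
  have hl : l ≠ [] := by
    rintro rfl
    have hba : IsPolygonEdge P1.vertices b a := by
      rw [hP1, isPolygonEdge_insert_iff]; simp
    have := P1.simple b a a q hba haq2 (by simp [hab.symm])
      ⟨by rw [segment_symm]; exact hq', right_mem_segment ℝ _ _⟩
    rcases this.1 with h1 | h1
    · exact hqb h1
    · exact hqa h1
  have hold : ∀ c d, IsPolygonEdge (a :: b :: l) c d → (c = a ∧ d = b) ∨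
      (IsPolygonEdge P1.vertices c d ∧ (c, d) ≠ (a, q) ∧ (c, d) ≠ (q, b)) := by
    intro c d hcd
    have hq1 : q ∉ a :: b :: l := by
      simp only [List.nodup_cons, List.mem_cons, not_or] at hnd ⊢
      exact ⟨hqa, hnd.2.1⟩
    have hc := hcd.left_mem
    have hd := hcd.right_mem
    rw [isPolygonEdge_cons_cons_iff] at hcd
    rcases hcd with h1 | h1
    · exact Or.inl h1
    · refine Or.inr ⟨?_, ?_, ?_⟩
      · rw [hP1, isPolygonEdge_insert_iff]; exact Or.inr (Or.inr h1)
      · simp only [ne_eq, Prod.mk.injEq]; rintro ⟨rfl, rfl⟩; exact hq1 hd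
      · simp only [ne_eq, Prod.mk.injEq]; rintro ⟨rfl, rfl⟩; exact hq1 hc
  have hab_old : ∀ c d, IsPolygonEdge (a :: b :: l) c d → (c, d) ≠ (a, b) →
      segment ℝ a b ∩ segment ℝ c d ⊆ {a, b} ∩ {c, d} := by
    rintro c d hcd hne p ⟨hp, hp'⟩
    have hq1 : q ∉ a :: b :: l := by
      simp only [List.nodup_cons, List.mem_cons, not_or] at hnd ⊢
      exact ⟨hqa, hnd.2.1⟩
    rcases hold c d hcd with ⟨rfl, rfl⟩ | ⟨h1, h2, h3⟩
    · exact absurd rfl hne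
    · rcases segment_subset_union hq' hp with hp1 | hp1
      · have := P1.simple a q c d haq2 h1 h2.symm ⟨hp1, hp'⟩
        refine ⟨?_, this.2⟩
        rcases this.1 with h4 | h4
        · exact Or.inl h4
        · rw [Set.mem_singleton_iff] at h4
          subst h4
          exfalso
          rcases this.2 with h5 | h5
          · exact hq1 (h5 ▸ hcd.left_mem)
          · exact hq1 ((Set.mem_singleton_iff.1 h5) ▸ hcd.right_mem)
      · have := P1.simple q b c d hqb2 h1 h3.symm ⟨hp1, hp'⟩
        refine ⟨?_, this.2⟩
        rcases this.1 with h4 | h4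
        · subst h4
          exfalso
          rcases this.2 with h5 | h5
          · exact hq1 (h5 ▸ hcd.left_mem)
          · exact hq1 ((Set.mem_singleton_iff.1 h5) ▸ hcd.right_mem)
        · exact Or.inr h4
  let P2 : PolygonalKnot :=
    { vertices := a :: b :: l
      three_le := by
        have := List.length_pos_of_ne_nil hl
        simp only [List.length_cons]; omega
      nodup := by
        simp only [List.nodup_cons, List.mem_cons, not_or] at hnd ⊢
        tauto
      simple := by
        intro x y c d hxy hcd hne
        by_cases h1 : (x, y) = (a, b)
        · obtain ⟨rfl, rfl⟩ := Prod.mk.inj h1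
          exact hab_old c d hcd hne.symm
        by_cases h2 : (c, d) = (a, b)
        · obtain ⟨rfl, rfl⟩ := Prod.mk.inj h2
          exact Set.inter_subset_inter_comm (hab_old x y hxy hne)
        rcases hold x y hxy with ⟨rfl, rfl⟩ | ⟨h3, -⟩
        · exact absurd rfl h1
        rcases hold c d hcd with ⟨rfl, rfl⟩ | ⟨h4, -⟩
        · exact absurd rfl h2
        exact P1.simple _ _ _ _ h3 h4 hne }
  have hm : P2.Equiv P1 := Move.equiv (.triangle P2 P1 a b q l rfl hP1
    (Set.inter_subset_left.trans (triangle_subset_segment hq')))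
  refine ⟨P2, ?_, (hm.trans e1.symm).trans hPK⟩
  have hins := insert_edges (K := P2) rfl hP1
  have hab2 : (a, b) ∈ P2.edges := by
    rw [mem_edges, isPolygonEdge_cons_cons_iff]; simp
  rw [hE1, hP] at hins
  have hnot : (a, q) ∉ P2.edges ∧ (q, b) ∉ P2.edges := by
    have hq1 : q ∉ a :: b :: l := by
      simp only [List.nodup_cons, List.mem_cons, not_or] at hnd ⊢
      exact ⟨hqa, hnd.2.1⟩
    exact ⟨fun h => hq1 (IsPolygonEdge.right_mem h), fun h => hq1 (IsPolygonEdge.left_mem h)⟩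
  have h0 : (a, b) ∉ E := by
    intro h
    have : (a, b) ∈ P.edges := by rw [hP]; simp [h]
    exact hqb (haq.right_unique P.nodup this)
  ext e
  have := Set.ext_iff.1 hins e
  simp only [Set.mem_union, Set.mem_insert_iff, Set.mem_sdiff, Set.mem_singleton_iff] at this ⊢
  by_cases h1 : e = (a, b)
  · subst h1; simp [hab2]
  · by_cases h2 : e = (a, q)
    · subst h2; simp [hnot.1, h1, hE]
    · by_cases h3 : e = (q, b)
      · subst h3; simp [hnot.2, h1, hE']
      · simp only [h1, h2, h3, false_or, not_false_eq_true, and_true] at this ⊢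
        exact this.symm

/-! ### Isotopies of polygons through simple polygons -/

section Loops

variable {α : Type*}

/-- The directed edges of the family of closed polygons with vertices `f a`, in which `s a` is the
vertex that follows `a`. -/
def loopEdges (s : α → α) (f : α → Point3) : Set (Point3 × Point3) :=
  {e | ∃ a, e = (f a, f (s a))}

/-- The closed polygons with vertices `f a` and successor map `s` are simple and disjoint: the
half-open edges, which contain their starting point but not their end point, are pairwise
disjoint. -/
structure SimpleLoop (s : α → α) (f : α → Point3) : Prop where
  ne : ∀ a, f a ≠ f (s a)
  disjoint : ∀ (a b : α) (τ τ' : ℝ), 0 ≤ τ → τ < 1 → 0 ≤ τ' → τ' < 1 →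
    (1 - τ) • f a + τ • f (s a) = (1 - τ') • f b + τ' • f (s b) → a = b

/-- A reformulation of simplicity by inequalities over compact parameter sets, which makes it
evidently an open condition on `f`. -/
structure RobustLoop (s : α → α) (f : α → Point3) : Prop where
  /-- edges that are not adjacent are disjoint -/
  far : ∀ a b, b ≠ a → b ≠ s a → a ≠ s b → ∀ p ∈ Set.Icc (0 : ℝ) 1 ×ˢ Set.Icc (0 : ℝ) 1,
    ((1 - p.1) • f a + p.1 • f (s a)) - ((1 - p.2) • f b + p.2 • f (s b)) ≠ 0
  /-- two consecutive edges do not point in the same direction from their common end point -/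
  near : ∀ a, ∀ τ ∈ Set.Icc (0 : ℝ) 1,
    τ • (f a - f (s a)) - (1 - τ) • (f (s (s a)) - f (s a)) ≠ 0

theorem SimpleLoop.robust {s : α → α} {f : α → Point3} (hs : Function.Injective s)
    (h : SimpleLoop s f) : RobustLoop s f := by
  constructor
  · rintro a b hba hbs has ⟨τ, τ'⟩ ⟨⟨h0, h1⟩, ⟨h0', h1'⟩⟩ heq
    simp only at h0 h1 h0' h1' heq
    rw [sub_eq_zero] at heq
    rcases eq_or_lt_of_le h1 with rfl | h1 <;> rcases eq_or_lt_of_le h1' with rfl | h1'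
    · apply hba
      apply hs
      exact (h.disjoint (s a) (s b) 0 0 le_rfl one_pos le_rfl one_pos (by simpa using heq)).symm
    · exact hbs (h.disjoint (s a) b 0 τ' le_rfl one_pos h0' h1' (by simpa using heq)).symm
    · exact has (h.disjoint a (s b) τ 0 h0 h1 le_rfl one_pos (by simpa using heq))
    · exact hba (h.disjoint a b τ τ' h0 h1 h0' h1' heq).symm
  · rintro a τ ⟨h0, h1⟩ heq
    rw [sub_eq_zero] at heq
    have hne : ∀ c, s c ≠ c := fun c hc => h.ne c (by rw [hc])
    rcases eq_or_lt_of_le h0 with rfl | h0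
    · simp only [zero_smul, sub_zero, one_smul] at heq
      exact h.ne (s a) (sub_eq_zero.1 heq.symm).symm
    · refine hne a (h.disjoint a (s a) (1 - τ) (1 - τ) (by linarith) (by linarith) (by linarith)
        (by linarith) ?_).symm
      linear_combination (norm := module) (1 : ℝ) • heq

theorem isOpen_setOf_forall_compact_ne_zero {X Y : Type*} [TopologicalSpace X]
    [TopologicalSpace Y] {K : Set Y} (hK : IsCompact K) {F : X → Y → Point3}
    (hF : Continuous (Function.uncurry F)) : IsOpen {x | ∀ y ∈ K, F x y ≠ 0} := by
  rw [isOpen_iff_eventually]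
  intro x hx
  refine hK.eventually_forall_of_forall_eventually fun y hy => ?_
  exact (hF.continuousAt (x := (x, y))).eventually_ne (hx y hy)

/-- Simplicity is stable under small perturbations of the vertices. -/
theorem isOpen_robustLoop [Finite α] (s : α → α) : IsOpen {f : α → Point3 | RobustLoop s f} := by
  have : {f : α → Point3 | RobustLoop s f} =
      (⋂ (a : α) (b : α) (_ : b ≠ a) (_ : b ≠ s a) (_ : a ≠ s b),
        {f | ∀ p ∈ Set.Icc (0 : ℝ) 1 ×ˢ Set.Icc (0 : ℝ) 1,
          ((1 - p.1) • f a + p.1 • f (s a)) - ((1 - p.2) • f b + p.2 • f (s b)) ≠ 0}) ∩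
      ⋂ (a : α), {f | ∀ τ ∈ Set.Icc (0 : ℝ) 1,
        τ • (f a - f (s a)) - (1 - τ) • (f (s (s a)) - f (s a)) ≠ 0} := by
    ext f
    simp only [Set.mem_inter_iff, Set.mem_iInter, Set.mem_ofPred_eq]
    exact ⟨fun h => ⟨h.far, h.near⟩, fun h => ⟨h.1, h.2⟩⟩
  rw [this]
  refine IsOpen.inter ?_ ?_
  · refine isOpen_iInter_of_finite fun a => isOpen_iInter_of_finite fun b =>
      isOpen_iInter_of_finite fun _ => isOpen_iInter_of_finite fun _ =>
      isOpen_iInter_of_finite fun _ => ?_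
    exact isOpen_setOf_forall_compact_ne_zero (isCompact_Icc.prod isCompact_Icc)
      (F := fun (f : α → Point3) (p : ℝ × ℝ) =>
        ((1 - p.1) • f a + p.1 • f (s a)) - ((1 - p.2) • f b + p.2 • f (s b))) (by
        unfold Function.uncurry; fun_prop)
  · refine isOpen_iInter_of_finite fun a => ?_
    exact isOpen_setOf_forall_compact_ne_zero isCompact_Icc
      (F := fun (f : α → Point3) (τ : ℝ) =>
        τ • (f a - f (s a)) - (1 - τ) • (f (s (s a)) - f (s a))) (by
        unfold Function.uncurry; fun_prop)

theorem segment_inter_subset_of_forall {u v w : Point3}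
    (h : ∀ τ ∈ Set.Icc (0 : ℝ) 1, τ • (u - v) - (1 - τ) • (w - v) ≠ 0) :
    segment ℝ u v ∩ segment ℝ v w ⊆ {v} := by
  rintro p ⟨⟨a, b, ha, hb, hab, rfl⟩, ⟨c, d, hc, hd, hcd, hp⟩⟩
  have hb' : b = 1 - a := by linarith
  have hc' : c = 1 - d := by linarith
  subst hb' hc'
  by_cases h0 : a + d = 0
  · have : a = 0 := by linarith
    subst this
    simp
  · exfalso
    have hpos : 0 < a + d := lt_of_le_of_ne (by positivity) (Ne.symm h0)
    refine h (a / (a + d)) ⟨by positivity, by rw [div_le_one hpos]; linarith⟩ ?_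
    have h1 : 1 - a / (a + d) = d / (a + d) := by field_simp; ring
    have h2 : a • (u - v) - d • (w - v) = 0 := by
      linear_combination (norm := module) (-1 : ℝ) • hp
    rw [h1, div_eq_inv_mul, div_eq_inv_mul, mul_smul, mul_smul, ← smul_sub, h2, smul_zero]

theorem mem_segment_iff_exists {u v p : Point3} :
    p ∈ segment ℝ u v ↔ ∃ τ ∈ Set.Icc (0 : ℝ) 1, p = (1 - τ) • u + τ • v := by
  constructor
  · rintro ⟨a, b, ha, hb, hab, rfl⟩
    exact ⟨b, ⟨hb, by linarith⟩, by rw [← hab]; simp⟩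
  · rintro ⟨τ, ⟨h0, h1⟩, rfl⟩
    exact ⟨1 - τ, τ, by linarith, h0, by ring, rfl⟩

theorem RobustLoop.near_inter {s : α → α} {f : α → Point3} (h : RobustLoop s f) (a : α) :
    segment ℝ (f a) (f (s a)) ∩ segment ℝ (f (s a)) (f (s (s a))) ⊆ {f (s a)} :=
  segment_inter_subset_of_forall (h.near a)

theorem RobustLoop.far_inter {s : α → α} {f : α → Point3} (h : RobustLoop s f) {a b : α}
    (hba : b ≠ a) (hbs : b ≠ s a) (has : a ≠ s b) {p : Point3}
    (hp : p ∈ segment ℝ (f a) (f (s a))) (hp' : p ∈ segment ℝ (f b) (f (s b))) : False := by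
  obtain ⟨τ, hτ, rfl⟩ := mem_segment_iff_exists.1 hp
  obtain ⟨τ', hτ', hp'⟩ := mem_segment_iff_exists.1 hp'
  exact h.far a b hba hbs has (τ, τ') ⟨hτ, hτ'⟩ (sub_eq_zero.2 hp')

theorem RobustLoop.ne {s : α → α} {f : α → Point3} (h : RobustLoop s f) (a : α) :
    f a ≠ f (s a) := by
  intro h0
  exact h.near a 1 (by simp) (by simp [h0])

theorem RobustLoop.inter {s : α → α} {f : α → Point3} (h : RobustLoop s f) {a b : α}
    (hab : a ≠ b) : segment ℝ (f a) (f (s a)) ∩ segment ℝ (f b) (f (s b)) ⊆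
      {f a, f (s a)} ∩ {f b, f (s b)} := by
  by_cases h1 : b = s a
  · subst h1
    intro p hp
    have := h.near_inter a hp
    simp only [Set.mem_singleton_iff] at this
    simp [this]
  · by_cases h2 : a = s b
    · subst h2
      intro p hp
      have := h.near_inter b ⟨hp.2, hp.1⟩
      simp only [Set.mem_singleton_iff] at this
      simp [this]
    · rintro p ⟨hp, hp'⟩
      exact (h.far_inter hab.symm h1 h2 hp hp').elim

theorem RobustLoop.injective {s : α → α} {f : α → Point3} (h : RobustLoop s f) :
    Function.Injective f := by
  intro a b hab
  by_contra hne
  by_cases h1 : b = s a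
  · exact h.ne a (hab.trans (by rw [h1]))
  · by_cases h2 : a = s b
    · exact h.ne b (hab.symm.trans (by rw [h2]))
    · exact h.far_inter (Ne.symm hne) h1 h2 (left_mem_segment ℝ _ _)
        (by rw [hab]; exact left_mem_segment ℝ _ _)

/-- `L` lists the elements of `α` in the cyclic order given by the successor map `s`. -/
structure IsCyclicList (s : α → α) (L : List α) : Prop where
  nodup : L.Nodup
  three_le : 3 ≤ L.length
  mem : ∀ a, a ∈ L
  edge : ∀ a b, (∃ t, L ~r a :: b :: t) ↔ b = s a

namespace IsCyclicList

variable {s : α → α} {L : List α} (hL : IsCyclicList s L)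
include hL

theorem isPolygonEdge_iff {f : α → Point3} {x y : Point3} :
    IsPolygonEdge (L.map f) x y ↔ ∃ a, x = f a ∧ y = f (s a) := by
  rw [isPolygonEdge_map_iff]
  constructor
  · rintro ⟨a, b, h, rfl, rfl⟩
    exact ⟨a, rfl, by rw [(hL.edge a b).1 h]⟩
  · rintro ⟨a, rfl, rfl⟩
    exact ⟨a, s a, (hL.edge _ _).2 rfl, rfl, rfl⟩

theorem exists_rotation (a' : α) : ∃ l, L ~r a' :: s a' :: s (s a') :: l := by
  obtain ⟨t, ht⟩ := (hL.edge a' _).2 rfl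
  have h3 := hL.three_le
  rw [ht.perm.length_eq] at h3
  match t, ht, h3 with
  | b :: l, ht, _ =>
    have : b = s (s a') := (hL.edge _ _).1
      ⟨l ++ [a'], ht.trans (by simpa using @List.isRotated_append _ [a'] (s a' :: b :: l))⟩
    exact ⟨l, this ▸ ht⟩

omit hL in
/-- The polygonal knot with vertices `f a`, in the order given by `L`. -/
def knot (hL : IsCyclicList s L) (f : α → Point3) (hf : RobustLoop s f) : PolygonalKnot where
  vertices := L.map f
  three_le := by simpa using hL.three_le
  nodup := hL.nodup.map hf.injective
  simple := by
    intro a b c d hab hcd hne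
    obtain ⟨i, rfl, rfl⟩ := hL.isPolygonEdge_iff.1 hab
    obtain ⟨j, rfl, rfl⟩ := hL.isPolygonEdge_iff.1 hcd
    exact hf.inter (fun h => hne (by rw [h]))

theorem knot_edges (f : α → Point3) (hf : RobustLoop s f) :
    (hL.knot f hf).edges = loopEdges s f := by
  ext ⟨x, y⟩
  refine (hL.isPolygonEdge_iff (f := f)).trans ?_
  simp [loopEdges]

theorem mem_carrier {f : α → Point3} {hf : RobustLoop s f} {p : Point3} :
    p ∈ (hL.knot f hf).carrier ↔ ∃ c, p ∈ segment ℝ (f c) (f (s c)) := by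
  constructor
  · rintro ⟨⟨x, y⟩, h, hp⟩
    rw [hL.knot_edges] at h
    obtain ⟨c, hc⟩ := h
    obtain ⟨rfl, rfl⟩ := Prod.mk.inj hc
    exact ⟨c, hp⟩
  · rintro ⟨c, hp⟩
    exact ⟨(f c, f (s c)), by rw [hL.knot_edges]; exact ⟨c, rfl⟩, hp⟩

end IsCyclicList

/-- Points of a triangle lie on segments from a corner to the opposite side. -/
theorem exists_of_mem_triangle {q q' b p : Point3} (hp : p ∈ convexHull ℝ {b, q, q'}) :
    ∃ t ∈ Set.Icc (0 : ℝ) 1, ∃ θ ∈ Set.Icc (0 : ℝ) 1,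
      p = (1 - θ) • b + θ • ((1 - t) • q + t • q') := by
  rw [convexHull_insert (by simp), convexHull_pair] at hp
  simp only [convexJoin_singleton_left, Set.mem_iUnion, exists_prop] at hp
  obtain ⟨r, hr, hp⟩ := hp
  obtain ⟨t, ht, rfl⟩ := mem_segment_iff_exists.1 hr
  obtain ⟨θ, hθ, rfl⟩ := mem_segment_iff_exists.1 hp
  exact ⟨t, ht, θ, hθ, rfl⟩

theorem eq_zero_of_smul_mem {V : Type*} [AddCommGroup V] [Module ℝ V] {W : Submodule ℝ V} {e : V}
    (he : e ∉ W) {c : ℝ} (hc : c • e ∈ W) : c = 0 := by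
  by_contra h
  exact he ((W.smul_mem_iff h).1 hc)

/-- Moving one vertex, in a direction that leaves the plane spanned by its two edges, as long as the
polygon stays simple on the way. This is a composition of two triangle moves: the new position `q'`
is inserted after the old one, and the old one is then removed, as a vertex between its
predecessor and `q'`. -/
theorem IsCyclicList.equiv_update [DecidableEq α] {s : α → α} {L : List α} (hL : IsCyclicList s L)
    {f : α → Point3} {a' : α} {q' : Point3} (hf : RobustLoop s f)
    (hf' : RobustLoop s (Function.update f (s a') q'))
    (hrob : ∀ t ∈ Set.Icc (0 : ℝ) 1,
      RobustLoop s (Function.update f (s a') ((1 - t) • f (s a') + t • q')))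
    (he : q' - f (s a') ∉
      Submodule.span ℝ {f a' - f (s a'), f (s (s a')) - f (s a')}) :
    (hL.knot f hf).Equiv (hL.knot _ hf') := by
  obtain ⟨l, hl⟩ := hL.exists_rotation a'
  set a := s a' with ha
  set b := s a with hb
  have hnd := hl.nodup_iff.1 hL.nodup
  simp only [List.nodup_cons, List.mem_cons, not_or] at hnd
  obtain ⟨⟨ha'a, ha'b, ha'l⟩, ⟨hab, hal⟩, hbl, -⟩ := hnd
  set W := Submodule.span ℝ {f a' - f a, f b - f a} with hW
  have hA : f a' - f a ∈ W := Submodule.subset_span (by simp)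
  have hB : f b - f a ∈ W := Submodule.subset_span (by simp)
  set g := Function.update f a q' with hg
  have hga : g a = q' := by simp [hg]
  have hgo : ∀ c, c ≠ a → g c = f c := fun c hc => by simp [hg, hc]
  have hs : Function.Injective s := by
    intro c d hcd
    have h1 := hL.isPolygonEdge_iff (f := f) (x := f c) (y := f (s c))
    have h2 := hL.isPolygonEdge_iff (f := f) (x := f d) (y := f (s c))
    exact hf.injective (IsPolygonEdge.left_unique (hL.nodup.map hf.injective)
      (h1.2 ⟨c, rfl, rfl⟩) (h2.2 ⟨d, rfl, by rw [hcd]⟩))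
  -- both polygons are rotated to lists that start at the moving vertex or at its predecessor
  obtain ⟨K1, hK1, e1, hE1⟩ := (hL.knot f hf).exists_of_isRotated
    (l := f a :: f b :: (l ++ [a']).map f) (by
      have : L ~r a :: b :: (l ++ [a']) :=
        hl.trans (by simpa using @List.isRotated_append _ [a'] (a :: b :: l))
      simpa [IsCyclicList.knot] using this.map f)
  have hc1 : K1.carrier = (hL.knot f hf).carrier := by simp only [carrier, hE1]
  obtain ⟨K2, hK2, e2, hE2⟩ := (hL.knot g hf').exists_of_isRotated
    (l := f a' :: q' :: f b :: l.map f) (by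
      have := hl.map g
      have hgl : l.map g = l.map f := List.map_congr_left fun c hc => hgo c (by
        rintro rfl; exact hal hc)
      simpa [IsCyclicList.knot, hga, hgo a' ha'a, hgo b (Ne.symm hab), hgl] using this)
  have hc2 : K2.carrier = (hL.knot g hf').carrier := by simp only [carrier, hE2]
  have hqa : q' ≠ f a := by
    rintro h
    apply he
    rw [h, sub_self]
    exact W.zero_mem
  have hqb : q' ≠ f b := by
    rintro h
    apply he
    rw [h]
    exact hB
  -- the old polygon meets the triangle swept out by the edge after the moving vertex only in that
  -- edge: for the edge before the vertex because `q'` lies outside the plane, and for all others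
  -- because the polygon stays simple during the motion
  have ht1 : convexHull ℝ {f a, q', f b} ∩ K1.carrier ⊆ segment ℝ (f a) (f b) := by
    rintro p ⟨hp, hpK⟩
    have ht : ({f a, q', f b} : Set Point3) = {f b, f a, q'} := by ext; simp; tauto
    rw [ht] at hp
    obtain ⟨t, ht, θ, hθ, rfl⟩ := exists_of_mem_triangle hp
    rw [hc1, hL.mem_carrier] at hpK
    obtain ⟨c, hpc⟩ := hpK
    by_cases hca : c = a
    · subst hca; exact hpc
    by_cases hca' : c = a'
    · subst hca'
      obtain ⟨ν, hν, hpν⟩ := mem_segment_iff_exists.1 hpc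
      have h0 : θ * t = 0 := by
        refine eq_zero_of_smul_mem he ?_
        have : (θ * t) • (q' - f a) = (1 - ν) • (f c - f a) - (1 - θ) • (f b - f a) := by
          linear_combination (norm := module) (1 : ℝ) • hpν
        rw [this]
        exact W.sub_mem (W.smul_mem _ hA) (W.smul_mem _ hB)
      rw [segment_symm]
      refine mem_segment_iff_exists.2 ?_
      rcases mul_eq_zero.1 h0 with rfl | rfl
      · exact ⟨0, by simp, by simp⟩
      · exact ⟨θ, hθ, by simp⟩
    · have hsc : s c ≠ a := fun h => hca' (hs h)
      have hR := hrob t ht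
      set k := Function.update f a ((1 - t) • f a + t • q') with hk
      have hka : k a = (1 - t) • f a + t • q' := by simp [hk]
      have hkc : k c = f c := by simp [hk, hca]
      have hksc : k (s c) = f (s c) := by simp [hk, hsc]
      have hkb : k b = f b := by simp [hk, Ne.symm hab]
      have hp1 : (1 - θ) • f b + θ • ((1 - t) • f a + t • q') ∈ segment ℝ (k a) (k (s a)) := by
        rw [← hb, hkb, hka, segment_symm]
        exact mem_segment_iff_exists.2 ⟨θ, hθ, rfl⟩
      have hp2 : (1 - θ) • f b + θ • ((1 - t) • f a + t • q') ∈ segment ℝ (k c) (k (s c)) := by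
        rwa [hkc, hksc]
      by_cases hcb : c = b
      · subst hcb
        have := hR.near_inter a ⟨hp1, by rw [← hb]; exact hp2⟩
        simp only [Set.mem_singleton_iff] at this
        rw [this, ← hb, hkb]
        exact right_mem_segment ℝ _ _
      · exact (hR.far_inter hca hcb (Ne.symm hsc) hp1 hp2).elim
  -- the same for the new polygon and the triangle swept out by the edge before the moving vertex
  have ht2 : convexHull ℝ {f a', f a, q'} ∩ K2.carrier ⊆ segment ℝ (f a') q' := by
    rintro p ⟨hp, hpK⟩
    obtain ⟨t, ht, θ, hθ, rfl⟩ := exists_of_mem_triangle hp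
    rw [hc2, hL.mem_carrier] at hpK
    obtain ⟨c, hpc⟩ := hpK
    by_cases hca' : c = a'
    · subst hca'; rwa [← ha, hga, hgo c ha'a] at hpc
    by_cases hca : c = a
    · subst hca
      rw [← hb, hga, hgo b (Ne.symm hab)] at hpc
      obtain ⟨ν, hν, hpν⟩ := mem_segment_iff_exists.1 hpc
      have h0 : (1 - ν) - θ * t = 0 := by
        refine eq_zero_of_smul_mem he ?_
        have : ((1 - ν) - θ * t) • (q' - f a) =
            (1 - θ) • (f a' - f a) - ν • (f b - f a) := by
          linear_combination (norm := module) (-1 : ℝ) • hpν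
        rw [this]
        exact W.sub_mem (W.smul_mem _ hA) (W.smul_mem _ hB)
      have h1 : (1 - θ) • (f a' - f a) - ν • (f b - f a) = 0 := by
        have : (1 - ν) = θ * t := by linarith
        linear_combination (norm := module) (1 : ℝ) • hpν + this • q' - this • f a
      have h2 : (1 - θ) + ν = 0 := by
        by_contra h2
        have hpos : 0 < (1 - θ) + ν :=
          lt_of_le_of_ne (add_nonneg (by linarith [hθ.2]) hν.1) (Ne.symm h2)
        refine hf.near a' ((1 - θ) / ((1 - θ) + ν))
          ⟨div_nonneg (by linarith [hθ.2]) hpos.le, by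
            rw [div_le_one hpos]; linarith [hν.1]⟩ ?_
        rw [← ha, ← hb]
        have h3 : 1 - (1 - θ) / ((1 - θ) + ν) = ν / ((1 - θ) + ν) := by
          rw [eq_div_iff h2, sub_mul, div_mul_cancel₀ _ h2]; ring
        rw [h3, div_eq_inv_mul, div_eq_inv_mul, mul_smul, mul_smul, ← smul_sub, h1, smul_zero]
      have h3 : ν = 0 := by linarith [hθ.2, hν.1]
      rw [hpν, h3]
      simpa using right_mem_segment ℝ _ _
    · have hsc : s c ≠ a := fun h => hca' (hs h)
      have hR := hrob t ht
      set k := Function.update f a ((1 - t) • f a + t • q') with hk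
      have hka : k a = (1 - t) • f a + t • q' := by simp [hk]
      have hkc : k c = f c := by simp [hk, hca]
      have hksc : k (s c) = f (s c) := by simp [hk, hsc]
      have hka' : k a' = f a' := by simp [hk, ha'a]
      rw [hgo c hca, hgo _ hsc] at hpc
      have hp1 : (1 - θ) • f a' + θ • ((1 - t) • f a + t • q') ∈
          segment ℝ (k a') (k (s a')) := by
        rw [← ha, hka', hka]
        exact mem_segment_iff_exists.2 ⟨θ, hθ, rfl⟩
      have hp2 : (1 - θ) • f a' + θ • ((1 - t) • f a + t • q') ∈ segment ℝ (k c) (k (s c)) := by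
        rwa [hkc, hksc]
      by_cases hcb : s c = a'
      · have := hR.near_inter c ⟨hp2, by rw [hcb]; exact hp1⟩
        simp only [Set.mem_singleton_iff] at this
        rw [this, hcb, hka']
        exact left_mem_segment ℝ _ _
      · exact (hR.far_inter hca' hca (Ne.symm hcb) hp1 hp2).elim
  have hcorner : segment ℝ (f a) q' ∩ segment ℝ q' (f b) ⊆ {q'} := by
    rintro p ⟨hp1, hp2⟩
    obtain ⟨ν, hν, rfl⟩ := mem_segment_iff_exists.1 hp1
    obtain ⟨μ, hμ, hp2⟩ := mem_segment_iff_exists.1 hp2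
    have h0 : ν - (1 - μ) = 0 := by
      refine eq_zero_of_smul_mem he ?_
      have : (ν - (1 - μ)) • (q' - f a) = μ • (f b - f a) := by
        linear_combination (norm := module) (1 : ℝ) • hp2
      rw [this]
      exact W.smul_mem _ hB
    have h1 : μ • (f b - f a) = 0 := by
      have : ν = 1 - μ := by linarith
      linear_combination (norm := module) (-1 : ℝ) • hp2 + this • q' - this • f a
    rcases smul_eq_zero.1 h1 with rfl | h2
    · have : ν = 1 := by linarith
      simp [this]
    · exact absurd (sub_eq_zero.1 h2).symm (hf.ne a)
  have hcorner' : segment ℝ (f a') (f a) ∩ segment ℝ (f a) q' ⊆ {f a} := by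
    rintro p ⟨hp1, hp2⟩
    obtain ⟨ν, hν, rfl⟩ := mem_segment_iff_exists.1 hp1
    obtain ⟨μ, hμ, hp2⟩ := mem_segment_iff_exists.1 hp2
    have h0 : μ = 0 := by
      refine eq_zero_of_smul_mem he ?_
      have : μ • (q' - f a) = (1 - ν) • (f a' - f a) := by
        linear_combination (norm := module) (-1 : ℝ) • hp2
      rw [this]
      exact W.smul_mem _ hA
    rw [hp2, h0]
    simp
  -- the polygon through both positions is reached by one triangle move from either side
  obtain ⟨M1, hM1, d1⟩ := exists_insert hK1 hqa hqb hcorner ht1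
  obtain ⟨M2, hM2, d2⟩ := exists_insert hK2 (hf.ne a').symm (Ne.symm hqa) hcorner' ht2
  obtain ⟨M3, hM3, d3, -⟩ := M1.exists_of_isRotated (l := f a' :: f a :: q' :: f b :: l.map f) (by
    rw [hM1]
    simpa using @List.isRotated_append _ (f a :: q' :: f b :: l.map f) [f a'])
  have : M3 = M2 := ext_vertices (hM3.trans hM2.symm)
  subst this
  exact e1.trans (d1.trans (d3.trans (d2.symm.trans e2.symm)))

end Loops

section Loops

variable {α : Type*}

theorem span_pair_ne_top (u v : Point3) : Submodule.span ℝ {u, v} ≠ ⊤ := by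
  intro h
  have h1 : Module.finrank ℝ (Submodule.span ℝ ({u, v} : Set Point3)) ≤ 2 := by
    have := finrank_span_finset_le_card (R := ℝ) ({u, v} : Finset Point3)
    rw [Set.finrank] at this
    rw [Finset.coe_pair] at this
    exact this.trans Finset.card_le_two
  rw [h, finrank_top] at h1
  simp at h1

/-- Two translates of planes do not cover a ball. -/
theorem exists_generic_point (q q' u v u' v' : Point3) {ε : ℝ} (hε : 0 < ε) :
    ∃ r, dist r q < ε ∧ r - q ∉ Submodule.span ℝ {u, v} ∧
      r - q' ∉ Submodule.span ℝ {u', v'} := by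
  by_contra! h
  have key : ∀ (q u v : Point3), MeasureTheory.volume
      {r : Point3 | r - q ∈ Submodule.span ℝ {u, v}} = 0 := by
    intro q u v
    have h0 := MeasureTheory.Measure.addHaar_submodule
      (MeasureTheory.volume : MeasureTheory.Measure Point3) _ (span_pair_ne_top u v)
    have : {r : Point3 | r - q ∈ Submodule.span ℝ {u, v}} =
        (fun r => r - q) ⁻¹' (Submodule.span ℝ {u, v} : Set Point3) := rfl
    rw [this]
    have h2 := MeasureTheory.measure_preimage_add_right
      (MeasureTheory.volume : MeasureTheory.Measure Point3) (-q)
      (Submodule.span ℝ {u, v} : Set Point3)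
    simp only [← sub_eq_add_neg] at h2
    rw [h2, h0]
  have hball : Metric.ball q ε ⊆ {r : Point3 | r - q ∈ Submodule.span ℝ {u, v}} ∪
      {r : Point3 | r - q' ∈ Submodule.span ℝ {u', v'}} := by
    intro r hr
    by_cases h1 : r - q ∈ Submodule.span ℝ {u, v}
    · exact Or.inl h1
    · exact Or.inr (h r hr h1)
  have h0 := (MeasureTheory.measure_mono hball).trans
    ((MeasureTheory.measure_union_le _ _).trans (by rw [key, key, add_zero]))
  exact (Metric.measure_ball_pos MeasureTheory.volume q hε).ne' (le_antisymm h0 bot_le)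

/-- Near a simple polygon, moving a vertex does not change the knot: it can be moved by way of a
point in general position, so that neither of the two motions is in the plane of the edges. -/
theorem IsCyclicList.equiv_update_of_ball [Fintype α] [DecidableEq α] {s : α → α} {L : List α}
    (hL : IsCyclicList s L) {f₀ : α → Point3} {ε : ℝ}
    (hball : ∀ f, dist f f₀ < ε → RobustLoop s f) {f : α → Point3} (a' : α) {q' : Point3}
    (hf : dist f f₀ < ε) (hf' : dist (Function.update f (s a') q') f₀ < ε) :
    (hL.knot f (hball f hf)).Equiv (hL.knot _ (hball _ hf')) := by
  set a := s a' with ha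
  have hε : 0 < ε := dist_nonneg.trans_lt hf
  obtain ⟨r, hr, hr1, hr2⟩ := exists_generic_point (f a) q' (f a' - f a) (f (s a) - f a)
    (f a' - q') (f (s a) - q') (sub_pos.2 hf)
  have hcoord : ∀ x, dist (Function.update f a x) f₀ < ε ↔ dist x (f₀ a) < ε := by
    intro x
    rw [dist_pi_lt_iff hε]
    refine ⟨fun h => by simpa using h a, fun h c => ?_⟩
    by_cases hc : c = a
    · subst hc; simpa using h
    · rw [Function.update_of_ne hc]
      exact (dist_le_pi_dist f f₀ c).trans_lt hf
  have hfa : dist (f a) (f₀ a) < ε := (dist_le_pi_dist f f₀ a).trans_lt hf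
  have hra : dist r (f₀ a) < ε := by
    have := dist_triangle r (f a) (f₀ a)
    have h2 := dist_le_pi_dist f f₀ a
    linarith
  have hqa : dist q' (f₀ a) < ε := (hcoord q').1 hf'
  have hconv : ∀ x y : Point3, dist x (f₀ a) < ε → dist y (f₀ a) < ε → ∀ t ∈ Set.Icc (0 : ℝ) 1,
      dist ((1 - t) • x + t • y) (f₀ a) < ε := by
    intro x y hx hy t ht
    exact convex_ball (f₀ a) ε hx hy (by linarith [ht.2]) ht.1 (by ring)
  have hne : ∀ c, s c ≠ c := fun c hc => (hball f hf).ne c (by rw [hc])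
  have ha'a : a' ≠ a := fun h => hne a' h.symm
  have hsaa : s a ≠ a := hne a
  have h1 : (hL.knot f (hball f hf)).Equiv (hL.knot _ (hball _ ((hcoord r).2 hra))) := by
    refine hL.equiv_update _ _ (fun t ht => ?_) hr1
    exact hball _ ((hcoord _).2 (hconv _ _ hfa hra t ht))
  have h2 : (hL.knot _ (hball _ hf')).Equiv (hL.knot _ (hball _ ((hcoord r).2 hra))) := by
    have e : Function.update (Function.update f a q') a r = Function.update f a r :=
      Function.update_idem _ _ _
    have h3 := hL.equiv_update (f := Function.update f a q') (a' := a') (q' := r)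
      (hball _ hf') (by rw [← ha, e]; exact hball _ ((hcoord r).2 hra)) (fun t ht => by
        rw [← ha, Function.update_idem, Function.update_self]
        exact hball _ ((hcoord _).2 (hconv _ _ hqa hra t ht))) (by
        rw [← ha, Function.update_self, Function.update_of_ne ha'a, Function.update_of_ne hsaa]
        exact hr2)
    have h4 : ∀ (g g' : α → Point3) (hg : RobustLoop s g) (hg' : RobustLoop s g'), g = g' →
        hL.knot g hg = hL.knot g' hg' := by rintro g _ hg hg' rfl; rfl
    have h5 := h4 _ _ (by rw [e]; exact hball _ ((hcoord r).2 hra))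
      (hball _ ((hcoord r).2 hra)) e
    exact h5 ▸ h3
  exact h1.trans h2.symm

/-- Two polygons near a simple polygon are the same knot: the vertices can be moved one after the
other. -/
theorem IsCyclicList.equiv_of_ball [Fintype α] {s : α → α} {L : List α}
    (hL : IsCyclicList s L) {f₀ : α → Point3} {ε : ℝ}
    (hball : ∀ f, dist f f₀ < ε → RobustLoop s f) {f g : α → Point3}
    (hf : dist f f₀ < ε) (hg : dist g f₀ < ε) :
    (hL.knot f (hball f hf)).Equiv (hL.knot g (hball g hg)) := by
  classical
  have hε : 0 < ε := dist_nonneg.trans_lt hf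
  have hs : Function.Surjective s := by
    refine Finite.surjective_of_injective fun c d hcd => ?_
    have h1 := hL.isPolygonEdge_iff (f := f) (x := f c) (y := f (s c))
    have h2 := hL.isPolygonEdge_iff (f := f) (x := f d) (y := f (s c))
    exact (hball f hf).injective (IsPolygonEdge.left_unique (hL.nodup.map (hball f hf).injective)
      (h1.2 ⟨c, rfl, rfl⟩) (h2.2 ⟨d, rfl, by rw [hcd]⟩))
  have hmix : ∀ T : Finset α, dist (T.piecewise g f) f₀ < ε := by
    intro T
    rw [dist_pi_lt_iff hε]
    intro c
    by_cases hc : c ∈ T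
    · rw [Finset.piecewise_eq_of_mem _ _ _ hc]; exact (dist_le_pi_dist g f₀ c).trans_lt hg
    · rw [Finset.piecewise_eq_of_notMem _ _ _ hc]; exact (dist_le_pi_dist f f₀ c).trans_lt hf
  have key : ∀ T : Finset α, (hL.knot f (hball f hf)).Equiv (hL.knot _ (hball _ (hmix T))) := by
    intro T
    have h4 : ∀ (g g' : α → Point3) (hg : RobustLoop s g) (hg' : RobustLoop s g'), g = g' →
        hL.knot g hg = hL.knot g' hg' := by rintro g _ hg hg' rfl; rfl
    induction T using Finset.induction_on with
    | empty =>
      rw [h4 (Finset.piecewise ∅ g f) f _ (hball f hf) (by simp)]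
      exact PolygonalKnot.Equiv.refl _
    | insert c T hc ih =>
      refine ih.trans ?_
      obtain ⟨a', rfl⟩ := hs c
      have e := Finset.piecewise_insert T g f (s a')
      have := hL.equiv_update_of_ball hball (f := T.piecewise g f) a' (q' := g (s a')) (hmix T)
        (by rw [← e]; exact hmix _)
      rwa [h4 _ _ _ (hball _ (hmix _)) e.symm] at this
  have := key Finset.univ
  simpa using this

/-- The knot is a locally constant function of the time, hence constant. -/
theorem IsCyclicList.equiv_of_path [Fintype α] {s : α → α} {L : List α}
    (hL : IsCyclicList s L) {f : ℝ → α → Point3} (hc : Continuous f)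
    (hf : ∀ t ∈ Set.Icc (0 : ℝ) 1, RobustLoop s (f t)) :
    (hL.knot (f 0) (hf 0 (by simp))).Equiv (hL.knot (f 1) (hf 1 (by simp))) := by
  let F : unitInterval → Quotient (Relation.EqvGen.setoid Move) :=
    fun t => Quotient.mk _ (hL.knot (f t) (hf t t.2))
  have hF : IsLocallyConstant F := by
    rw [IsLocallyConstant.iff_eventually_eq]
    intro t
    obtain ⟨ε, hε, hball⟩ := Metric.isOpen_iff.1 (isOpen_robustLoop s) (f t) (hf t t.2)
    have h1 : Continuous fun u : unitInterval => f u := hc.comp continuous_subtype_val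
    filter_upwards [(h1.tendsto t).eventually (Metric.ball_mem_nhds (f t) hε)] with u hu
    exact Quotient.sound (hL.equiv_of_ball (fun g hg => hball hg) hu (by simpa using hε))
  exact Quotient.exact (hF.apply_eq_of_preconnectedSpace 0 1)

/-- A knot whose edges are those of a family of polygons with different vertices lists all of
these vertices, so the family consists of one polygon. -/
theorem exists_isCyclicList {s : α → α} {f : α → Point3} {K : PolygonalKnot}
    (hf : Function.Injective f) (hK : K.edges = loopEdges s f) :
    ∃ L, IsCyclicList s L ∧ K.vertices = L.map f := by
  have hmem : ∀ x, x ∈ K.vertices ↔ ∃ a, f a = x := by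
    intro x
    constructor
    · intro hx
      obtain ⟨y, hy⟩ := exists_isPolygonEdge_of_mem (by have := K.three_le; omega) hx
      rw [← mem_edges, hK] at hy
      obtain ⟨a, ha⟩ := hy
      exact ⟨a, (Prod.mk.inj ha).1.symm⟩
    · rintro ⟨a, rfl⟩
      have : (f a, f (s a)) ∈ K.edges := by rw [hK]; exact ⟨a, rfl⟩
      exact IsPolygonEdge.left_mem this
  obtain ⟨L, hL⟩ : ∃ L : List α, L.map f = K.vertices := by
    have : K.vertices ∈ Set.range (List.map f) := by
      rw [Set.range_list_map]
      exact fun x hx => (hmem x).1 hx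
    exact this
  have hnd := K.nodup
  rw [← hL] at hnd
  refine ⟨L, ⟨List.Nodup.of_map f hnd, ?_, ?_, ?_⟩, hL.symm⟩
  · have := K.three_le
    rwa [← hL, List.length_map] at this
  · intro a
    have := (hmem (f a)).2 ⟨a, rfl⟩
    rw [← hL, List.mem_map] at this
    obtain ⟨b, hb, hab⟩ := this
    rwa [← hf hab]
  · intro a b
    have h1 : (f a, f b) ∈ K.edges ↔ ∃ t, L ~r a :: b :: t := by
      rw [mem_edges, ← hL, isPolygonEdge_map_iff]
      constructor
      · rintro ⟨a', b', h, ha, hb⟩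
        rwa [hf ha, hf hb]
      · intro h
        exact ⟨a, b, h, rfl, rfl⟩
    rw [← h1, hK]
    constructor
    · rintro ⟨c, hc⟩
      obtain ⟨h2, h3⟩ := Prod.mk.inj hc
      rw [hf h3, hf h2]
    · rintro rfl
      exact ⟨a, rfl⟩

/-- A continuous family of simple polygons consists of diagrams of one knot. -/
theorem EdgesRepresent.of_path [Fintype α] {s : α → α} (hs : Function.Injective s)
    {f : ℝ → α → Point3} (hc : Continuous f)
    (hf : ∀ t ∈ Set.Icc (0 : ℝ) 1, SimpleLoop s (f t)) {K : PolygonalKnot}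
    (h : EdgesRepresent (loopEdges s (f 0)) K) : EdgesRepresent (loopEdges s (f 1)) K := by
  obtain ⟨P, hP, hPK⟩ := h
  have hr : ∀ t ∈ Set.Icc (0 : ℝ) 1, RobustLoop s (f t) := fun t ht => (hf t ht).robust hs
  obtain ⟨L, hL, hPL⟩ := exists_isCyclicList (hr 0 (by simp)).injective hP
  refine ⟨hL.knot (f 1) (hr 1 (by simp)), hL.knot_edges _ _, ?_⟩
  have : P = hL.knot (f 0) (hr 0 (by simp)) := ext_vertices hPL
  rw [this] at hPK
  exact (hL.equiv_of_path hc hr).symm.trans hPK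

end Loops

/-! ### Half-open edges in coordinates -/

/-- The segment from `u` to `v` without its end point `v`. -/
def halfOpen (u v : Point3) : Set Point3 :=
  {p | ∃ τ : ℝ, 0 ≤ τ ∧ τ < 1 ∧ p = (1 - τ) • u + τ • v}

theorem SimpleLoop.of_halfOpen {α : Type*} {s : α → α} {f : α → Point3}
    (hne : ∀ a, f a ≠ f (s a))
    (h : ∀ a b p, p ∈ halfOpen (f a) (f (s a)) → p ∈ halfOpen (f b) (f (s b)) → a = b) :
    SimpleLoop s f :=
  ⟨hne, fun a b τ τ' h0 h1 h0' h1' e => h a b _ ⟨τ, h0, h1, rfl⟩ ⟨τ', h0', h1', e⟩⟩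

section halfOpen

variable {u v p : Point3} (h : p ∈ halfOpen u v) (c : Fin 3)
include h

theorem halfOpen_const (huv : u c = v c) : p c = u c := by
  obtain ⟨τ, h0, h1, rfl⟩ := h
  simp only [Pi.add_apply, Pi.smul_apply, smul_eq_mul, ← huv]
  ring

theorem halfOpen_mem_uIcc : p c ∈ Set.uIcc (u c) (v c) := by
  obtain ⟨τ, h0, h1, rfl⟩ := h
  rw [← segment_eq_uIcc]
  exact ⟨1 - τ, τ, by linarith, h0, by ring, rfl⟩

theorem halfOpen_ne (huv : u c ≠ v c) : p c ≠ v c := by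
  obtain ⟨τ, h0, h1, rfl⟩ := h
  intro h2
  simp only [Pi.add_apply, Pi.smul_apply, smul_eq_mul] at h2
  have : (1 - τ) * (u c - v c) = 0 := by linarith
  rcases mul_eq_zero.1 this with h | h
  · linarith
  · exact huv (by linarith)

/-- If one coordinate has its initial value, then the whole point is the initial point. -/
theorem halfOpen_eq_left (huv : u c ≠ v c) (hp : p c = u c) : p = u := by
  obtain ⟨τ, h0, h1, rfl⟩ := h
  simp only [Pi.add_apply, Pi.smul_apply, smul_eq_mul] at hp
  have : τ * (v c - u c) = 0 := by linarith
  rcases mul_eq_zero.1 this with h | h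
  · simp [h]
  · exact absurd (by linarith) huv

theorem halfOpen_mul_le {e : ℝ} (huv : e * u c ≤ e * v c) : e * u c ≤ e * p c := by
  obtain ⟨τ, h0, h1, rfl⟩ := h
  simp only [Pi.add_apply, Pi.smul_apply, smul_eq_mul]
  nlinarith

theorem halfOpen_mul_lt {e : ℝ} (huv : e * u c < e * v c) : e * p c < e * v c := by
  obtain ⟨τ, h0, h1, rfl⟩ := h
  simp only [Pi.add_apply, Pi.smul_apply, smul_eq_mul]
  nlinarith

end halfOpen

/-! ### Lattice links as cyclic sequences of points -/

section Stair

variable {ι : Type*}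

/-- The successor map of the vertices of `stair`. -/
def stairNext (σ : Equiv.Perm ι) : ι × Fin 3 → ι × Fin 3
  | (i, 0) => (i, 1)
  | (i, 1) => (i, 2)
  | (i, 2) => (σ i, 0)

/-- The lattice link through the points `(x i, y i, z i)`, cyclically ordered by `σ`: consecutive
points are joined by a segment in `z`-direction, one in `x`-direction and one in `y`-direction, in
this order. -/
def stair (σ : Equiv.Perm ι) (x y z : ι → ℝ) : ι × Fin 3 → Point3
  | (i, 0) => ![x i, y i, z i]
  | (i, 1) => ![x i, y i, z (σ i)]
  | (i, 2) => ![x (σ i), y i, z (σ i)]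

theorem stairNext_injective (σ : Equiv.Perm ι) : Function.Injective (stairNext σ) := by
  rintro ⟨i, a⟩ ⟨j, b⟩ h
  fin_cases a <;> fin_cases b <;> simp [stairNext] at h ⊢ <;> exact h

/-- The oriented link `stair σ x y z` is the knot `K`. -/
def StairRepresents (σ : Equiv.Perm ι) (x y z : ι → ℝ) (K : PolygonalKnot) : Prop :=
  EdgesRepresent (loopEdges (stairNext σ) (stair σ x y z)) K

/-- The segments of a lattice link are disjoint because each of them determines its point `i` by
the two coordinates that are constant on it. -/
theorem simpleLoop_stair {σ : Equiv.Perm ι} (hσ : ∀ i, σ i ≠ i) {x y z : ι → ℝ}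
    (hx : Function.Injective x) (hy : Function.Injective y) (hz : Function.Injective z) :
    SimpleLoop (stairNext σ) (stair σ x y z) := by
  have hx' : ∀ i, x i ≠ x (σ i) := fun i h => hσ i (hx h).symm
  have hy' : ∀ i, y i ≠ y (σ i) := fun i h => hσ i (hy h).symm
  have hz' : ∀ i, z i ≠ z (σ i) := fun i h => hσ i (hz h).symm
  refine SimpleLoop.of_halfOpen ?_ ?_
  · rintro ⟨i, a⟩ h
    have h0 := congrFun h 0
    have h1 := congrFun h 1
    have h2 := congrFun h 2
    fin_cases a <;> simp [stair, stairNext] at h0 h1 h2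
    · exact hz' i h2
    · exact hx' i h0
    · exact hy' i h1
  -- the equations of the half-open segments in the three directions
  · have eZ : ∀ i p, p ∈ halfOpen (stair σ x y z (i, 0)) (stair σ x y z (stairNext σ (i, 0))) →
        p 0 = x i ∧ p 1 = y i ∧ p 2 ≠ z (σ i) := fun i p h =>
      ⟨halfOpen_const h 0 rfl, halfOpen_const h 1 rfl, halfOpen_ne h 2 (hz' i)⟩
    have eX : ∀ i p, p ∈ halfOpen (stair σ x y z (i, 1)) (stair σ x y z (stairNext σ (i, 1))) →
        p 0 ≠ x (σ i) ∧ p 1 = y i ∧ p 2 = z (σ i) := fun i p h =>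
      ⟨halfOpen_ne h 0 (hx' i), halfOpen_const h 1 rfl, halfOpen_const h 2 rfl⟩
    have eY : ∀ i p, p ∈ halfOpen (stair σ x y z (i, 2)) (stair σ x y z (stairNext σ (i, 2))) →
        p 0 = x (σ i) ∧ p 1 ≠ y (σ i) ∧ p 2 = z (σ i) := fun i p h =>
      ⟨halfOpen_const h 0 rfl, halfOpen_ne h 1 (hy' i), halfOpen_const h 2 rfl⟩
    rintro ⟨i, a⟩ ⟨j, b⟩ p ha hb
    fin_cases a <;> fin_cases b
    · have h1 := eZ i p ha; have h2 := eZ j p hb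
      rw [hx (h1.1.symm.trans h2.1)]
    · have h1 := eZ i p ha; have h2 := eX j p hb
      obtain rfl := hy (h1.2.1.symm.trans h2.2.1)
      exact absurd h2.2.2 h1.2.2
    · have h1 := eZ i p ha; have h2 := eY j p hb
      obtain rfl := hx (h1.1.symm.trans h2.1)
      exact absurd h1.2.1 h2.2.1
    · have h1 := eX i p ha; have h2 := eZ j p hb
      obtain rfl := hy (h1.2.1.symm.trans h2.2.1)
      exact absurd h1.2.2 h2.2.2
    · have h1 := eX i p ha; have h2 := eX j p hb
      rw [hy (h1.2.1.symm.trans h2.2.1)]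
    · have h1 := eX i p ha; have h2 := eY j p hb
      have : i = j := σ.injective (hz (h1.2.2.symm.trans h2.2.2))
      subst this
      exact absurd h2.1 h1.1
    · have h1 := eY i p ha; have h2 := eZ j p hb
      obtain rfl := hx (h2.1.symm.trans h1.1)
      exact absurd h2.2.1 h1.2.1
    · have h1 := eY i p ha; have h2 := eX j p hb
      have : i = j := σ.injective (hz (h1.2.2.symm.trans h2.2.2))
      subst this
      exact absurd h1.1 h2.1
    · have h1 := eY i p ha; have h2 := eY j p hb
      rw [σ.injective (hz (h1.2.2.symm.trans h2.2.2))]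

theorem lineMap_lt_lineMap {a b a' b' t : ℝ} (ht : t ∈ Set.Icc (0 : ℝ) 1) (h : a < b)
    (h' : a' < b') : (1 - t) * a + t * a' < (1 - t) * b + t * b' := by
  rcases eq_or_lt_of_le ht.1 with rfl | h0
  · simpa using h
  · have h1 := mul_le_mul_of_nonneg_left h.le (sub_nonneg.2 ht.2)
    have h2 := mul_lt_mul_of_pos_left h' h0
    linarith

theorem injective_lineMap_of_lt_iff_lt {x x' : ι → ℝ} (hx : Function.Injective x)
    (h : ∀ i j, x i < x j ↔ x' i < x' j) {t : ℝ} (ht : t ∈ Set.Icc (0 : ℝ) 1) :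
    Function.Injective fun i => (1 - t) * x i + t * x' i := by
  intro i j hij
  by_contra hne
  rcases lt_or_gt_of_ne (fun h => hne (hx h)) with h1 | h1
  · exact (lineMap_lt_lineMap ht h1 ((h i j).1 h1)).ne hij
  · exact (lineMap_lt_lineMap ht h1 ((h j i).1 h1)).ne hij.symm

/-- Only the order of the coordinates matters. -/
theorem StairRepresents.congr [Fintype ι] {σ : Equiv.Perm ι} (hσ : ∀ i, σ i ≠ i)
    {x y z x' y' z' : ι → ℝ} (hx : Function.Injective x) (hy : Function.Injective y)
    (hz : Function.Injective z) (hxx : ∀ i j, x i < x j ↔ x' i < x' j)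
    (hyy : ∀ i j, y i < y j ↔ y' i < y' j) (hzz : ∀ i j, z i < z j ↔ z' i < z' j)
    {K : PolygonalKnot} (h : StairRepresents σ x y z K) : StairRepresents σ x' y' z' K := by
  have := EdgesRepresent.of_path (stairNext_injective σ)
    (f := fun t => stair σ (fun i => (1 - t) * x i + t * x' i)
      (fun i => (1 - t) * y i + t * y' i) (fun i => (1 - t) * z i + t * z' i)) (K := K) (by
        refine continuous_pi fun ⟨i, a⟩ => continuous_pi fun c => ?_
        fin_cases a <;> fin_cases c <;> simp [stair] <;> fun_prop)
      (fun t ht => simpleLoop_stair hσ (injective_lineMap_of_lt_iff_lt hx hxx ht)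
        (injective_lineMap_of_lt_iff_lt hy hyy ht) (injective_lineMap_of_lt_iff_lt hz hzz ht))
  simp only [sub_zero, sub_self, one_mul, zero_mul, zero_add, add_zero] at this
  exact this h

/-- A linear map which is joined to the identity by a segment of invertible maps does not change the
knot. -/
theorem EdgesRepresent.map_linear {α : Type*} [Fintype α] {s : α → α}
    (hs : Function.Injective s) {f : α → Point3} (hf : SimpleLoop s f) (L : Point3 →ₗ[ℝ] Point3)
    (hL : ∀ t ∈ Set.Icc (0 : ℝ) 1, ∀ v, (1 - t) • v + t • L v = 0 → v = 0) {K : PolygonalKnot}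
    (h : EdgesRepresent (loopEdges s f) K) : EdgesRepresent (loopEdges s fun a => L (f a)) K := by
  have key := EdgesRepresent.of_path hs (f := fun t a => (1 - t) • f a + t • L (f a)) (K := K)
    (by fun_prop) (by
      intro t ht
      have hinj : ∀ v w, (1 - t) • v + t • L v = (1 - t) • w + t • L w → v = w := by
        intro v w hvw
        refine sub_eq_zero.1 (hL t ht (v - w) ?_)
        rw [map_sub]
        linear_combination (norm := module) (1 : ℝ) • hvw
      constructor
      · intro a ha
        exact hf.ne a (hinj _ _ ha)
      · intro a b τ τ' h0 h1 h0' h1' he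
        refine hf.disjoint a b τ τ' h0 h1 h0' h1' (hinj _ _ ?_)
        simp only [map_add, map_smul]
        linear_combination (norm := module) (1 : ℝ) • he)
  simp only [sub_zero, sub_self, one_smul, zero_smul, zero_add, add_zero] at key
  exact key h

end Stair

/-! ### Insertion of a point into a lattice link -/

section Stair

variable {ι : Type*}

/-- The cyclic order `σ` with one new element `none` inserted after `i`. -/
def insertAfter [DecidableEq ι] (σ : Equiv.Perm ι) (i : ι) : Equiv.Perm (Option ι) :=
  (Equiv.swap none (some i)).trans (Equiv.optionCongr σ)

section insertAfter

variable [DecidableEq ι] (σ : Equiv.Perm ι) (i : ι)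

@[simp] theorem insertAfter_none : insertAfter σ i none = some (σ i) := by
  simp [insertAfter]

@[simp] theorem insertAfter_some_self : insertAfter σ i (some i) = none := by
  simp [insertAfter]

theorem insertAfter_some_of_ne {k : ι} (h : k ≠ i) : insertAfter σ i (some k) = some (σ k) := by
  have : Equiv.swap none (some i) (some k) = some k :=
    Equiv.swap_apply_of_ne_of_ne (by simp) (by simpa using h)
  simp [insertAfter, this]

theorem insertAfter_some (k : ι) :
    insertAfter σ i (some k) = if k = i then none else some (σ k) := by
  split_ifs with h
  · subst h; simp
  · exact insertAfter_some_of_ne σ i h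

theorem insertAfter_ne_self (hσ : ∀ k, σ k ≠ k) (κ : Option ι) : insertAfter σ i κ ≠ κ := by
  rcases κ with _ | k
  · simp
  · rw [insertAfter_some]
    split_ifs
    · simp
    · simpa using hσ k

end insertAfter

/-- A function on `ι`, extended to the new element by the value `a`. -/
def extend {β : Type*} (a : β) (x : ι → β) (κ : Option ι) : β := κ.elim a x

@[simp] theorem extend_none {β : Type*} (a : β) (x : ι → β) : extend a x none = a := rfl

@[simp] theorem extend_some {β : Type*} (a : β) (x : ι → β) (k : ι) :
    extend a x (some k) = x k := rfl

theorem extend_injective {β : Type*} {a : β} {x : ι → β} (hx : Function.Injective x)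
    (ha : ∀ k, x k ≠ a) : Function.Injective (extend a x) := by
  rintro (_ | k) (_ | l) h
  · rfl
  · exact absurd h.symm (ha l)
  · exact absurd h (ha k)
  · exact congrArg some (hx h)

theorem mem_openSegment_of_third {u v c : ℝ} (h : (u < c ∧ c < v) ∨ (v < c ∧ c < u))
    (x y : ℝ) : (![x, y, c] : Point3) ∈ openSegment ℝ ![x, y, u] ![x, y, v] := by
  have huv : v - u ≠ 0 := by rcases h with h | h <;> intro h' <;> linarith
  have hpos : 0 < (c - u) / (v - u) ∧ (c - u) / (v - u) < 1 := by
    rcases h with h | h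
    · have : 0 < v - u := by linarith
      exact ⟨div_pos (by linarith) this, by rw [div_lt_one this]; linarith⟩
    · have : v - u < 0 := by linarith
      exact ⟨div_pos_of_neg_of_neg (by linarith) this, by rw [div_lt_one_of_neg this]; linarith⟩
  refine ⟨1 - (c - u) / (v - u), (c - u) / (v - u), by linarith, hpos.1, by ring, ?_⟩
  ext k
  fin_cases k
  · simp; ring
  · simp; ring
  · simp; field_simp; ring

/-- Inserting a point `(ax, ay, az)` after the point `i`: the segment in `z`-direction that starts
at `i` is replaced by two such segments, which are joined at height `az` by two steps. This
does not change the knot if the new segment is close enough to the old one: no other point has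
its `x`-coordinate between `x i` and `ax`, and where the `y`-coordinate of another point lies
between `y i` and `ay`, the segments at that point avoid the strip that is swept out. -/
theorem StairRepresents.insert [Fintype ι] [DecidableEq ι] {σ : Equiv.Perm ι}
    (hσ : ∀ k, σ k ≠ k) {x y z : ι → ℝ} (hx : Function.Injective x) (hy : Function.Injective y)
    (hz : Function.Injective z) {i : ι} {ax ay az : ℝ}
    (haz : (z i < az ∧ az < z (σ i)) ∨ (z (σ i) < az ∧ az < z i))
    (hx_ne : ∀ k, x k ≠ ax) (hy_ne : ∀ k, y k ≠ ay) (hz_ne : ∀ k, z k ≠ az)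
    (hax : ∀ k, k ≠ i → x k ∉ Set.uIcc (x i) ax)
    (hay : ∀ k, k ≠ i → y k ∈ Set.uIcc (y i) ay → z (σ i) ∉ Set.uIcc (z k) (z (σ k)) ∧
      ∀ u ∈ Set.uIcc (x k) (x (σ k)), u ∉ Set.uIcc (x i) ax)
    {K : PolygonalKnot} (h : StairRepresents σ x y z K) :
    StairRepresents (insertAfter σ i) (extend ax x) (extend ay y) (extend az z) K := by
  have hx' : ∀ k, x k ≠ x (σ k) := fun k h => hσ k (hx h).symm
  have hy' : ∀ k, y k ≠ y (σ k) := fun k h => hσ k (hy h).symm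
  have hz' : ∀ k, z k ≠ z (σ k) := fun k h => hσ k (hz h).symm
  set xt : ℝ → ℝ := fun t => x i + t * (ax - x i) with hxt
  set yt : ℝ → ℝ := fun t => y i + t * (ay - y i) with hyt
  set c : ℝ → ℕ → ℝ := fun t m => match m with
    | 0 => z i
    | 1 => az + (1 - t) * ((z i - az) / 2)
    | 2 => az
    | 3 => az + (1 - t) * ((z (σ i) - az) / 2)
    | _ => z (σ i) with hc
  -- the deformation starts from the old link (`t = 0`); while the new point moves into its place,
  -- the heights of the vertices on the old segment remain strictly monotone for `t < 1`
  let f : ℝ → Option ι × Fin 3 → Point3 := fun t a => match a with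
    | (none, 0) => ![xt t, yt t, c t 3]
    | (none, 1) => ![xt t, yt t, z (σ i)]
    | (none, 2) => ![x (σ i), yt t, z (σ i)]
    | (some k, 0) => ![x k, y k, z k]
    | (some k, 1) => if k = i then ![x i, y i, c t 1] else ![x k, y k, z (σ k)]
    | (some k, 2) => if k = i then ![xt t, y i, az] else ![x (σ k), y k, z (σ k)]
  let s := stairNext (insertAfter σ i)
  have hf1 : f 1 = stair (insertAfter σ i) (extend ax x) (extend ay y) (extend az z) := by
    funext ⟨κ, a⟩
    rcases κ with _ | k
    · fin_cases a <;> simp [f, stair, hxt, hyt, hc]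
    · by_cases hk : k = i
      · subst hk
        fin_cases a <;> simp [f, stair, hxt, hyt, hc]
      · fin_cases a <;> simp [f, stair, insertAfter_some_of_ne σ i hk, hk]
  have hfc : Continuous f := by
    refine continuous_pi fun ⟨κ, a⟩ => ?_
    rcases κ with _ | k
    · fin_cases a <;> simp only [f, hxt, hyt, hc] <;> refine continuous_pi fun d => ?_ <;>
        fin_cases d <;> simp <;> fun_prop
    · by_cases hk : k = i
      · subst hk
        fin_cases a <;> simp only [f, hxt, hyt, hc, if_true] <;>
          refine continuous_pi fun d => ?_ <;> fin_cases d <;> simp <;> fun_prop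
      · fin_cases a <;> simp only [f, hk, if_false] <;> fun_prop
  have hsimple : ∀ t ∈ Set.Icc (0 : ℝ) 1, SimpleLoop s (f t) := by
    intro t ht
    rcases eq_or_lt_of_le ht.2 with rfl | ht1
    · rw [hf1]
      exact simpleLoop_stair (insertAfter_ne_self σ i hσ) (extend_injective hx hx_ne)
        (extend_injective hy hy_ne) (extend_injective hz hz_ne)
    have hxt_mem : xt t ∈ Set.uIcc (x i) ax := by
      rw [← segment_eq_uIcc]
      exact ⟨1 - t, t, by linarith, ht.1, by ring, by simp only [smul_eq_mul, hxt]; ring⟩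
    have hyt_mem : yt t ∈ Set.uIcc (y i) ay := by
      rw [← segment_eq_uIcc]
      exact ⟨1 - t, t, by linarith, ht.1, by ring, by simp only [smul_eq_mul, hyt]; ring⟩
    have hxsub : Set.uIcc (x i) (xt t) ⊆ Set.uIcc (x i) ax :=
      Set.uIcc_subset_uIcc Set.left_mem_uIcc hxt_mem
    have hysub : Set.uIcc (y i) (yt t) ⊆ Set.uIcc (y i) ay :=
      Set.uIcc_subset_uIcc Set.left_mem_uIcc hyt_mem
    have hxne : xt t ≠ x (σ i) := fun h => hax (σ i) (hσ i) (h ▸ hxt_mem)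
    have hyne : yt t ≠ y (σ i) := fun h =>
      (hay (σ i) (hσ i) (h ▸ hyt_mem)).1 Set.left_mem_uIcc
    -- multiplication by the sign `e` turns both directions of the segment into the upward one
    obtain ⟨e, he, hcm⟩ : ∃ e : ℝ, e ≠ 0 ∧ e * c t 0 < e * c t 1 ∧ e * c t 1 < e * c t 2 ∧
        e * c t 2 < e * c t 3 ∧ e * c t 3 < e * c t 4 := by
      rcases haz with ⟨h1, h2⟩ | ⟨h1, h2⟩
      · refine ⟨1, one_ne_zero, ?_⟩
        have h3 := mul_pos (sub_pos.2 ht1) (sub_pos.2 h1)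
        have h4 := mul_pos (sub_pos.2 ht1) (sub_pos.2 h2)
        have h5 := mul_nonneg ht.1 (sub_pos.2 h1).le
        have h6 := mul_nonneg ht.1 (sub_pos.2 h2).le
        simp only [hc]
        refine ⟨?_, ?_, ?_, ?_⟩ <;> linarith
      · refine ⟨-1, by norm_num, ?_⟩
        have h3 := mul_pos (sub_pos.2 ht1) (sub_pos.2 h1)
        have h4 := mul_pos (sub_pos.2 ht1) (sub_pos.2 h2)
        have h5 := mul_nonneg ht.1 (sub_pos.2 h1).le
        have h6 := mul_nonneg ht.1 (sub_pos.2 h2).le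
        simp only [hc]
        refine ⟨?_, ?_, ?_, ?_⟩ <;> linarith
    obtain ⟨hc0, hc1, hc2, hc3⟩ := hcm
    have hc0' : e * z i < e * c t 1 := hc0
    have hc1' : e * c t 1 < e * az := hc1
    have hc2' : e * az < e * c t 3 := hc2
    have hc3' : e * c t 3 < e * z (σ i) := hc3
    have hcne : ∀ m n, e * c t m < e * c t n → c t m ≠ c t n := fun m n h h' => by
      rw [h'] at h; exact lt_irrefl _ h
    -- the four steps that replace the segment at `i`
    let idx : ℕ → Option ι × Fin 3 := fun m => match m with
      | 0 => (some i, 0)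
      | 1 => (some i, 1)
      | 2 => (some i, 2)
      | _ => (none, 0)
    -- the six kinds of segments, and the constraints on their points
    have spec : ∀ a p, p ∈ halfOpen (f t a) (f t (s a)) →
        (∃ k, k ≠ i ∧ a = (some k, 0) ∧ p 0 = x k ∧ p 1 = y k ∧
          p 2 ∈ Set.uIcc (z k) (z (σ k)) ∧ p 2 ≠ z (σ k)) ∨
        (∃ k, k ≠ i ∧ a = (some k, 1) ∧ p 0 ∈ Set.uIcc (x k) (x (σ k)) ∧ p 0 ≠ x (σ k) ∧
          p 1 = y k ∧ p 2 = z (σ k)) ∨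
        (∃ k, k ≠ i ∧ a = (some k, 2) ∧ p 0 = x (σ k) ∧ p 1 ≠ y (σ k) ∧ p 2 = z (σ k)) ∨
        (a = (none, 1) ∧ p 0 ≠ x (σ i) ∧ p 1 = yt t ∧ p 2 = z (σ i)) ∨
        (a = (none, 2) ∧ p 0 = x (σ i) ∧ p 1 ≠ y (σ i) ∧ p 2 = z (σ i)) ∨
        (∃ m < 4, a = idx m ∧ p 0 ∈ Set.uIcc (x i) ax ∧ p 1 ∈ Set.uIcc (y i) ay ∧
          p 2 ≠ z (σ i) ∧ (p 2 = z i → p 1 = y i) ∧ e * c t m ≤ e * p 2 ∧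
          e * p 2 < e * c t (m + 1)) := by
      rintro ⟨κ, a⟩ p hp
      rcases κ with _ | k
      · fin_cases a
        · refine Or.inr (Or.inr (Or.inr (Or.inr (Or.inr ⟨3, by norm_num, rfl, ?_⟩))))
          have h0 : p 0 = xt t := halfOpen_const hp 0 (by simp [f, s, stairNext])
          have h1 : p 1 = yt t := halfOpen_const hp 1 (by simp [f, s, stairNext])
          have h2 : e * c t 3 ≤ e * p 2 := halfOpen_mul_le hp 2 (by
            simpa [f, s, stairNext] using hc3'.le)
          have h3 : e * p 2 < e * c t 4 := halfOpen_mul_lt hp 2 (by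
            simpa [f, s, stairNext] using hc3')
          refine ⟨h0 ▸ hxt_mem, h1 ▸ hyt_mem, fun h => ?_, fun h => ?_, h2, h3⟩
          · rw [h] at h3; exact lt_irrefl _ h3
          · rw [h] at h2
            exact absurd (hc0.trans (hc1.trans hc2)) h2.not_gt
        · refine Or.inr (Or.inr (Or.inr (Or.inl ⟨rfl, ?_, ?_, ?_⟩)))
          · exact halfOpen_ne hp 0 (by simpa [f, s, stairNext] using hxne)
          · exact halfOpen_const hp 1 (by simp [f, s, stairNext])
          · exact halfOpen_const hp 2 (by simp [f, s, stairNext])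
        · refine Or.inr (Or.inr (Or.inr (Or.inr (Or.inl ⟨rfl, ?_, ?_, ?_⟩))))
          · exact halfOpen_const hp 0 (by simp [f, s, stairNext])
          · simpa [f, s, stairNext] using
              halfOpen_ne hp 1 (by simpa [f, s, stairNext] using hyne)
          · exact halfOpen_const hp 2 (by simp [f, s, stairNext])
      · by_cases hk : k = i
        · subst hk
          refine Or.inr (Or.inr (Or.inr (Or.inr (Or.inr ?_))))
          fin_cases a
          · have h0 : p 0 = x k := halfOpen_const hp 0 (by simp [f, s, stairNext])
            have h1 : p 1 = y k := halfOpen_const hp 1 (by simp [f, s, stairNext])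
            have h2 : e * c t 0 ≤ e * p 2 := halfOpen_mul_le hp 2 (by
              simpa [f, s, stairNext] using hc0'.le)
            have h3 : e * p 2 < e * c t 1 := by
              simpa [f, s, stairNext] using halfOpen_mul_lt hp 2 (by
                simpa [f, s, stairNext] using hc0')
            refine ⟨0, by norm_num, rfl, h0 ▸ Set.left_mem_uIcc, h1 ▸ Set.left_mem_uIcc,
              fun h => ?_, fun h => h1, h2, h3⟩
            rw [h] at h3
            exact absurd (h3.trans (hc1.trans (hc2.trans hc3))) (lt_irrefl _)
          · have h0 : p 0 ∈ Set.uIcc (x k) (xt t) := by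
              simpa [f, s, stairNext] using halfOpen_mem_uIcc hp 0
            have h1 : p 1 = y k := by
              simpa [f, s, stairNext] using halfOpen_const hp 1 (by simp [f, s, stairNext])
            have h2 : e * c t 1 ≤ e * p 2 := by
              simpa [f, s, stairNext] using halfOpen_mul_le (e := e) hp 2 (by
                simpa [f, s, stairNext] using hc1'.le)
            have h3 : e * p 2 < e * az := by
              simpa [f, s, stairNext] using halfOpen_mul_lt (e := e) hp 2 (by
                simpa [f, s, stairNext] using hc1')
            refine ⟨1, by norm_num, rfl, hxsub h0, h1 ▸ Set.left_mem_uIcc,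
              fun h => ?_, fun h => h1, h2, h3⟩
            rw [h] at h3
            exact absurd (h3.trans (hc2.trans hc3)) (lt_irrefl _)
          · have h0 : p 0 = xt t := by
              simpa [f, s, stairNext] using halfOpen_const hp 0 (by simp [f, s, stairNext])
            have h1 : p 1 ∈ Set.uIcc (y k) (yt t) := by
              simpa [f, s, stairNext] using halfOpen_mem_uIcc hp 1
            have h2 : e * az ≤ e * p 2 := by
              simpa [f, s, stairNext] using halfOpen_mul_le (e := e) hp 2 (by
                simpa [f, s, stairNext] using hc2'.le)
            have h3 : e * p 2 < e * c t 3 := by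
              simpa [f, s, stairNext] using halfOpen_mul_lt (e := e) hp 2 (by
                simpa [f, s, stairNext] using hc2')
            refine ⟨2, by norm_num, rfl, h0 ▸ hxt_mem, hysub h1,
              fun h => ?_, fun h => ?_, h2, h3⟩
            · rw [h] at h3
              exact absurd (h3.trans hc3) (lt_irrefl _)
            · rw [h] at h2
              exact absurd (hc0.trans hc1) h2.not_gt
        · have hsk := insertAfter_some_of_ne σ i hk
          fin_cases a
          · refine Or.inl ⟨k, hk, rfl, ?_, ?_, ?_, ?_⟩
            · exact halfOpen_const hp 0 (by simp [f, s, stairNext, hk])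
            · exact halfOpen_const hp 1 (by simp [f, s, stairNext, hk])
            · simpa [f, s, stairNext, hk] using halfOpen_mem_uIcc hp 2
            · simpa [f, s, stairNext, hk] using
                halfOpen_ne hp 2 (by simpa [f, s, stairNext, hk] using hz' k)
          · refine Or.inr (Or.inl ⟨k, hk, rfl, ?_, ?_, ?_, ?_⟩)
            · simpa [f, s, stairNext, hk] using halfOpen_mem_uIcc hp 0
            · simpa [f, s, stairNext, hk] using
                halfOpen_ne hp 0 (by simpa [f, s, stairNext, hk] using hx' k)
            · simpa [f, s, stairNext, hk] using
                halfOpen_const hp 1 (by simp [f, s, stairNext, hk])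
            · simpa [f, s, stairNext, hk] using
                halfOpen_const hp 2 (by simp [f, s, stairNext, hk])
          · refine Or.inr (Or.inr (Or.inl ⟨k, hk, rfl, ?_, ?_, ?_⟩))
            · simpa [f, s, stairNext, hk] using
                halfOpen_const hp 0 (by simp [f, s, stairNext, hk, hsk])
            · simpa [f, s, stairNext, hk, hsk] using
                halfOpen_ne hp 1 (by simpa [f, s, stairNext, hk, hsk] using hy' k)
            · simpa [f, s, stairNext, hk] using
                halfOpen_const hp 2 (by simp [f, s, stairNext, hk, hsk])
    refine SimpleLoop.of_halfOpen ?_ ?_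
    · rintro ⟨κ, a⟩ h
      have h0 := congrFun h 0
      have h1 := congrFun h 1
      have h2 := congrFun h 2
      rcases κ with _ | k
      · fin_cases a
        · exact hcne 3 4 hc3 (show c t 3 = z (σ i) by simpa [f, s, stairNext] using h2)
        · exact hxne (by simpa [f, s, stairNext] using h0)
        · exact hyne (by simpa [f, s, stairNext] using h1)
      · by_cases hk : k = i
        · subst hk
          fin_cases a
          · exact hcne 0 1 hc0 (show z k = c t 1 by simpa [f, s, stairNext] using h2)
          · exact hcne 1 2 hc1 (show c t 1 = az by simpa [f, s, stairNext] using h2)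
          · exact hcne 2 3 hc2 (show az = c t 3 by simpa [f, s, stairNext] using h2)
        · have hsk := insertAfter_some_of_ne σ i hk
          fin_cases a
          · exact hz' k (by simpa [f, s, stairNext, hk] using h2)
          · exact hx' k (by simpa [f, s, stairNext, hk] using h0)
          · exact hy' k (by simpa [f, s, stairNext, hk, hsk] using h1)
    · have zinj : ∀ {k l}, z (σ k) = z (σ l) → k = l := fun h => σ.injective (hz h)
      intro a b p ha hb
      rcases spec a p ha with ⟨k, hk, rfl, A0, A1, A2, A3⟩ | ⟨k, hk, rfl, A0, A1, A2, A3⟩ |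
          ⟨k, hk, rfl, A0, A1, A2⟩ | ⟨rfl, A0, A1, A2⟩ | ⟨rfl, A0, A1, A2⟩ |
          ⟨m, hm, rfl, A0, A1, A2, A3, A4, A5⟩ <;>
        rcases spec b p hb with ⟨l, hl, rfl, B0, B1, B2, B3⟩ | ⟨l, hl, rfl, B0, B1, B2, B3⟩ |
          ⟨l, hl, rfl, B0, B1, B2⟩ | ⟨rfl, B0, B1, B2⟩ | ⟨rfl, B0, B1, B2⟩ |
          ⟨n, hn, rfl, B0, B1, B2, B3, B4, B5⟩
      · rw [hx (A0.symm.trans B0)]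
      · obtain rfl := hy (A1.symm.trans B2)
        exact absurd B3 A3
      · obtain rfl := hx (A0.symm.trans B0)
        exact absurd A1 B1
      · exact absurd (B2 ▸ A2) (hay k hk (by rw [← A1, B1]; exact hyt_mem)).1
      · obtain rfl := hx (A0.symm.trans B0)
        exact absurd A1 B1
      · exact absurd (A0 ▸ B0) (hax k hk)
      · obtain rfl := hy (B1.symm.trans A2)
        exact absurd A3 B3
      · rw [zinj (A3.symm.trans B3)]
      · obtain rfl := zinj (A3.symm.trans B2)
        exact absurd B0 A1
      · exact absurd (zinj (A3.symm.trans B2)) hk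
      · exact absurd (zinj (A3.symm.trans B2)) hk
      · exact absurd B0 ((hay k hk (A2 ▸ B1)).2 _ A0)
      · obtain rfl := hx (B0.symm.trans A0)
        exact absurd B1 A1
      · obtain rfl := zinj (A2.symm.trans B3)
        exact absurd A0 B1
      · rw [zinj (A2.symm.trans B2)]
      · exact absurd (zinj (A2.symm.trans B2)) hk
      · exact absurd (zinj (A2.symm.trans B2)) hk
      · have h1 : σ k = i := by
          by_contra h1
          exact hax _ h1 (A0 ▸ B0)
        exact absurd (h1 ▸ B3 (h1 ▸ A2)) A1
      · exact absurd (A2 ▸ B2) (hay l hl (by rw [← B1, A1]; exact hyt_mem)).1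
      · exact absurd (zinj (B3.symm.trans A2)) hl
      · exact absurd (zinj (B2.symm.trans A2)) hl
      · rfl
      · exact absurd B0 A0
      · exact absurd A2 B2
      · obtain rfl := hx (B0.symm.trans A0)
        exact absurd B1 A1
      · exact absurd (zinj (B3.symm.trans A2)) hl
      · exact absurd (zinj (B2.symm.trans A2)) hl
      · exact absurd A0 B0
      · rfl
      · exact absurd A2 B2
      · exact absurd (B0 ▸ A0) (hax l hl)
      · exact absurd A0 ((hay l hl (B2 ▸ A1)).2 _ B0)
      · have h1 : σ l = i := by
          by_contra h1
          exact hax _ h1 (B0 ▸ A0)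
        exact absurd (h1 ▸ A3 (h1 ▸ B2)) B1
      · exact absurd B2 A2
      · exact absurd B2 A2
      · have : m = n := by
          interval_cases m <;> interval_cases n <;> first | rfl | (exfalso; linarith)
        rw [this]
  have hpath := EdgesRepresent.of_path (stairNext_injective _) hfc hsimple (K := K)
  rw [hf1] at hpath
  refine hpath ?_
  -- for `t = 0` the new link is the old one, with three additional vertices on the segment at `i`
  have hP : ∀ a, a ≠ ((i, 0) : ι × Fin 3) → stair σ x y z a ≠ ![x i, y i, z i] := fun a ha h =>
    ha (((simpleLoop_stair hσ hx hy hz).robust (stairNext_injective σ)).injective (h.trans rfl))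
  set E₀ : Set (Point3 × Point3) :=
    {e | ∃ a, a ≠ ((i, 0) : ι × Fin 3) ∧ e = (stair σ x y z a, stair σ x y z (stairNext σ a))}
    with hE₀
  have hE₀_fst : ∀ q, (![x i, y i, z i], q) ∉ E₀ := by
    rintro q ⟨a, ha, h⟩
    exact hP a ha (congrArg Prod.fst h).symm
  have hne3 : ∀ {w : ℝ}, w ≠ z i → (![x i, y i, w] : Point3) ≠ ![x i, y i, z i] := fun hw h =>
    hw (congrFun h 2)
  have h0 : EdgesRepresent
      (Insert.insert ((![x i, y i, z i] : Point3), ![x i, y i, z (σ i)]) E₀) K := by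
    unfold StairRepresents at h
    convert h using 1
    ext e
    simp only [Set.mem_insert_iff, hE₀, loopEdges, Set.mem_ofPred_eq]
    constructor
    · rintro (rfl | ⟨a, -, rfl⟩)
      · exact ⟨(i, 0), rfl⟩
      · exact ⟨a, rfl⟩
    · rintro ⟨a, rfl⟩
      by_cases ha : a = (i, 0)
      · subst ha
        exact Or.inl rfl
      · exact Or.inr ⟨a, ha, rfl⟩
  have hz_ne' := hz' i
  have h1 := h0.subdivide (hE₀_fst _) (q := ![x i, y i, c 0 3])
    (mem_openSegment_of_third (by
      simp only [hc]
      rcases haz with ⟨h1, h2⟩ | ⟨h1, h2⟩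
      · left; constructor <;> linarith
      · right; constructor <;> linarith) _ _)
  have hne_c3 : c 0 3 ≠ z i := by
    simp only [hc]
    rcases haz with ⟨h1, h2⟩ | ⟨h1, h2⟩
    · intro h; linarith
    · intro h; linarith
  have hne_c2 : az ≠ z i := (hz_ne i).symm
  have h2 := h1.subdivide (q := ![x i, y i, az]) (by
      rintro (h | h)
      · exact hne3 hne_c3 (congrArg Prod.fst h).symm
      · exact hE₀_fst _ h)
    (mem_openSegment_of_third (by
      simp only [hc]
      rcases haz with ⟨h1, h2⟩ | ⟨h1, h2⟩
      · left; constructor <;> linarith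
      · right; constructor <;> linarith) _ _)
  have h3 := h2.subdivide (q := ![x i, y i, c 0 1]) (by
      rintro (h | h | h)
      · exact hne3 hne_c2 (congrArg Prod.fst h).symm
      · exact hne3 hne_c3 (congrArg Prod.fst h).symm
      · exact hE₀_fst _ h)
    (mem_openSegment_of_third (by
      simp only [hc]
      rcases haz with ⟨h1, h2⟩ | ⟨h1, h2⟩
      · left; constructor <;> linarith
      · right; constructor <;> linarith) _ _)
  convert h3 using 1
  have hx0 : xt 0 = x i := by simp [hxt]
  have hy0 : yt 0 = y i := by simp [hyt]
  have hf_ne : ∀ k, k ≠ i → ∀ a, f 0 (some k, a) = stair σ x y z (k, a) := by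
    intro k hk a
    fin_cases a <;> simp [f, stair, hk]
  have hf_next : ∀ k, f 0 (some k, 0) = stair σ x y z (k, 0) := by
    intro k
    simp [f, stair]
  ext e
  simp only [Set.mem_insert_iff, hE₀, loopEdges, Set.mem_ofPred_eq]
  constructor
  · rintro ⟨⟨_ | k, a⟩, rfl⟩
    · fin_cases a
      · right; right; right; left
        simp [f, stairNext, hx0, hy0]
      · right; right; right; right
        exact ⟨(i, 1), by simp, by simp [f, stairNext, stair, hx0, hy0]⟩
      · right; right; right; right
        exact ⟨(i, 2), by simp, by simp [f, stairNext, stair, hy0]⟩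
    · by_cases hk : k = i
      · subst hk
        fin_cases a
        · left
          simp [f, stairNext]
        · right; left
          simp [f, stairNext, hx0]
        · right; right; left
          simp [f, stairNext, hx0, hy0]
      · right; right; right; right
        refine ⟨(k, a), by simp [hk], ?_⟩
        rw [hf_ne k hk]
        fin_cases a
        · simp [stairNext, hf_ne k hk]
        · simp [stairNext, hf_ne k hk]
        · simp [stairNext, insertAfter_some_of_ne σ i hk, hf_next]
  · rintro (rfl | rfl | rfl | rfl | ⟨⟨k, a⟩, ha, rfl⟩)
    · exact ⟨(some i, 0), by simp [f, stairNext]⟩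
    · exact ⟨(some i, 1), by simp [f, stairNext, hx0]⟩
    · exact ⟨(some i, 2), by simp [f, stairNext, hx0, hy0]⟩
    · exact ⟨(none, 0), by simp [f, stairNext, hx0, hy0]⟩
    · by_cases hk : k = i
      · subst hk
        fin_cases a
        · exact absurd rfl ha
        · exact ⟨(none, 1), by simp [f, stairNext, stair, hx0, hy0]⟩
        · exact ⟨(none, 2), by simp [f, stairNext, stair, hy0]⟩
      · refine ⟨(some k, a), ?_⟩
        rw [hf_ne k hk]
        fin_cases a
        · simp [stairNext, hf_ne k hk]
        · simp [stairNext, hf_ne k hk]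
        · simp [stairNext, insertAfter_some_of_ne σ i hk, hf_next]

end Stair

/-! ### Symmetries of lattice links -/

section Stair

variable {ι : Type*}

theorem StairRepresents.reindex {κ : Type*} (e : κ ≃ ι) {σ : Equiv.Perm ι} {τ : Equiv.Perm κ}
    (hτ : ∀ k, e (τ k) = σ (e k)) {x y z : ι → ℝ} {K : PolygonalKnot}
    (h : StairRepresents σ x y z K) :
    StairRepresents τ (fun k => x (e k)) (fun k => y (e k)) (fun k => z (e k)) K := by
  have hE : loopEdges (stairNext τ) (stair τ (fun k => x (e k)) (fun k => y (e k))
      fun k => z (e k)) = loopEdges (stairNext σ) (stair σ x y z) := by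
    have key : ∀ k a, stair τ (fun k => x (e k)) (fun k => y (e k)) (fun k => z (e k)) (k, a) =
        stair σ x y z (e k, a) := by
      intro k a
      fin_cases a <;> simp [stair, hτ]
    have key' : ∀ k a, stair τ (fun k => x (e k)) (fun k => y (e k)) (fun k => z (e k))
        (stairNext τ (k, a)) = stair σ x y z (stairNext σ (e k, a)) := by
      intro k a
      fin_cases a
      · exact key k 1
      · exact key k 2
      · exact (key (τ k) 0).trans (by rw [hτ]; rfl)
    ext p
    constructor
    · rintro ⟨⟨k, a⟩, rfl⟩
      exact ⟨(e k, a), by rw [key, key']⟩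
    · rintro ⟨⟨i, a⟩, rfl⟩
      refine ⟨(e.symm i, a), ?_⟩
      rw [key, key', e.apply_symm_apply]
  unfold StairRepresents
  rw [hE]
  exact h

/-- The cyclic permutation of the coordinates. -/
def cyclicMap : Point3 →ₗ[ℝ] Point3 where
  toFun v := ![v 2, v 0, v 1]
  map_add' v w := by ext k; fin_cases k <;> simp
  map_smul' c v := by ext k; fin_cases k <;> simp

/-- The roles of the three coordinates can be permuted cyclically: the rotation of space about the
main diagonal is isotopic to the identity. -/
theorem StairRepresents.rotate [Fintype ι] {σ : Equiv.Perm ι} (hσ : ∀ i, σ i ≠ i) {x y z : ι → ℝ}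
    (hx : Function.Injective x) (hy : Function.Injective y) (hz : Function.Injective z)
    {K : PolygonalKnot} (h : StairRepresents σ x y z K) :
    StairRepresents σ (fun i => z (σ i)) (fun i => x (σ i)) y K := by
  have h1 := h.map_linear (stairNext_injective σ) (simpleLoop_stair hσ hx hy hz) cyclicMap (by
    intro t ht v hv
    have h0 := congrFun hv 0
    have h1 := congrFun hv 1
    have h2 := congrFun hv 2
    simp [cyclicMap] at h0 h1 h2
    -- the determinant of `(1 - t) • 1 + t • L`
    have hpos : 0 < (1 - t) ^ 3 + t ^ 3 := by
      rcases eq_or_lt_of_le ht.1 with h | h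
      · rw [← h]; norm_num
      · have := pow_nonneg (sub_nonneg.2 ht.2) 3
        positivity
    ext k
    apply (mul_eq_zero.1 (?_ : ((1 - t) ^ 3 + t ^ 3) * v k = 0)).resolve_left hpos.ne'
    fin_cases k
    · simp only [Fin.zero_eta]
      linear_combination (1 - t) ^ 2 * h0 - (1 - t) * t * h2 + t ^ 2 * h1
    · simp only [Fin.mk_one]
      linear_combination (1 - t) ^ 2 * h1 - (1 - t) * t * h0 + t ^ 2 * h2
    · simp only [Fin.reduceFinMk]
      linear_combination (1 - t) ^ 2 * h2 - (1 - t) * t * h1 + t ^ 2 * h0)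
  have hE : loopEdges (stairNext σ) (stair σ (fun i => z (σ i)) (fun i => x (σ i)) y) =
      loopEdges (stairNext σ) fun a => cyclicMap (stair σ x y z a) := by
    ext p
    constructor
    · rintro ⟨⟨i, a⟩, rfl⟩
      fin_cases a
      · exact ⟨(i, 2), by simp [stair, stairNext, cyclicMap]⟩
      · exact ⟨(σ i, 0), by simp [stair, stairNext, cyclicMap]⟩
      · exact ⟨(σ i, 1), by simp [stair, stairNext, cyclicMap]⟩
    · rintro ⟨⟨i, a⟩, rfl⟩
      fin_cases a
      · exact ⟨(σ.symm i, 1), by simp [stair, stairNext, cyclicMap]⟩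
      · exact ⟨(σ.symm i, 2), by simp [stair, stairNext, cyclicMap]⟩
      · exact ⟨(i, 0), by simp [stair, stairNext, cyclicMap]⟩
  unfold StairRepresents
  rw [hE]
  exact h1

/-- Rotating three times is the same as replacing each point by its successor. -/
theorem StairRepresents.of_rotate [Fintype ι] {σ : Equiv.Perm ι} (hσ : ∀ i, σ i ≠ i)
    {x y z : ι → ℝ} (hx : Function.Injective x) (hy : Function.Injective y)
    (hz : Function.Injective z) {K : PolygonalKnot}
    (h : StairRepresents σ (fun i => z (σ i)) (fun i => x (σ i)) y K) :
    StairRepresents σ x y z K := by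
  have hx' : Function.Injective fun i => x (σ i) := hx.comp σ.injective
  have hy' : Function.Injective fun i => y (σ i) := hy.comp σ.injective
  have hz' : Function.Injective fun i => z (σ i) := hz.comp σ.injective
  have h1 := (h.rotate hσ hz' hx' hy).rotate hσ hy' (hz'.comp σ.injective) hx'
  have h2 := (h1.reindex σ.symm (τ := σ) (by simp)).reindex σ.symm (τ := σ) (by simp)
  simpa using h2

/-- The first factor of `(x, y, z) ↦ (-y, -x, -z)`. This linear map of determinant one is factored
into two maps which are joined to the identity by segments of invertible maps; it has the
eigenvalue `-1` itself, so that the segment from the identity to it contains a singular map. -/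
def flipMap₁ : Point3 →ₗ[ℝ] Point3 where
  toFun v := ![v 0, -v 2, v 1]
  map_add' v w := by ext k; fin_cases k <;> simp; ring
  map_smul' c v := by ext k; fin_cases k <;> simp

/-- The second factor of `(x, y, z) ↦ (-y, -x, -z)`, after `flipMap₁`. -/
def flipMap₂ : Point3 →ₗ[ℝ] Point3 where
  toFun v := ![-v 2, -v 0, v 1]
  map_add' v w := by ext k; fin_cases k <;> simp <;> ring
  map_smul' c v := by ext k; fin_cases k <;> simp

/-- The map `(x, y, z) ↦ (-y, -x, -z)` exchanges the directions of `x` and `y`. It takes a lattice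
link to a lattice link with the opposite orientation, since its segments appear in the order `z`,
`y`, `x`. -/
theorem StairRepresents.reverse [Fintype ι] {σ : Equiv.Perm ι} (hσ : ∀ i, σ i ≠ i) {x y z : ι → ℝ}
    (hx : Function.Injective x) (hy : Function.Injective y) (hz : Function.Injective z)
    {K : PolygonalKnot} (h : StairRepresents σ x y z K) :
    StairRepresents σ.symm (fun i => -y i) (fun i => -x i) (fun i => -z (σ i)) K.reverse := by
  have hs := simpleLoop_stair hσ hx hy hz
  have h1 := h.map_linear (stairNext_injective σ) hs flipMap₁ (by
    intro t ht v hv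
    have h0 := congrFun hv 0
    have h1 := congrFun hv 1
    have h2 := congrFun hv 2
    simp [flipMap₁] at h0 h1 h2
    have hpos : 0 < (1 - t) ^ 2 + t ^ 2 := by nlinarith [sq_nonneg (1 - 2 * t)]
    ext k
    fin_cases k
    · simp only [Fin.zero_eta, Pi.zero_apply]
      linear_combination h0
    · apply (mul_eq_zero.1 (?_ : ((1 - t) ^ 2 + t ^ 2) * v 1 = 0)).resolve_left hpos.ne'
      linear_combination (1 - t) * h1 + t * h2
    · apply (mul_eq_zero.1 (?_ : ((1 - t) ^ 2 + t ^ 2) * v 2 = 0)).resolve_left hpos.ne'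
      linear_combination (1 - t) * h2 - t * h1)
  have hs1 : SimpleLoop (stairNext σ) fun a => flipMap₁ (stair σ x y z a) := by
    have hinj : Function.Injective flipMap₁ := by
      intro v w hvw
      have h0 := congrFun hvw 0
      have h1 := congrFun hvw 1
      have h2 := congrFun hvw 2
      simp [flipMap₁] at h0 h1 h2
      ext k
      fin_cases k <;> assumption
    refine ⟨fun a ha => hs.ne a (hinj ha), fun a b τ τ' h0 h1 h0' h1' he =>
      hs.disjoint a b τ τ' h0 h1 h0' h1' (hinj ?_)⟩
    simpa only [map_add, map_smul] using he
  have h2 := h1.map_linear (stairNext_injective σ) hs1 flipMap₂ (by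
    intro t ht v hv
    have h0 := congrFun hv 0
    have h1 := congrFun hv 1
    have h2 := congrFun hv 2
    simp [flipMap₂] at h0 h1 h2
    -- the determinant of `(1 - t) • 1 + t • L`
    have hpos : 0 < (1 - t) ^ 3 + t ^ 3 := by
      rcases eq_or_lt_of_le ht.1 with h | h
      · rw [← h]; norm_num
      · have := pow_nonneg (sub_nonneg.2 ht.2) 3
        positivity
    ext k
    apply (mul_eq_zero.1 (?_ : ((1 - t) ^ 3 + t ^ 3) * v k = 0)).resolve_left hpos.ne'
    fin_cases k
    · simp only [Fin.zero_eta]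
      linear_combination (1 - t) ^ 2 * h0 + (1 - t) * t * h2 - t ^ 2 * h1
    · simp only [Fin.mk_one]
      linear_combination (1 - t) ^ 2 * h1 + (1 - t) * t * h0 + t ^ 2 * h2
    · simp only [Fin.reduceFinMk]
      linear_combination (1 - t) ^ 2 * h2 - (1 - t) * t * h1 - t ^ 2 * h0)
  have hE : loopEdges (stairNext σ.symm)
      (stair σ.symm (fun i => -y i) (fun i => -x i) fun i => -z (σ i)) =
      Prod.swap ⁻¹' loopEdges (stairNext σ) fun a => flipMap₂ (flipMap₁ (stair σ x y z a)) := by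
    ext ⟨p, q⟩
    simp only [loopEdges, Set.mem_preimage, Prod.swap_prod_mk, Set.mem_ofPred_eq, Prod.mk.injEq]
    constructor
    · rintro ⟨⟨i, a⟩, rfl, rfl⟩
      fin_cases a
      · exact ⟨(i, 0), by simp [stair, stairNext, flipMap₁, flipMap₂]⟩
      · exact ⟨(σ.symm i, 2), by simp [stair, stairNext, flipMap₁, flipMap₂]⟩
      · exact ⟨(σ.symm i, 1), by simp [stair, stairNext, flipMap₁, flipMap₂]⟩
    · rintro ⟨⟨i, a⟩, rfl, rfl⟩
      fin_cases a
      · exact ⟨(i, 0), by simp [stair, stairNext, flipMap₁, flipMap₂]⟩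
      · exact ⟨(σ i, 2), by simp [stair, stairNext, flipMap₁, flipMap₂]⟩
      · exact ⟨(σ i, 1), by simp [stair, stairNext, flipMap₁, flipMap₂]⟩
  unfold StairRepresents
  rw [hE]
  exact h2.reverse

end Stair

/-! ### Lattice links with integer coordinates and their bad crossings -/

/-- A lattice link: points with pairwise different integer coordinates, and a successor map without
fixed points on them. The link itself is `stair next x y z`. -/
structure LatticeLink (ι : Type*) where
  /-- the successor of a point -/
  next : Equiv.Perm ι
  x : ι → ℤ
  y : ι → ℤ
  z : ι → ℤ
  next_ne : ∀ i, next i ≠ i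
  x_injective : Function.Injective x
  y_injective : Function.Injective y
  z_injective : Function.Injective z

/-- `c` lies strictly between the integers `a` and `b`. -/
def IntBetween (c a b : ℤ) : Prop := (a < c ∧ c < b) ∨ (b < c ∧ c < a)

theorem int_cast_mem_uIcc {a b c : ℤ} :
    (c : ℝ) ∈ Set.uIcc (a : ℝ) (b : ℝ) ↔ (a ≤ c ∧ c ≤ b) ∨ (b ≤ c ∧ c ≤ a) := by
  rw [Set.mem_uIcc]
  norm_cast

namespace LatticeLink

variable {ι : Type*} (S : LatticeLink ι)

/-- The oriented lattice link is the knot `K`. -/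
def Represents (K : PolygonalKnot) : Prop :=
  StairRepresents S.next (fun i => (S.x i : ℝ)) (fun i => (S.y i : ℝ)) (fun i => (S.z i : ℝ)) K

theorem cast_injective {x : ι → ℤ} (hx : Function.Injective x) :
    Function.Injective fun i => (x i : ℝ) :=
  Int.cast_injective.comp hx

theorem coord_ne {a b : ι} (h : a ≠ b) : S.x a ≠ S.x b ∧ S.y a ≠ S.y b ∧ S.z a ≠ S.z b :=
  ⟨S.x_injective.ne h, S.y_injective.ne h, S.z_injective.ne h⟩

theorem eq_or_ne_coord (a b : ι) : (S.x a = S.x b ∧ S.y a = S.y b ∧ S.z a = S.z b) ∨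
    (S.x a ≠ S.x b ∧ S.y a ≠ S.y b ∧ S.z a ≠ S.z b) := by
  rcases eq_or_ne a b with rfl | h
  · simp
  · exact Or.inr (S.coord_ne h)

theorem Represents.congr [Fintype ι] {S T : LatticeLink ι} (hn : S.next = T.next)
    (hx : ∀ i j, S.x i < S.x j ↔ T.x i < T.x j) (hy : ∀ i j, S.y i < S.y j ↔ T.y i < T.y j)
    (hz : ∀ i j, S.z i < S.z j ↔ T.z i < T.z j) {K : PolygonalKnot} (h : S.Represents K) :
    T.Represents K := by
  unfold Represents at h ⊢
  rw [← hn]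
  exact h.congr S.next_ne (cast_injective S.x_injective) (cast_injective S.y_injective)
    (cast_injective S.z_injective) (by simpa using hx) (by simpa using hy) (by simpa using hz)

/-- Cyclic permutation of the coordinates. -/
@[simps]
def rotate : LatticeLink ι where
  next := S.next
  x i := S.z (S.next i)
  y i := S.x (S.next i)
  z := S.y
  next_ne := S.next_ne
  x_injective := S.z_injective.comp S.next.injective
  y_injective := S.x_injective.comp S.next.injective
  z_injective := S.y_injective

theorem represents_rotate [Fintype ι] {K : PolygonalKnot} :
    S.rotate.Represents K ↔ S.Represents K :=
  ⟨fun h => StairRepresents.of_rotate S.next_ne (cast_injective S.x_injective)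
      (cast_injective S.y_injective) (cast_injective S.z_injective) h,
    fun h => StairRepresents.rotate S.next_ne (cast_injective S.x_injective)
      (cast_injective S.y_injective) (cast_injective S.z_injective) h⟩

/-- The image under `(x, y, z) ↦ (-y, -x, -z)` with the opposite orientation. -/
@[simps]
def reverse : LatticeLink ι where
  next := S.next.symm
  x i := -S.y i
  y i := -S.x i
  z i := -S.z (S.next i)
  next_ne i h := S.next_ne i (by rw [Equiv.symm_apply_eq] at h; exact h.symm)
  x_injective := neg_injective.comp S.y_injective
  y_injective := neg_injective.comp S.x_injective
  z_injective := neg_injective.comp (S.z_injective.comp S.next.injective)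

theorem Represents.reverse [Fintype ι] {S : LatticeLink ι} {K : PolygonalKnot}
    (h : S.Represents K) : S.reverse.Represents K.reverse := by
  have := StairRepresents.reverse S.next_ne (cast_injective S.x_injective)
    (cast_injective S.y_injective) (cast_injective S.z_injective) h
  simpa [Represents] using this

/-- Insertion of a point after `i`. -/
@[simps]
def insert [DecidableEq ι] (i : ι) (ax ay az : ℤ) (hx : ∀ k, S.x k ≠ ax) (hy : ∀ k, S.y k ≠ ay)
    (hz : ∀ k, S.z k ≠ az) : LatticeLink (Option ι) where
  next := insertAfter S.next i
  x := extend ax S.x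
  y := extend ay S.y
  z := extend az S.z
  next_ne := insertAfter_ne_self _ _ S.next_ne
  x_injective := extend_injective S.x_injective hx
  y_injective := extend_injective S.y_injective hy
  z_injective := extend_injective S.z_injective hz

theorem Represents.insert [Fintype ι] [DecidableEq ι] {S : LatticeLink ι} {i : ι} {ax ay az : ℤ}
    {hx : ∀ k, S.x k ≠ ax} {hy : ∀ k, S.y k ≠ ay} {hz : ∀ k, S.z k ≠ az}
    (haz : IntBetween az (S.z i) (S.z (S.next i)))
    (hax : ∀ k, k ≠ i → ¬ ((S.x i ≤ S.x k ∧ S.x k ≤ ax) ∨ (ax ≤ S.x k ∧ S.x k ≤ S.x i)))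
    (hay : ∀ k, k ≠ i → ((S.y i ≤ S.y k ∧ S.y k ≤ ay) ∨ (ay ≤ S.y k ∧ S.y k ≤ S.y i)) →
      ¬ ((S.z k ≤ S.z (S.next i) ∧ S.z (S.next i) ≤ S.z (S.next k)) ∨
        (S.z (S.next k) ≤ S.z (S.next i) ∧ S.z (S.next i) ≤ S.z k)) ∧
      max (S.x i) ax < min (S.x k) (S.x (S.next k)))
    {K : PolygonalKnot} (h : S.Represents K) : (S.insert i ax ay az hx hy hz).Represents K := by
  have hext : ∀ (a : ℤ) (f : ι → ℤ), (fun κ => ((extend a f κ : ℤ) : ℝ)) =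
      extend (a : ℝ) fun k => (f k : ℝ) := by
    intro a f
    funext κ
    cases κ <;> rfl
  unfold Represents
  simp only [insert_next, insert_x, insert_y, insert_z, hext]
  refine StairRepresents.insert S.next_ne (cast_injective S.x_injective)
    (cast_injective S.y_injective) (cast_injective S.z_injective) ?_
    (by exact_mod_cast hx) (by exact_mod_cast hy) (by exact_mod_cast hz) ?_ ?_ h
  · rcases haz with h | h
    · left; exact_mod_cast h
    · right; exact_mod_cast h
  · intro k hk
    rw [int_cast_mem_uIcc]
    exact hax k hk
  · intro k hk hk'
    rw [int_cast_mem_uIcc] at hk'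
    obtain ⟨h1, h2⟩ := hay k hk hk'
    refine ⟨by rwa [int_cast_mem_uIcc], fun u hu hu' => ?_⟩
    have h3 : (max (S.x i) ax : ℤ) < ((min (S.x k) (S.x (S.next k)) : ℤ) : ℝ) := by
      exact_mod_cast h2
    push_cast at h3
    exact absurd (hu.1.trans hu'.2) (not_le.2 h3)

/-- All coordinates are multiplied by three, to make room for new points. -/
@[simps]
def triple : LatticeLink ι where
  next := S.next
  x i := 3 * S.x i
  y i := 3 * S.y i
  z i := 3 * S.z i
  next_ne := S.next_ne
  x_injective i j h := S.x_injective (by simpa using h)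
  y_injective i j h := S.y_injective (by simpa using h)
  z_injective i j h := S.z_injective (by simpa using h)

theorem Represents.triple [Fintype ι] {S : LatticeLink ι} {K : PolygonalKnot}
    (h : S.Represents K) : S.triple.Represents K :=
  Represents.congr (S := S) (T := S.triple) rfl (by simp) (by simp) (by simp) h

/-- The crossings of the `(y,z)`-projection between the `y`-segment after `p.1` and the `z`-segment
after `p.2` where the crossing condition fails. -/
def bad0 : Set (ι × ι) :=
  {p | IntBetween (S.z (S.next p.1)) (S.z p.2) (S.z (S.next p.2)) ∧
    IntBetween (S.y p.2) (S.y p.1) (S.y (S.next p.1)) ∧ S.x p.2 ≤ S.x (S.next p.1)}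

/-- The crossings of the `(z,x)`-projection between the `z`-segment after `p.1` and the `x`-segment
after `p.2` where the crossing condition fails. -/
def bad1 : Set (ι × ι) :=
  {p | IntBetween (S.x p.1) (S.x p.2) (S.x (S.next p.2)) ∧
    IntBetween (S.z (S.next p.2)) (S.z p.1) (S.z (S.next p.1)) ∧ S.y p.2 ≤ S.y p.1}

/-- The crossings of the `(x,y)`-projection between the `x`-segment after `p.1` and the `y`-segment
after `p.2` where the crossing condition fails. -/
def bad2 : Set (ι × ι) :=
  {p | IntBetween (S.y p.1) (S.y p.2) (S.y (S.next p.2)) ∧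
    IntBetween (S.x (S.next p.2)) (S.x p.1) (S.x (S.next p.1)) ∧
    S.z (S.next p.2) ≤ S.z (S.next p.1)}

theorem sign_cases {a b : ℤ} (h : a ≠ b) :
    ((b - a).sign = 1 ∧ a < b) ∨ ((b - a).sign = -1 ∧ b < a) := by
  rcases lt_or_gt_of_ne h with h | h
  · exact Or.inl ⟨Int.sign_eq_one_of_pos (by omega), h⟩
  · exact Or.inr ⟨Int.sign_eq_neg_one_of_neg (by omega), h⟩

/-- The link with one new point after `j`, close to the projection of a bad crossing between the
`y`-segment at `j` and the `z`-segment at `i`. -/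
def fixAux [DecidableEq ι] (j i : ι) : LatticeLink (Option ι) :=
  S.triple.insert j (3 * S.x (S.next j) + (S.x j - S.x (S.next j)).sign)
    (3 * S.y i + (S.y (S.next j) - S.y j).sign)
    (3 * S.z (S.next j) + 2 * (S.z (S.next i) - S.z i).sign)
    (fun k => by
      have := sign_cases (S.coord_ne (S.next_ne j)).1
      simp only [triple_x]
      omega)
    (fun k => by
      have := sign_cases (S.coord_ne (S.next_ne j)).2.1.symm
      simp only [triple_y]
      omega)
    (fun k => by
      have := sign_cases (S.coord_ne (S.next_ne i)).2.2.symm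
      simp only [triple_z]
      omega)

/-- Removal of a bad crossing of the `(y,z)`-projection, between the `y`-segment at `j` and the
`z`-segment at `i`: two new points, `some none` after `j` and `none` after `i`, are
inserted so that the `y`-segment passes the `z`-segment where the latter has been interrupted.
Both lie close to the projection of the crossing, within the room that is made by `triple`; the
signs put them on the sides where no new bad crossing arises. -/
def fix [DecidableEq ι] (j i : ι) (hij : i ≠ S.next j) : LatticeLink (Option (Option ι)) :=
  (S.fixAux j i).insert (some i) (3 * S.x i + (S.x (S.next i) - S.x i).sign)
    (3 * S.y i + 2 * (S.y (S.next j) - S.y j).sign)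
    (3 * S.z (S.next j) + (S.z (S.next i) - S.z i).sign)
    (by
      have h1 := sign_cases (S.coord_ne (S.next_ne j)).1
      have h2 := sign_cases (S.coord_ne (S.next_ne i)).1.symm
      have h3 := (S.coord_ne hij).1
      rintro (_ | k) <;> simp only [fixAux, insert_x, extend_none, extend_some, triple_x] <;> omega)
    (by
      have := sign_cases (S.coord_ne (S.next_ne j)).2.1.symm
      rintro (_ | k) <;> simp only [fixAux, insert_y, extend_none, extend_some, triple_y] <;> omega)
    (by
      have := sign_cases (S.coord_ne (S.next_ne i)).2.2.symm
      rintro (_ | k) <;> simp only [fixAux, insert_z, extend_none, extend_some, triple_z] <;> omega)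

theorem fst_ne_snd_of_mem_bad0 {j i : ι} (hb : (j, i) ∈ S.bad0) : j ≠ i := by
  rintro rfl
  have := hb.1
  simp only [IntBetween] at this
  omega

theorem snd_ne_next_of_mem_bad0 {j i : ι} (hb : (j, i) ∈ S.bad0) : i ≠ S.next j := by
  rintro rfl
  have := hb.2.1
  simp only [IntBetween] at this
  omega

theorem Represents.fixAux [Fintype ι] [DecidableEq ι] {S : LatticeLink ι} {j i : ι}
    (hb : (j, i) ∈ S.bad0) {K : PolygonalKnot} (h : S.Represents K) :
    (S.fixAux j i).Represents K := by
  have hη := sign_cases (S.coord_ne (S.next_ne j)).1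
  have hd := sign_cases (S.coord_ne (S.next_ne j)).2.1.symm
  have he := sign_cases (S.coord_ne (S.next_ne i)).2.2.symm
  have hy := hb.2.1
  -- in the rotated link the `y`-segment at `j` is a `z`-segment, into which a point can be inserted
  rw [← represents_rotate]
  generalize hη' : (S.x j - S.x (S.next j)).sign = η at hη
  generalize hd' : (S.y (S.next j) - S.y j).sign = d at hd
  generalize he' : (S.z (S.next i) - S.z i).sign = e at he
  have hne : ∀ k, k ≠ j → S.x (S.next k) ≠ S.x (S.next j) ∧ S.y (S.next k) ≠ S.y (S.next j) ∧
    S.z (S.next k) ≠ S.z (S.next j) := fun k hk => S.coord_ne (S.next.injective.ne hk)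
  have h1 : (S.triple.rotate.insert j (3 * S.z (S.next j) - 2 * e) (3 * S.x (S.next j) - η)
      (3 * S.y i + d) (fun k => by simp only [triple_z, triple_next, rotate_x]; omega)
      (fun k => by simp only [triple_x, triple_next, rotate_y]; omega)
      (fun k => by simp only [triple_y, rotate_z]; omega)).Represents K := by
    refine Represents.insert ?_ ?_ ?_ ((represents_rotate _).2 h.triple)
    · simp only [IntBetween, rotate_z, rotate_next, triple_y, triple_next] at hy ⊢
      omega
    · intro k hk
      have := hne k hk
      simp only [rotate_x, triple_z, triple_next]
      omega
    · intro k hk hk'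
      have := hne k hk
      simp only [rotate_y, triple_x, triple_next] at hk'
      omega
  have hn : ∀ κ, (insertAfter S.next j κ = some (S.next j) ∧ κ = none) ∨
      (insertAfter S.next j κ = none ∧ κ = some j) ∨
      (∃ k, k ≠ j ∧ insertAfter S.next j κ = some (S.next k) ∧ κ = some k) := by
    rintro (_ | k)
    · simp
    · by_cases hk : k = j
      · subst hk; simp
      · simp [hk, insertAfter_some_of_ne]
  refine Represents.congr (T := (S.fixAux j i).rotate) (by rfl) ?_ ?_ ?_ h1
  · intro κ μ
    simp only [LatticeLink.fixAux, hη', hd', he', insert_x, insert_z, rotate_x, insert_next,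
      triple_next]
    rcases hn κ with ⟨h, rfl⟩ | ⟨h, rfl⟩ | ⟨k, hk, h, rfl⟩ <;>
      rcases hn μ with ⟨h', rfl⟩ | ⟨h', rfl⟩ | ⟨l, hl, h', rfl⟩ <;>
      simp only [h, h', extend_none, extend_some, rotate_x, triple_z, triple_next] <;>
      (try have := hne k hk) <;> (try have := hne l hl) <;> omega
  · intro κ μ
    simp only [LatticeLink.fixAux, hη', hd', he', insert_y, insert_x, rotate_y, insert_next,
      triple_next]
    rcases hn κ with ⟨h, rfl⟩ | ⟨h, rfl⟩ | ⟨k, hk, h, rfl⟩ <;>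
      rcases hn μ with ⟨h', rfl⟩ | ⟨h', rfl⟩ | ⟨l, hl, h', rfl⟩ <;>
      simp only [h, h', extend_none, extend_some, rotate_y, triple_x, triple_next] <;>
      (try have := hne k hk) <;> (try have := hne l hl) <;> omega
  · intro κ μ
    simp only [LatticeLink.fixAux, hd', insert_y, insert_z, rotate_z]
    cases κ <;> cases μ <;> simp

theorem Represents.fix [Fintype ι] [DecidableEq ι] {S : LatticeLink ι} {j i : ι}
    (hb : (j, i) ∈ S.bad0) {K : PolygonalKnot} (h : S.Represents K) :
    (S.fix j i (S.snd_ne_next_of_mem_bad0 hb)).Represents K := by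
  have hij := S.snd_ne_next_of_mem_bad0 hb
  have hη := sign_cases (S.coord_ne (S.next_ne j)).1
  have hξ := sign_cases (S.coord_ne (S.next_ne i)).1.symm
  have hd := sign_cases (S.coord_ne (S.next_ne j)).2.1.symm
  have he := sign_cases (S.coord_ne (S.next_ne i)).2.2.symm
  obtain ⟨hz, hy, hx⟩ := hb
  have hni : insertAfter S.next j (some i) = some (S.next i) :=
    insertAfter_some_of_ne _ _ (S.fst_ne_snd_of_mem_bad0 ⟨hz, hy, hx⟩).symm
  have hxne := (S.coord_ne hij).1
  simp only [IntBetween] at hz hx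
  refine Represents.insert ?_ ?_ ?_ (h.fixAux ⟨hz, hy, hx⟩)
  · simp only [LatticeLink.fixAux, IntBetween, insert_z, insert_next, triple_next, extend_some,
      hni, triple_z]
    omega
  · rintro (_ | k) hk
    · simp only [LatticeLink.fixAux, insert_x, extend_none, extend_some, triple_x]
      omega
    · have := S.coord_ne (show k ≠ i by simpa using hk)
      simp only [LatticeLink.fixAux, insert_x, extend_some, triple_x]
      omega
  · rintro (_ | k) hk hk'
    · simp only [LatticeLink.fixAux, insert_x, insert_z, insert_next, extend_none, extend_some,
        triple_next, triple_x, triple_z, hni, insertAfter_none]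
      omega
    · have := S.coord_ne (show k ≠ i by simpa using hk)
      simp only [LatticeLink.fixAux, insert_y, extend_some, triple_y] at hk'
      omega

end LatticeLink

/-! ### Counting bad crossings after a removal -/

namespace LatticeLink

variable {ι : Type*} (S : LatticeLink ι)

/-- The point of the old link that a point of `fix` is close to. -/
def collapse (j i : ι) : Option (Option ι) → ι := extend i (extend j id)

@[simp] theorem collapse_none (j i : ι) : collapse j i none = i := rfl

@[simp] theorem collapse_some_none (j i : ι) : collapse j i (some none) = j := rfl

@[simp] theorem collapse_some_some (j i k : ι) : collapse j i (some (some k)) = k := rfl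

theorem collapse_eq {j i : ι} (hji : j ≠ i) {u v : Option (Option ι)}
    (h : collapse j i u = collapse j i v) : u = v ∨
      (u = none ∧ v = some (some i)) ∨ (u = some (some i) ∧ v = none) ∨
      (u = some none ∧ v = some (some j)) ∨ (u = some (some j) ∧ v = some none) := by
  rcases u with _ | _ | k <;> rcases v with _ | _ | l <;> simp_all

variable [DecidableEq ι]

/-- The successor of each point of the new link: the points that are affected by the insertions,
and all others. -/
theorem fix_next_cases {j i : ι} (hij : i ≠ S.next j) (hji : j ≠ i) (u : Option (Option ι)) :
    ((u = none ∧ (S.fix j i hij).next u = some (some (S.next i))) ∨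
      (u = some none ∧ (S.fix j i hij).next u = some (some (S.next j))) ∨
      (u = some (some i) ∧ (S.fix j i hij).next u = none) ∨
      (u = some (some j) ∧ (S.fix j i hij).next u = some none)) ∨
    ∃ l, l ≠ i ∧ l ≠ j ∧ u = some (some l) ∧
      (S.fix j i hij).next u = some (some (S.next l)) := by
  rcases u with _ | _ | l
  · left; left
    simp [fix, fixAux, insertAfter_some_of_ne _ _ hji.symm]
  · left; right; left
    simp [fix, fixAux, insertAfter_some]
  · by_cases hi : l = i
    · subst hi
      left; right; right; left
      simp [fix]
    by_cases hj : l = j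
    · subst hj
      left; right; right; right
      simp [fix, fixAux, insertAfter_some, hi]
    · right
      exact ⟨l, hi, hj, rfl, by simp [fix, fixAux, insertAfter_some, hi, hj]⟩

/-- The facts about the positions of the new points that are used to compare crossings. -/
theorem fix_coord {j i : ι} (hb : (j, i) ∈ S.bad0) : ∃ ξ η d e : ℤ,
    ((ξ = 1 ∧ S.x i < S.x (S.next i)) ∨ (ξ = -1 ∧ S.x (S.next i) < S.x i)) ∧
    ((η = 1 ∧ S.x (S.next j) < S.x j) ∨ (η = -1 ∧ S.x j < S.x (S.next j))) ∧
    ((d = 1 ∧ S.y j < S.y i ∧ S.y i < S.y (S.next j)) ∨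
      (d = -1 ∧ S.y (S.next j) < S.y i ∧ S.y i < S.y j)) ∧
    ((e = 1 ∧ S.z i < S.z (S.next j) ∧ S.z (S.next j) < S.z (S.next i)) ∨
      (e = -1 ∧ S.z (S.next i) < S.z (S.next j) ∧ S.z (S.next j) < S.z i)) ∧
    (S.fix j i (S.snd_ne_next_of_mem_bad0 hb)).x =
      extend (3 * S.x i + ξ) (extend (3 * S.x (S.next j) + η) fun k => 3 * S.x k) ∧
    (S.fix j i (S.snd_ne_next_of_mem_bad0 hb)).y =
      extend (3 * S.y i + 2 * d) (extend (3 * S.y i + d) fun k => 3 * S.y k) ∧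
    (S.fix j i (S.snd_ne_next_of_mem_bad0 hb)).z =
      extend (3 * S.z (S.next j) + e) (extend (3 * S.z (S.next j) + 2 * e) fun k => 3 * S.z k) := by
  have hd := sign_cases (S.coord_ne (S.next_ne j)).2.1.symm
  have he := sign_cases (S.coord_ne (S.next_ne i)).2.2.symm
  refine ⟨_, _, _, _, sign_cases (S.coord_ne (S.next_ne i)).1.symm,
    sign_cases (S.coord_ne (S.next_ne j)).1, ?_, ?_, rfl, rfl, rfl⟩
  · have := hb.2.1
    simp only [IntBetween] at this
    lia (splits := 30)
  · have := hb.1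
    simp only [IntBetween] at this
    lia (splits := 30)

/-- Every bad crossing of the new link comes from a bad crossing of the old one, and none comes from
the crossing that has been removed. The segments that are excluded at the end are too short for
a crossing. What remains of an interrupted segment are parts with disjoint ranges, so that
`collapse` is injective on bad crossings. -/
theorem mem_bad0_of_fix {j i : ι} (hb : (j, i) ∈ S.bad0) {u v : Option (Option ι)}
    (hp : (u, v) ∈ (S.fix j i (S.snd_ne_next_of_mem_bad0 hb)).bad0) :
    (collapse j i u, collapse j i v) ∈ S.bad0 ∧ ¬ (collapse j i u = j ∧ collapse j i v = i) ∧
      u ≠ some (some i) ∧ v ≠ some none := by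
  have hij := S.snd_ne_next_of_mem_bad0 hb
  have hji := S.fst_ne_snd_of_mem_bad0 hb
  obtain ⟨ξ, η, d, e, hξ, hη, hd, he, fix_x, fix_y, fix_z⟩ := S.fix_coord hb
  have hxb := hb.2.2
  have hxij := (S.coord_ne hij).1
  have hxji := S.coord_ne hji
  have hij' : ¬ i = j := hji.symm
  obtain ⟨g1, g2, g3⟩ := hp
  have D1 := fun l => S.eq_or_ne_coord l (S.next j)
  have D2 := fun l => S.eq_or_ne_coord (S.next l) i
  have D3 := fun l (h : l ≠ i) => S.coord_ne h
  have D4 := fun l (h : l ≠ j) => S.coord_ne (S.next.injective.ne h)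
  simp only at g1 g2 g3 hxb
  rcases S.fix_next_cases hij hji u with hu | ⟨l, hl, hl', rfl, hu⟩ <;>
    rcases S.fix_next_cases hij hji v with hv | ⟨k, hk, hk', rfl, hv⟩
  · clear D1 D2 D3 D4
    rcases hu with ⟨rfl, hu⟩ | ⟨rfl, hu⟩ | ⟨rfl, hu⟩ | ⟨rfl, hu⟩ <;>
      rcases hv with ⟨rfl, hv⟩ | ⟨rfl, hv⟩ | ⟨rfl, hv⟩ | ⟨rfl, hv⟩ <;>
      simp only [bad0, IntBetween, Set.mem_ofPred_eq, hu, hv, fix_x, fix_y, fix_z, collapse_none,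
        collapse_some_none, collapse_some_some, extend_none, extend_some, ne_eq, reduceCtorEq,
        not_false_eq_true, and_true, not_true_eq_false, and_false, hji, hij',
        Option.some.injEq] at g1 g2 g3 ⊢ <;> lia (splits := 30)
  · have D1 := D1 k
    have D2 := D2 k
    have D3 := D3 k hk
    have D4 := D4 k hk'
    rcases hu with ⟨rfl, hu⟩ | ⟨rfl, hu⟩ | ⟨rfl, hu⟩ | ⟨rfl, hu⟩ <;>
      simp only [bad0, IntBetween, Set.mem_ofPred_eq, hu, hv, fix_x, fix_y, fix_z, collapse_none,
        collapse_some_none, collapse_some_some, extend_none, extend_some, ne_eq, reduceCtorEq,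
        not_false_eq_true, and_true, not_true_eq_false, and_false, hji, hij',
        Option.some.injEq, hk] at g1 g2 g3 ⊢ <;> lia (splits := 30)
  · have D1 := D1 l
    have D2 := D2 l
    have D3 := D3 l hl
    have D4 := D4 l hl'
    rcases hv with ⟨rfl, hv⟩ | ⟨rfl, hv⟩ | ⟨rfl, hv⟩ | ⟨rfl, hv⟩ <;>
      simp only [bad0, IntBetween, Set.mem_ofPred_eq, hu, hv, fix_x, fix_y, fix_z, collapse_none,
        collapse_some_none, collapse_some_some, extend_none, extend_some, ne_eq, reduceCtorEq,
        not_false_eq_true, and_true, not_true_eq_false, and_false,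
        Option.some.injEq, hl, hl'] at g1 g2 g3 ⊢ <;> lia (splits := 30)
  · simp only [bad0, IntBetween, Set.mem_ofPred_eq, hu, hv, fix_x, fix_y, fix_z,
        collapse_some_some, extend_some, ne_eq, reduceCtorEq, not_false_eq_true, and_true,
        Option.some.injEq, hl] at g1 g2 g3 ⊢
    lia (splits := 30)

/-- The analogue of `mem_bad0_of_fix` for the `(z,x)`-projection. -/
theorem mem_bad1_of_fix {j i : ι} (hb : (j, i) ∈ S.bad0) {u v : Option (Option ι)}
    (hp : (u, v) ∈ (S.fix j i (S.snd_ne_next_of_mem_bad0 hb)).bad1) :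
    (collapse j i u, collapse j i v) ∈ S.bad1 ∧ u ≠ some none ∧ v ≠ some (some i) ∧
      v ≠ some none := by
  have hij := S.snd_ne_next_of_mem_bad0 hb
  have hji := S.fst_ne_snd_of_mem_bad0 hb
  obtain ⟨ξ, η, d, e, hξ, hη, hd, he, fix_x, fix_y, fix_z⟩ := S.fix_coord hb
  have hxb := hb.2.2
  have hxij := (S.coord_ne hij).1
  have hxji := S.coord_ne hji
  have hij' : ¬ i = j := hji.symm
  obtain ⟨g1, g2, g3⟩ := hp
  have D1 := fun l => S.eq_or_ne_coord l (S.next j)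
  have D2 := fun l => S.eq_or_ne_coord (S.next l) i
  have D3 := fun l (h : l ≠ i) => S.coord_ne h
  have D4 := fun l (h : l ≠ j) => S.coord_ne (S.next.injective.ne h)
  simp only at g1 g2 g3 hxb
  rcases S.fix_next_cases hij hji u with hu | ⟨l, hl, hl', rfl, hu⟩ <;>
    rcases S.fix_next_cases hij hji v with hv | ⟨k, hk, hk', rfl, hv⟩
  · clear D1 D2 D3 D4
    rcases hu with ⟨rfl, hu⟩ | ⟨rfl, hu⟩ | ⟨rfl, hu⟩ | ⟨rfl, hu⟩ <;>
      rcases hv with ⟨rfl, hv⟩ | ⟨rfl, hv⟩ | ⟨rfl, hv⟩ | ⟨rfl, hv⟩ <;>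
      simp only [bad1, IntBetween, Set.mem_ofPred_eq, hu, hv, fix_x, fix_y, fix_z, collapse_none,
        collapse_some_none, collapse_some_some, extend_none, extend_some, ne_eq, reduceCtorEq,
        not_false_eq_true, and_true, not_true_eq_false, and_false,
        Option.some.injEq] at g1 g2 g3 ⊢ <;> lia (splits := 30)
  · have D1 := D1 k
    have D2 := D2 k
    have D3 := D3 k hk
    have D4 := D4 k hk'
    rcases hu with ⟨rfl, hu⟩ | ⟨rfl, hu⟩ | ⟨rfl, hu⟩ | ⟨rfl, hu⟩ <;>
      simp only [bad1, IntBetween, Set.mem_ofPred_eq, hu, hv, fix_x, fix_y, fix_z, collapse_none,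
        collapse_some_none, collapse_some_some, extend_none, extend_some, ne_eq, reduceCtorEq,
        not_false_eq_true, and_true, not_true_eq_false, and_false, Option.some.injEq, hk]
        at g1 g2 g3 ⊢ <;> lia (splits := 30)
  · have D1 := D1 l
    have D2 := D2 l
    have D3 := D3 l hl
    have D4 := D4 l hl'
    rcases hv with ⟨rfl, hv⟩ | ⟨rfl, hv⟩ | ⟨rfl, hv⟩ | ⟨rfl, hv⟩ <;>
      simp only [bad1, IntBetween, Set.mem_ofPred_eq, hu, hv, fix_x, fix_y, fix_z, collapse_none,
        collapse_some_none, collapse_some_some, extend_none, extend_some, ne_eq, reduceCtorEq,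
        not_false_eq_true, and_true, not_true_eq_false, and_false,
        Option.some.injEq] at g1 g2 g3 ⊢ <;> lia (splits := 30)
  · simp only [bad1, IntBetween, Set.mem_ofPred_eq, hu, hv, fix_x, fix_y, fix_z,
        collapse_some_some, extend_some, ne_eq, reduceCtorEq, not_false_eq_true, and_true,
        Option.some.injEq, hk] at g1 g2 g3 ⊢
    lia (splits := 30)

/-- The analogue of `mem_bad0_of_fix` for the `(x,y)`-projection. -/
theorem mem_bad2_of_fix {j i : ι} (hb : (j, i) ∈ S.bad0) {u v : Option (Option ι)}
    (hp : (u, v) ∈ (S.fix j i (S.snd_ne_next_of_mem_bad0 hb)).bad2) :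
    (collapse j i u, collapse j i v) ∈ S.bad2 ∧ u ≠ some none ∧ u ≠ some (some i) ∧
      v ≠ some (some i) := by
  have hij := S.snd_ne_next_of_mem_bad0 hb
  have hji := S.fst_ne_snd_of_mem_bad0 hb
  obtain ⟨ξ, η, d, e, hξ, hη, hd, he, fix_x, fix_y, fix_z⟩ := S.fix_coord hb
  have hxb := hb.2.2
  have hxij := (S.coord_ne hij).1
  have hxji := S.coord_ne hji
  have hij' : ¬ i = j := hji.symm
  obtain ⟨g1, g2, g3⟩ := hp
  have D1 := fun l => S.eq_or_ne_coord l (S.next j)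
  have D2 := fun l => S.eq_or_ne_coord (S.next l) i
  have D3 := fun l (h : l ≠ i) => S.coord_ne h
  have D4 := fun l (h : l ≠ j) => S.coord_ne (S.next.injective.ne h)
  simp only at g1 g2 g3 hxb
  rcases S.fix_next_cases hij hji u with hu | ⟨l, hl, hl', rfl, hu⟩ <;>
    rcases S.fix_next_cases hij hji v with hv | ⟨k, hk, hk', rfl, hv⟩
  · clear D1 D2 D3 D4
    rcases hu with ⟨rfl, hu⟩ | ⟨rfl, hu⟩ | ⟨rfl, hu⟩ | ⟨rfl, hu⟩ <;>
      rcases hv with ⟨rfl, hv⟩ | ⟨rfl, hv⟩ | ⟨rfl, hv⟩ | ⟨rfl, hv⟩ <;>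
      simp only [bad2, IntBetween, Set.mem_ofPred_eq, hu, hv, fix_x, fix_y, fix_z, collapse_none,
        collapse_some_none, collapse_some_some, extend_none, extend_some, ne_eq, reduceCtorEq,
        not_false_eq_true, and_true, not_true_eq_false, and_false, hji,
        Option.some.injEq] at g1 g2 g3 ⊢ <;> lia (splits := 30)
  · have D1 := D1 k
    have D2 := D2 k
    have D3 := D3 k hk
    have D4 := D4 k hk'
    rcases hu with ⟨rfl, hu⟩ | ⟨rfl, hu⟩ | ⟨rfl, hu⟩ | ⟨rfl, hu⟩ <;>
      simp only [bad2, IntBetween, Set.mem_ofPred_eq, hu, hv, fix_x, fix_y, fix_z, collapse_none,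
        collapse_some_none, collapse_some_some, extend_none, extend_some, ne_eq, reduceCtorEq,
        not_false_eq_true, and_true, not_true_eq_false, and_false, Option.some.injEq, hji, hk]
        at g1 g2 g3 ⊢ <;> lia (splits := 30)
  · have D1 := D1 l
    have D2 := D2 l
    have D3 := D3 l hl
    have D4 := D4 l hl'
    rcases hv with ⟨rfl, hv⟩ | ⟨rfl, hv⟩ | ⟨rfl, hv⟩ | ⟨rfl, hv⟩ <;>
      simp only [bad2, IntBetween, Set.mem_ofPred_eq, hu, hv, fix_x, fix_y, fix_z, collapse_none,
        collapse_some_none, collapse_some_some, extend_none, extend_some, ne_eq, reduceCtorEq,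
        not_false_eq_true, and_true, not_true_eq_false, and_false, hji, hl,
        Option.some.injEq] at g1 g2 g3 ⊢ <;> lia (splits := 30)
  · simp only [bad2, IntBetween, Set.mem_ofPred_eq, hu, hv, fix_x, fix_y, fix_z,
        collapse_some_some, extend_some, ne_eq, reduceCtorEq, not_false_eq_true, and_true,
        Option.some.injEq, hl, hk] at g1 g2 g3 ⊢
    lia (splits := 30)


end LatticeLink

namespace LatticeLink

variable {ι : Type*} (S : LatticeLink ι)

section Fix

variable [DecidableEq ι]

theorem fix_next_none {j i : ι} (hij : i ≠ S.next j) (hji : j ≠ i) :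
    (S.fix j i hij).next none = some (some (S.next i)) := by
  simp [fix, fixAux, insertAfter_some_of_ne _ _ hji.symm]

theorem fix_next_some_none {j i : ι} (hij : i ≠ S.next j) :
    (S.fix j i hij).next (some none) = some (some (S.next j)) := by
  simp [fix, fixAux, insertAfter_some]

theorem fix_next_snd {j i : ι} (hij : i ≠ S.next j) :
    (S.fix j i hij).next (some (some i)) = none := by
  simp [fix]

theorem fix_next_fst {j i : ι} (hij : i ≠ S.next j) (hji : j ≠ i) :
    (S.fix j i hij).next (some (some j)) = some none := by
  simp [fix, fixAux, insertAfter_some, hji]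

/-- The two parts of the interrupted `z`-segment have disjoint height ranges. -/
theorem not_between_fix_z {j i : ι} (hb : (j, i) ∈ S.bad0) (c : ℤ) :
    let T := S.fix j i (S.snd_ne_next_of_mem_bad0 hb)
    ¬ (IntBetween c (T.z none) (T.z (T.next none)) ∧
      IntBetween c (T.z (some (some i))) (T.z (T.next (some (some i))))) := by
  obtain ⟨ξ, η, d, e, -, -, -, he, -, -, fix_z⟩ := S.fix_coord hb
  simp only [IntBetween, fix_next_none _ _ (S.fst_ne_snd_of_mem_bad0 hb), fix_next_snd, fix_z,
    extend_none, extend_some]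
  lia

/-- The two parts of the interrupted `y`-segment have disjoint ranges. -/
theorem not_between_fix_y {j i : ι} (hb : (j, i) ∈ S.bad0) (c : ℤ) :
    let T := S.fix j i (S.snd_ne_next_of_mem_bad0 hb)
    ¬ (IntBetween c (T.y (some none)) (T.y (T.next (some none))) ∧
      IntBetween c (T.y (some (some j))) (T.y (T.next (some (some j))))) := by
  obtain ⟨ξ, η, d, e, -, -, hd, -, -, fix_y, -⟩ := S.fix_coord hb
  simp only [IntBetween, fix_next_fst _ _ (S.fst_ne_snd_of_mem_bad0 hb), fix_next_some_none, fix_y,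
    extend_none, extend_some]
  lia

variable [Finite ι]

theorem ncard_bad0_fix_lt {j i : ι} (hb : (j, i) ∈ S.bad0) :
    (S.fix j i (S.snd_ne_next_of_mem_bad0 hb)).bad0.ncard < S.bad0.ncard := by
  have hji := S.fst_ne_snd_of_mem_bad0 hb
  refine lt_of_le_of_lt ?_ (Set.ncard_sdiff_singleton_lt_of_mem hb)
  refine Set.ncard_le_ncard_of_injOn (fun p => (collapse j i p.1, collapse j i p.2)) ?_ ?_
  · rintro ⟨u, v⟩ hp
    obtain ⟨h1, h2, -⟩ := S.mem_bad0_of_fix hb hp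
    exact ⟨h1, by simpa using h2⟩
  · rintro ⟨u, v⟩ hp ⟨u', v'⟩ hp' he
    obtain ⟨-, h2, h3, h4⟩ := S.mem_bad0_of_fix hb hp
    obtain ⟨-, -, h3', h4'⟩ := S.mem_bad0_of_fix hb hp'
    obtain ⟨g1, g2, -⟩ := hp
    obtain ⟨g1', g2', -⟩ := hp'
    simp only [Prod.mk.injEq] at he
    rcases collapse_eq hji he.1 with rfl | ⟨rfl, rfl⟩ | ⟨rfl, rfl⟩ | ⟨rfl, rfl⟩ | ⟨rfl, rfl⟩ <;>
      rcases collapse_eq hji he.2 with rfl | ⟨rfl, rfl⟩ | ⟨rfl, rfl⟩ | ⟨rfl, rfl⟩ | ⟨rfl, rfl⟩ <;>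
      first
      | rfl
      | exact absurd rfl h3
      | exact absurd rfl h3'
      | exact absurd rfl h4
      | exact absurd rfl h4'
      | exact absurd ⟨rfl, rfl⟩ h2
      | exact absurd ⟨g1, g1'⟩ (S.not_between_fix_z hb _)
      | exact absurd ⟨g1', g1⟩ (S.not_between_fix_z hb _)
      | exact absurd ⟨g2, g2'⟩ (S.not_between_fix_y hb _)
      | exact absurd ⟨g2', g2⟩ (S.not_between_fix_y hb _)

theorem ncard_bad1_fix_le {j i : ι} (hb : (j, i) ∈ S.bad0) :
    (S.fix j i (S.snd_ne_next_of_mem_bad0 hb)).bad1.ncard ≤ S.bad1.ncard := by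
  have hji := S.fst_ne_snd_of_mem_bad0 hb
  refine Set.ncard_le_ncard_of_injOn (fun p => (collapse j i p.1, collapse j i p.2))
    (fun p hp => (S.mem_bad1_of_fix hb hp).1) ?_
  rintro ⟨u, v⟩ hp ⟨u', v'⟩ hp' he
  obtain ⟨-, h2, h3, h4⟩ := S.mem_bad1_of_fix hb hp
  obtain ⟨-, h2', h3', h4'⟩ := S.mem_bad1_of_fix hb hp'
  obtain ⟨-, g1, -⟩ := hp
  obtain ⟨-, g1', -⟩ := hp'
  simp only [Prod.mk.injEq] at he
  rcases collapse_eq hji he.2 with rfl | ⟨rfl, rfl⟩ | ⟨rfl, rfl⟩ | ⟨rfl, rfl⟩ | ⟨rfl, rfl⟩ <;>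
    rcases collapse_eq hji he.1 with rfl | ⟨rfl, rfl⟩ | ⟨rfl, rfl⟩ | ⟨rfl, rfl⟩ | ⟨rfl, rfl⟩ <;>
    first
    | rfl
    | exact absurd rfl h2
    | exact absurd rfl h2'
    | exact absurd rfl h3
    | exact absurd rfl h3'
    | exact absurd rfl h4
    | exact absurd rfl h4'
    | exact absurd ⟨g1, g1'⟩ (S.not_between_fix_z hb _)
    | exact absurd ⟨g1', g1⟩ (S.not_between_fix_z hb _)

theorem ncard_bad2_fix_le {j i : ι} (hb : (j, i) ∈ S.bad0) :
    (S.fix j i (S.snd_ne_next_of_mem_bad0 hb)).bad2.ncard ≤ S.bad2.ncard := by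
  have hji := S.fst_ne_snd_of_mem_bad0 hb
  refine Set.ncard_le_ncard_of_injOn (fun p => (collapse j i p.1, collapse j i p.2))
    (fun p hp => (S.mem_bad2_of_fix hb hp).1) ?_
  rintro ⟨u, v⟩ hp ⟨u', v'⟩ hp' he
  obtain ⟨-, h2, h3, h4⟩ := S.mem_bad2_of_fix hb hp
  obtain ⟨-, h2', h3', h4'⟩ := S.mem_bad2_of_fix hb hp'
  obtain ⟨g1, -⟩ := hp
  obtain ⟨g1', -⟩ := hp'
  simp only [Prod.mk.injEq] at he
  rcases collapse_eq hji he.1 with rfl | ⟨rfl, rfl⟩ | ⟨rfl, rfl⟩ | ⟨rfl, rfl⟩ | ⟨rfl, rfl⟩ <;>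
    rcases collapse_eq hji he.2 with rfl | ⟨rfl, rfl⟩ | ⟨rfl, rfl⟩ | ⟨rfl, rfl⟩ | ⟨rfl, rfl⟩ <;>
    first
    | rfl
    | exact absurd rfl h2
    | exact absurd rfl h2'
    | exact absurd rfl h3
    | exact absurd rfl h3'
    | exact absurd rfl h4
    | exact absurd rfl h4'
    | exact absurd ⟨g1, g1'⟩ (S.not_between_fix_y hb _)
    | exact absurd ⟨g1', g1⟩ (S.not_between_fix_y hb _)

end Fix

/-- The total number of crossings, in the three projections, where the crossing condition fails. -/
noncomputable def numBad : ℕ := S.bad0.ncard + S.bad1.ncard + S.bad2.ncard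

theorem numBad_rotate : S.rotate.numBad = S.numBad := by
  have h0 : S.rotate.bad0 = Prod.map S.next id ⁻¹' S.bad2 := rfl
  have h1 : S.rotate.bad1 = Prod.map id S.next ⁻¹' S.bad0 := rfl
  have h2 : S.rotate.bad2 = Prod.map S.next S.next ⁻¹' S.bad1 := rfl
  have key : ∀ (f g : Equiv.Perm ι) (s : Set (ι × ι)), (Prod.map f g ⁻¹' s).ncard = s.ncard := by
    intro f g s
    exact Set.ncard_preimage_of_injective_subset_range (f.injective.prodMap g.injective)
      (by rw [(f.surjective.prodMap g.surjective).range_eq]; exact Set.subset_univ s)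
  have e0 := key S.next (Equiv.refl _) S.bad2
  have e1 := key (Equiv.refl _) S.next S.bad0
  have e2 := key S.next S.next S.bad1
  simp only [Equiv.coe_refl] at e0 e1
  unfold numBad
  rw [h0, h1, h2, e0, e1, e2]
  ring

/-- A lattice link none of whose crossings violates its crossing condition. -/
structure IsGood : Prop where
  bad0_eq : S.bad0 = ∅
  bad1_eq : S.bad1 = ∅
  bad2_eq : S.bad2 = ∅

theorem IsGood.reverse {S : LatticeLink ι} (h : S.IsGood) : S.reverse.IsGood := by
  have h0 := h.bad0_eq
  have h1 := h.bad1_eq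
  have h2 := h.bad2_eq
  simp only [Set.eq_empty_iff_forall_notMem, bad0, bad1, bad2, IntBetween, Prod.forall,
    Set.mem_ofPred_eq] at h0 h1 h2
  constructor <;>
    simp only [Set.eq_empty_iff_forall_notMem, bad0, bad1, bad2, IntBetween, Prod.forall,
      Set.mem_ofPred_eq, reverse_next, reverse_x, reverse_y, reverse_z, Equiv.apply_symm_apply]
  · intro l k
    have := h1 k (S.next.symm l)
    rw [Equiv.apply_symm_apply] at this
    lia
  · intro l k
    have := h0 (S.next.symm k) l
    rw [Equiv.apply_symm_apply] at this
    lia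
  · intro l k
    have := h2 (S.next.symm k) (S.next.symm l)
    rw [Equiv.apply_symm_apply, Equiv.apply_symm_apply] at this
    lia

/-- All bad crossings can be removed, at the price of two new points for each of them. -/
theorem exists_isGood (b : ℕ) : ∀ {ι : Type} [Fintype ι] (S : LatticeLink ι) {K : PolygonalKnot},
    S.Represents K → S.numBad ≤ b → ∃ (κ : Type) (_ : Fintype κ) (T : LatticeLink κ),
      T.Represents K ∧ T.IsGood ∧ Fintype.card κ ≤ Fintype.card ι + 2 * b := by
  classical
  induction b with
  | zero =>
    intro ι _ S K hS hb
    have : S.bad0.ncard = 0 ∧ S.bad1.ncard = 0 ∧ S.bad2.ncard = 0 := by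
      unfold numBad at hb
      omega
    simp only [Set.ncard_eq_zero (Set.toFinite _)] at this
    exact ⟨ι, inferInstance, S, hS, ⟨this.1, this.2.1, this.2.2⟩, by simp⟩
  | succ b ih =>
    -- a bad crossing of the `(y,z)`-projection can be removed; those of the other projections become
    -- crossings of the `(y,z)`-projection of a rotated link
    have step : ∀ {ι : Type} [Fintype ι] (S : LatticeLink ι) {K : PolygonalKnot},
        S.Represents K → S.numBad ≤ b + 1 → S.bad0.Nonempty →
        ∃ (κ : Type) (_ : Fintype κ) (T : LatticeLink κ), T.Represents K ∧ T.IsGood ∧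
          Fintype.card κ ≤ Fintype.card ι + 2 * (b + 1) := by
      rintro ι _ S K hS hb ⟨⟨j, i⟩, hji⟩
      have h0 := S.ncard_bad0_fix_lt hji
      have h1 := S.ncard_bad1_fix_le hji
      have h2 := S.ncard_bad2_fix_le hji
      obtain ⟨κ, hκ, T, hT, hT', hle⟩ := ih (S.fix j i (S.snd_ne_next_of_mem_bad0 hji))
        (hS.fix hji) (by unfold numBad at hb ⊢; omega)
      refine ⟨κ, hκ, T, hT, hT', hle.trans ?_⟩
      simp only [Fintype.card_option]
      omega
    intro ι _ S K hS hb
    by_cases h0 : S.bad0.Nonempty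
    · exact step S hS hb h0
    by_cases h2 : S.bad2.Nonempty
    · refine step S.rotate ((represents_rotate S).2 hS) (by rwa [numBad_rotate]) ?_
      obtain ⟨⟨l, k⟩, h⟩ := h2
      refine ⟨(S.next.symm l, k), ?_⟩
      change (S.next (S.next.symm l), k) ∈ S.bad2
      rwa [Equiv.apply_symm_apply]
    by_cases h1 : S.bad1.Nonempty
    · refine step S.rotate.rotate ((represents_rotate _).2 ((represents_rotate S).2 hS))
        (by rwa [numBad_rotate, numBad_rotate]) ?_
      obtain ⟨⟨l, k⟩, h⟩ := h1
      refine ⟨(S.next.symm (S.next.symm l), S.next.symm k), ?_⟩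
      change (S.next (S.next (S.next.symm (S.next.symm l))), S.next (S.next.symm k)) ∈ S.bad1
      rwa [Equiv.apply_symm_apply, Equiv.apply_symm_apply, Equiv.apply_symm_apply]
    · simp only [Set.not_nonempty_iff_eq_empty] at h0 h1 h2
      exact ⟨ι, inferInstance, S, hS, ⟨h0, h1, h2⟩, by omega⟩

end LatticeLink

/-! ### Lattice links in marked cubes -/

namespace LatticeLink

variable {ι : Type*} {N : ℕ}

/-- A lattice link whose coordinates are the numbers below `N`. -/
@[simps]
def ofEquiv (σ : Equiv.Perm ι) (hσ : ∀ i, σ i ≠ i) (x y z : ι ≃ Fin N) : LatticeLink ι where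
  next := σ
  x i := (x i : ℕ)
  y i := (y i : ℕ)
  z i := (z i : ℕ)
  next_ne := hσ
  x_injective i j h := x.injective (Fin.ext (by simpa using h))
  y_injective i j h := y.injective (Fin.ext (by simpa using h))
  z_injective i j h := z.injective (Fin.ext (by simpa using h))

end LatticeLink

namespace MarkedCube

variable {ι : Type*} {N : ℕ} (σ : Equiv.Perm ι) (hσ : ∀ i, σ i ≠ i) (x y z : ι ≃ Fin N)

theorem existsUnique_mark (f g h : ι ≃ Fin N) (a : Fin 3) (k : Fin N) :
    ∃! u : Fin 3 → Fin N, u ∈ {u | ∃ i, u = ![f i, g i, h i]} ∧ u a = k := by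
  have hb : Function.Bijective fun i => (![f i, g i, h i] : Fin 3 → Fin N) a := by
    fin_cases a
    · exact f.bijective
    · exact g.bijective
    · exact h.bijective
  obtain ⟨i, hi⟩ := hb.2 k
  refine ⟨_, ⟨⟨i, rfl⟩, hi⟩, ?_⟩
  rintro _ ⟨⟨j, rfl⟩, hj⟩
  rw [hb.1 (hj.trans hi.symm)]

/-- The marked cube of a lattice link whose coordinates are the numbers below `N`. The `X`, `Y` and
`Z` markings are the vertices of the link. -/
def ofEquiv : MarkedCube N where
  mark := ![
    {u | ∃ i, u = ![x i, y i, z i]},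
    {u | ∃ i, u = ![x i, y i, (σ.trans z) i]},
    {u | ∃ i, u = ![(σ.trans x) i, y i, (σ.trans z) i]}]
  flat_unique := by
    intro l
    fin_cases l
    · exact existsUnique_mark x y z
    · exact existsUnique_mark x y (σ.trans z)
    · exact existsUnique_mark (σ.trans x) y (σ.trans z)
  right_angle := by
    intro a u v w hu hv hw h2 h3
    fin_cases a
    · obtain ⟨i, rfl⟩ := hu
      obtain ⟨j, rfl⟩ := hv
      obtain ⟨k, rfl⟩ := hw
      obtain rfl : j = i := x.injective h2
      have h3' : x (σ k) = x j := h3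
      obtain rfl : σ k = j := x.injective h3'
      have hz : z (σ k) ≠ z (σ (σ k)) := fun h => hσ _ (z.injective h).symm
      have hy : y (σ k) ≠ y k := fun h => hσ _ (y.injective h)
      refine ⟨2, 1, by decide, ⟨hz, fun b hb => ?_⟩, ⟨hy, fun b hb => ?_⟩⟩ <;>
        fin_cases b <;> simp_all
    · obtain ⟨i, rfl⟩ := hu
      obtain ⟨j, rfl⟩ := hv
      obtain ⟨k, rfl⟩ := hw
      obtain rfl : j = i := y.injective h2
      obtain rfl : k = j := y.injective h3
      have hz : z (σ k) ≠ z k := fun h => hσ _ (z.injective h)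
      have hx : x k ≠ x (σ k) := fun h => hσ _ (x.injective h).symm
      refine ⟨0, 2, by decide, ⟨hx, fun b hb => ?_⟩, ⟨hz, fun b hb => ?_⟩⟩ <;>
        fin_cases b <;> simp_all
    · obtain ⟨i, rfl⟩ := hu
      obtain ⟨j, rfl⟩ := hv
      obtain ⟨k, rfl⟩ := hw
      have h2' : z j = z (σ i) := h2
      obtain rfl : j = σ i := z.injective h2'
      have h3' : z (σ k) = z (σ i) := h3
      obtain rfl : k = i := σ.injective (z.injective h3')
      have hy : y k ≠ y (σ k) := fun h => hσ _ (y.injective h).symm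
      have hx : x (σ k) ≠ x k := fun h => hσ _ (x.injective h)
      refine ⟨1, 0, by decide, ⟨hy, fun b hb => ?_⟩, ⟨hx, fun b hb => ?_⟩⟩ <;>
        fin_cases b <;> simp_all

/-- Each pair of consecutive labels is joined by segments of one direction only. -/
theorem edgeAlong_cases {b : Fin 3} {u v : Fin 3 → Fin N}
    (h : (ofEquiv σ hσ x y z).EdgeAlong b u v) :
    ∃ i, (b = 2 ∧ u = ![x i, y i, z i] ∧ v = ![x i, y i, z (σ i)]) ∨
      (b = 0 ∧ u = ![x i, y i, z (σ i)] ∧ v = ![x (σ i), y i, z (σ i)]) ∨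
      (b = 1 ∧ u = ![x (σ i), y i, z (σ i)] ∧ v = ![x (σ i), y (σ i), z (σ i)]) := by
  obtain ⟨⟨l, hu, hv⟩, hb, hne⟩ := h
  have h0 := hne 0
  have h1 := hne 1
  have h2 := hne 2
  fin_cases l
  · obtain ⟨i, rfl⟩ := hu
    obtain ⟨j, rfl⟩ := hv
    obtain rfl : i = j := by
      fin_cases b <;> simp at h0 h1 h2 <;> first | exact h0 | exact h1
    refine ⟨i, Or.inl ⟨?_, rfl, rfl⟩⟩
    fin_cases b <;> simp_all
  · obtain ⟨i, rfl⟩ := hu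
    obtain ⟨j, rfl⟩ := hv
    obtain rfl : i = j := by
      fin_cases b <;> simp at h0 h1 h2 <;> first | exact h1 | exact h2
    refine ⟨i, Or.inr (Or.inl ⟨?_, rfl, rfl⟩)⟩
    fin_cases b <;> simp_all
  · obtain ⟨i, rfl⟩ := hu
    obtain ⟨j, rfl⟩ := hv
    obtain rfl : σ i = j := by
      fin_cases b <;> simp at h0 h1 h2 <;> first | exact h0 | exact h2
    refine ⟨i, Or.inr (Or.inr ⟨?_, rfl, rfl⟩)⟩
    fin_cases b <;> simp_all

theorem edgeAlong_zero {u v : Fin 3 → Fin N} : (ofEquiv σ hσ x y z).EdgeAlong 0 u v ↔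
    ∃ i, u = ![x i, y i, z (σ i)] ∧ v = ![x (σ i), y i, z (σ i)] := by
  constructor
  · intro h
    obtain ⟨i, h | h | h⟩ := edgeAlong_cases σ hσ x y z h
    · exact absurd h.1 (by decide)
    · exact ⟨i, h.2⟩
    · exact absurd h.1 (by decide)
  · rintro ⟨i, rfl, rfl⟩
    refine ⟨⟨1, ⟨i, rfl⟩, ⟨i, rfl⟩⟩, fun h => hσ i (x.injective h).symm, fun a ha => ?_⟩
    fin_cases a <;> simp_all

theorem edgeAlong_one {u v : Fin 3 → Fin N} : (ofEquiv σ hσ x y z).EdgeAlong 1 u v ↔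
    ∃ i, u = ![x (σ i), y i, z (σ i)] ∧ v = ![x (σ i), y (σ i), z (σ i)] := by
  constructor
  · intro h
    obtain ⟨i, h | h | h⟩ := edgeAlong_cases σ hσ x y z h
    · exact absurd h.1 (by decide)
    · exact absurd h.1 (by decide)
    · exact ⟨i, h.2⟩
  · rintro ⟨i, rfl, rfl⟩
    refine ⟨⟨2, ⟨i, rfl⟩, ⟨σ i, rfl⟩⟩, fun h => hσ i (y.injective h).symm, fun a ha => ?_⟩
    fin_cases a <;> simp_all

theorem edgeAlong_two {u v : Fin 3 → Fin N} : (ofEquiv σ hσ x y z).EdgeAlong 2 u v ↔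
    ∃ i, u = ![x i, y i, z i] ∧ v = ![x i, y i, z (σ i)] := by
  constructor
  · intro h
    obtain ⟨i, h | h | h⟩ := edgeAlong_cases σ hσ x y z h
    · exact ⟨i, h.2⟩
    · exact absurd h.1 (by decide)
    · exact absurd h.1 (by decide)
  · rintro ⟨i, rfl, rfl⟩
    refine ⟨⟨0, ⟨i, rfl⟩, ⟨i, rfl⟩⟩, fun h => hσ i (z.injective h).symm, fun a ha => ?_⟩
    fin_cases a <;> simp_all

theorem represents_ofEquiv_iff [Fintype ι] {K : PolygonalKnot} :
    (ofEquiv σ hσ x y z).Represents K ↔ (LatticeLink.ofEquiv σ hσ x y z).Represents K := by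
  have hE : (ofEquiv σ hσ x y z).edges = loopEdges (stairNext σ)
      (stair σ (fun i => (x i : ℝ) + 1 / 2) (fun i => (y i : ℝ) + 1 / 2)
        fun i => (z i : ℝ) + 1 / 2) := by
    have hc : ∀ i j k : Fin N, center ![i, j, k] = ![(i : ℝ) + 1 / 2, (j : ℝ) + 1 / 2,
        (k : ℝ) + 1 / 2] := by
      intro i j k
      funext a
      fin_cases a <;> rfl
    ext e
    constructor
    · rintro ⟨b, u, v, h, rfl⟩
      obtain ⟨i, ⟨-, rfl, rfl⟩ | ⟨-, rfl, rfl⟩ | ⟨-, rfl, rfl⟩⟩ := edgeAlong_cases σ hσ x y z h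
      · exact ⟨(i, 0), by simp only [hc]; rfl⟩
      · exact ⟨(i, 1), by simp only [hc]; rfl⟩
      · exact ⟨(i, 2), by simp only [hc]; rfl⟩
    · rintro ⟨⟨i, a⟩, rfl⟩
      fin_cases a
      · exact ⟨2, _, _, (edgeAlong_two σ hσ x y z).2 ⟨i, rfl, rfl⟩, by simp only [hc]; rfl⟩
      · exact ⟨0, _, _, (edgeAlong_zero σ hσ x y z).2 ⟨i, rfl, rfl⟩, by simp only [hc]; rfl⟩
      · exact ⟨1, _, _, (edgeAlong_one σ hσ x y z).2 ⟨i, rfl, rfl⟩, by simp only [hc]; rfl⟩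
  have hinj : ∀ f : ι ≃ Fin N, Function.Injective fun i => (f i : ℝ) := fun f i j h =>
    f.injective (Fin.ext (by simpa using h))
  have hinj' : ∀ f : ι ≃ Fin N, Function.Injective fun i => (f i : ℝ) + 1 / 2 := fun f i j h =>
    hinj f (add_right_cancel h)
  unfold Represents LatticeLink.Represents
  rw [hE]
  simp only [LatticeLink.ofEquiv_next, LatticeLink.ofEquiv_x, LatticeLink.ofEquiv_y,
    LatticeLink.ofEquiv_z, Int.cast_natCast]
  constructor
  · intro h
    exact StairRepresents.congr hσ (hinj' x) (hinj' y) (hinj' z) (by simp) (by simp) (by simp) h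
  · intro h
    exact StairRepresents.congr hσ (hinj x) (hinj y) (hinj z) (by simp) (by simp) (by simp) h

theorem intBetween_iff {a b c : Fin N} :
    IntBetween (a : ℕ) (b : ℕ) (c : ℕ) ↔ StrictlyBetween a b c := by
  simp only [IntBetween, StrictlyBetween, Nat.cast_lt, Fin.lt_def]

theorem bad0_iff {l k : ι} : (l, k) ∈ (LatticeLink.ofEquiv σ hσ x y z).bad0 ↔
    StrictlyBetween (z (σ l)) (z k) (z (σ k)) ∧ StrictlyBetween (y k) (y l) (y (σ l)) ∧
      ¬ x (σ l) < x k := by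
  simp [LatticeLink.bad0, intBetween_iff]

theorem bad1_iff {l k : ι} : (l, k) ∈ (LatticeLink.ofEquiv σ hσ x y z).bad1 ↔
    StrictlyBetween (x l) (x k) (x (σ k)) ∧ StrictlyBetween (z (σ k)) (z l) (z (σ l)) ∧
      ¬ y l < y k := by
  simp [LatticeLink.bad1, intBetween_iff]

theorem bad2_iff {l k : ι} : (l, k) ∈ (LatticeLink.ofEquiv σ hσ x y z).bad2 ↔
    StrictlyBetween (y l) (y k) (y (σ k)) ∧ StrictlyBetween (x (σ k)) (x l) (x (σ l)) ∧
      ¬ z (σ l) < z (σ k) := by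
  simp [LatticeLink.bad2, intBetween_iff]

/-- The violations of the crossing conditions in the marked cube are the bad crossings of the
lattice link. -/
theorem cross_zero {u v u' v' : Fin 3 → Fin N} : ((ofEquiv σ hσ x y z).Cross 0 u v u' v' ∧
    ¬ u 0 < u' 0) ↔ ∃ l k, (l, k) ∈ (LatticeLink.ofEquiv σ hσ x y z).bad0 ∧
      u = ![x (σ l), y l, z (σ l)] ∧ v = ![x (σ l), y (σ l), z (σ l)] ∧
      u' = ![x k, y k, z k] ∧ v' = ![x k, y k, z (σ k)] := by
  simp only [bad0_iff]
  constructor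
  · rintro ⟨⟨h1, h2, h3, h4⟩, h5⟩
    obtain ⟨l, rfl, rfl⟩ := (edgeAlong_one σ hσ x y z).1 h1
    obtain ⟨k, rfl, rfl⟩ := (edgeAlong_two σ hσ x y z).1 h2
    exact ⟨l, k, ⟨h3, h4, h5⟩, rfl, rfl, rfl, rfl⟩
  · rintro ⟨l, k, ⟨h3, h4, h5⟩, rfl, rfl, rfl, rfl⟩
    exact ⟨⟨(edgeAlong_one σ hσ x y z).2 ⟨l, rfl, rfl⟩,
      (edgeAlong_two σ hσ x y z).2 ⟨k, rfl, rfl⟩, h3, h4⟩, h5⟩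

theorem cross_one {u v u' v' : Fin 3 → Fin N} : ((ofEquiv σ hσ x y z).Cross 1 u v u' v' ∧
    ¬ u 1 < u' 1) ↔ ∃ l k, (l, k) ∈ (LatticeLink.ofEquiv σ hσ x y z).bad1 ∧
      u = ![x l, y l, z l] ∧ v = ![x l, y l, z (σ l)] ∧
      u' = ![x k, y k, z (σ k)] ∧ v' = ![x (σ k), y k, z (σ k)] := by
  simp only [bad1_iff]
  constructor
  · rintro ⟨⟨h1, h2, h3, h4⟩, h5⟩
    obtain ⟨l, rfl, rfl⟩ := (edgeAlong_two σ hσ x y z).1 h1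
    obtain ⟨k, rfl, rfl⟩ := (edgeAlong_zero σ hσ x y z).1 h2
    exact ⟨l, k, ⟨h3, h4, h5⟩, rfl, rfl, rfl, rfl⟩
  · rintro ⟨l, k, ⟨h3, h4, h5⟩, rfl, rfl, rfl, rfl⟩
    exact ⟨⟨(edgeAlong_two σ hσ x y z).2 ⟨l, rfl, rfl⟩,
      (edgeAlong_zero σ hσ x y z).2 ⟨k, rfl, rfl⟩, h3, h4⟩, h5⟩

theorem cross_two {u v u' v' : Fin 3 → Fin N} : ((ofEquiv σ hσ x y z).Cross 2 u v u' v' ∧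
    ¬ u 2 < u' 2) ↔ ∃ l k, (l, k) ∈ (LatticeLink.ofEquiv σ hσ x y z).bad2 ∧
      u = ![x l, y l, z (σ l)] ∧ v = ![x (σ l), y l, z (σ l)] ∧
      u' = ![x (σ k), y k, z (σ k)] ∧ v' = ![x (σ k), y (σ k), z (σ k)] := by
  simp only [bad2_iff]
  constructor
  · rintro ⟨⟨h1, h2, h3, h4⟩, h5⟩
    obtain ⟨l, rfl, rfl⟩ := (edgeAlong_zero σ hσ x y z).1 h1
    obtain ⟨k, rfl, rfl⟩ := (edgeAlong_one σ hσ x y z).1 h2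
    exact ⟨l, k, ⟨h3, h4, h5⟩, rfl, rfl, rfl, rfl⟩
  · rintro ⟨l, k, ⟨h3, h4, h5⟩, rfl, rfl, rfl, rfl⟩
    exact ⟨⟨(edgeAlong_zero σ hσ x y z).2 ⟨l, rfl, rfl⟩,
      (edgeAlong_one σ hσ x y z).2 ⟨k, rfl, rfl⟩, h3, h4⟩, h5⟩

theorem isCubeDiagram_ofEquiv (h : (LatticeLink.ofEquiv σ hσ x y z).IsGood) :
    (ofEquiv σ hσ x y z).IsCubeDiagram := by
  intro a u v u' v' hc
  by_contra hlt
  fin_cases a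
  · obtain ⟨l, k, hlk, -⟩ := (cross_zero σ hσ x y z).1 ⟨hc, hlt⟩
    rw [h.bad0_eq] at hlk
    exact hlk
  · obtain ⟨l, k, hlk, -⟩ := (cross_one σ hσ x y z).1 ⟨hc, hlt⟩
    rw [h.bad1_eq] at hlk
    exact hlk
  · obtain ⟨l, k, hlk, -⟩ := (cross_two σ hσ x y z).1 ⟨hc, hlt⟩
    rw [h.bad2_eq] at hlk
    exact hlk

theorem crossingCondition_two_ofEquiv
    (h : (ofEquiv σ hσ x y z).CrossingCondition 2) :
    (LatticeLink.ofEquiv σ hσ x y z).bad2 = ∅ := by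
  rw [Set.eq_empty_iff_forall_notMem]
  rintro ⟨l, k⟩ hlk
  obtain ⟨hc, hlt⟩ := (cross_two σ hσ x y z).2 ⟨l, k, hlk, rfl, rfl, rfl, rfl⟩
  exact hlt (h _ _ _ _ hc)

theorem numBad_zero_ofEquiv : (ofEquiv σ hσ x y z).numBad 0 =
    (LatticeLink.ofEquiv σ hσ x y z).bad0.ncard := by
  have hf : Function.Injective fun p : ι × ι => (y p.2, z (σ p.1)) := by
    rintro ⟨l, k⟩ ⟨l', k'⟩ h
    simpa [and_comm] using h
  rw [numBad, ← Set.ncard_image_of_injective _ hf]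
  congr 1
  ext ⟨r, s⟩
  constructor
  · rintro ⟨u, v, u', v', h1, h2, h3⟩
    obtain ⟨l, k, hlk, rfl, rfl, rfl, rfl⟩ := (cross_zero σ hσ x y z).1 ⟨h1, h2⟩
    exact ⟨(l, k), hlk, h3.symm⟩
  · rintro ⟨⟨l, k⟩, hlk, h⟩
    obtain ⟨hc, hlt⟩ := (cross_zero σ hσ x y z).2 ⟨l, k, hlk, rfl, rfl, rfl, rfl⟩
    exact ⟨_, _, _, _, hc, hlt, h.symm⟩

theorem numBad_one_ofEquiv : (ofEquiv σ hσ x y z).numBad 1 =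
    (LatticeLink.ofEquiv σ hσ x y z).bad1.ncard := by
  have hf : Function.Injective fun p : ι × ι => (z (σ p.2), x p.1) := by
    rintro ⟨l, k⟩ ⟨l', k'⟩ h
    simpa [and_comm] using h
  rw [numBad, ← Set.ncard_image_of_injective _ hf]
  congr 1
  ext ⟨r, s⟩
  constructor
  · rintro ⟨u, v, u', v', h1, h2, h3⟩
    obtain ⟨l, k, hlk, rfl, rfl, rfl, rfl⟩ := (cross_one σ hσ x y z).1 ⟨h1, h2⟩
    exact ⟨(l, k), hlk, h3.symm⟩
  · rintro ⟨⟨l, k⟩, hlk, h⟩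
    obtain ⟨hc, hlt⟩ := (cross_one σ hσ x y z).2 ⟨l, k, hlk, rfl, rfl, rfl, rfl⟩
    exact ⟨_, _, _, _, hc, hlt, h.symm⟩

end MarkedCube

namespace LatticeLink

theorem IsGood.congr {ι : Type*} {S T : LatticeLink ι} (hn : T.next = S.next)
    (hx : ∀ i j, S.x i < S.x j ↔ T.x i < T.x j) (hy : ∀ i j, S.y i < S.y j ↔ T.y i < T.y j)
    (hz : ∀ i j, S.z i < S.z j ↔ T.z i < T.z j) (hS : S.IsGood) : T.IsGood := by
  obtain ⟨h0, h1, h2⟩ := hS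
  constructor
  · rw [← h0]
    ext ⟨l, k⟩
    simp only [bad0, IntBetween, Set.mem_ofPred_eq, ← not_lt, hx, hy, hz, hn]
  · rw [← h1]
    ext ⟨l, k⟩
    simp only [bad1, IntBetween, Set.mem_ofPred_eq, ← not_lt, hx, hy, hz, hn]
  · rw [← h2]
    ext ⟨l, k⟩
    simp only [bad2, IntBetween, Set.mem_ofPred_eq, ← not_lt, hx, hy, hz, hn]

/-- The rank of a coordinate among all coordinates. -/
theorem exists_rank {ι : Type*} [Fintype ι] {f : ι → ℤ} (hf : Function.Injective f) :
    ∃ e : ι ≃ Fin (Fintype.card ι), ∀ i j, f i < f j ↔ e i < e j := by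
  classical
  let s : Finset ℤ := Finset.univ.image f
  have hs : s.card = Fintype.card ι := by
    rw [Finset.card_image_of_injective _ hf, Finset.card_univ]
  let e₁ : ι ≃ s := Equiv.ofBijective (fun i => ⟨f i, by simp [s]⟩)
    ⟨fun i j h => hf (congrArg Subtype.val h), fun ⟨a, ha⟩ => by
      obtain ⟨i, -, rfl⟩ := Finset.mem_image.1 ha
      exact ⟨i, rfl⟩⟩
  refine ⟨e₁.trans (s.orderIsoOfFin hs).symm.toEquiv, fun i j => ?_⟩
  rw [Equiv.trans_apply, Equiv.trans_apply, RelIso.coe_fn_toEquiv, OrderIso.lt_iff_lt]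
  exact Iff.rfl

/-- A lattice link without bad crossings gives a cube diagram. -/
theorem Represents.exists_isCubeDiagram {ι : Type*} [Fintype ι] {S : LatticeLink ι}
    {K : PolygonalKnot} (hS : S.Represents K) (hg : S.IsGood) :
    ∃ C : MarkedCube (Fintype.card ι), C.IsCubeDiagram ∧ C.Represents K := by
  obtain ⟨x, hx⟩ := exists_rank S.x_injective
  obtain ⟨y, hy⟩ := exists_rank S.y_injective
  obtain ⟨z, hz⟩ := exists_rank S.z_injective
  have hx' : ∀ i j, S.x i < S.x j ↔ (ofEquiv S.next S.next_ne x y z).x i <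
      (ofEquiv S.next S.next_ne x y z).x j := by simpa using hx
  have hy' : ∀ i j, S.y i < S.y j ↔ (ofEquiv S.next S.next_ne x y z).y i <
      (ofEquiv S.next S.next_ne x y z).y j := by simpa using hy
  have hz' : ∀ i j, S.z i < S.z j ↔ (ofEquiv S.next S.next_ne x y z).z i <
      (ofEquiv S.next S.next_ne x y z).z j := by simpa using hz
  exact ⟨MarkedCube.ofEquiv S.next S.next_ne x y z,
    MarkedCube.isCubeDiagram_ofEquiv _ _ _ _ _ (IsGood.congr (S := S) (by rfl) hx' hy' hz' hg),
    (MarkedCube.represents_ofEquiv_iff _ _ _ _ _).2 (hS.congr (by rfl) hx' hy' hz')⟩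

end LatticeLink

/-! ### From a grid diagram to a stack of bends -/

/-- The successor map of the vertices of a link with four vertices for each element of `ι`. -/
def gridNext {ι : Type*} (σ : Equiv.Perm ι) : ι × Fin 4 → ι × Fin 4
  | (i, 0) => (i, 1)
  | (i, 1) => (i, 2)
  | (i, 2) => (i, 3)
  | (i, 3) => (σ i, 0)

theorem gridNext_injective {ι : Type*} (σ : Equiv.Perm ι) : Function.Injective (gridNext σ) := by
  rintro ⟨i, a⟩ ⟨j, b⟩ h
  fin_cases a <;> fin_cases b <;> simp [gridNext] at h ⊢ <;> exact h

/-- Subdivision points of pairwise different edges can be removed. -/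
theorem EdgesRepresent.unsubdivide_all {ι : Type*} [Fintype ι] {a b q : ι → Point3}
    {E : Set (Point3 × Point3)} (ha : Function.Injective a) (hq : Function.Injective q)
    (haq : ∀ i j, a i ≠ q j) (hE : ∀ e ∈ E, ∀ i, e.1 ≠ a i ∧ e.1 ≠ q i)
    (hab : ∀ i, a i ≠ b i) (hmem : ∀ i, q i ∈ openSegment ℝ (a i) (b i)) {K : PolygonalKnot}
    (h : EdgesRepresent (E ∪ {e | ∃ i, e = (a i, q i) ∨ e = (q i, b i)}) K) :
    EdgesRepresent (E ∪ {e | ∃ i, e = (a i, b i)}) K := by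
  classical
  have key : ∀ F : Finset ι, EdgesRepresent (E ∪ {e | ∃ i ∈ F, e = (a i, b i)} ∪
      {e | ∃ i ∉ F, e = (a i, q i) ∨ e = (q i, b i)}) K := by
    intro F
    induction F using Finset.induction_on with
    | empty => simpa using h
    | insert i F hi ih =>
      set E' : Set (Point3 × Point3) := E ∪ {e | ∃ j ∈ F, e = (a j, b j)} ∪
        {e | ∃ j ∉ Insert.insert i F, e = (a j, q j) ∨ e = (q j, b j)} with hE'
      have hfst : ∀ e ∈ E', e.1 ≠ a i ∧ e.1 ≠ q i := by
        rintro e ((he | ⟨j, hj, rfl⟩) | ⟨j, hj, rfl | rfl⟩)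
        · exact hE e he i
        · exact ⟨fun h => hi (ha h ▸ hj), haq j i⟩
        · exact ⟨fun h => hj (ha h ▸ Finset.mem_insert_self i F), haq j i⟩
        · exact ⟨(haq i j).symm, fun h => hj (hq h ▸ Finset.mem_insert_self i F)⟩
      have h1 : EdgesRepresent (Insert.insert (a i, q i) (Insert.insert (q i, b i) E')) K := by
        convert ih using 1
        ext e
        simp only [hE', Set.mem_insert_iff, Set.mem_union, Set.mem_ofPred_eq, Finset.mem_insert,
          not_or]
        constructor
        · rintro (rfl | rfl | (h | h) | ⟨j, hj, h⟩)
          · exact Or.inr ⟨i, hi, Or.inl rfl⟩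
          · exact Or.inr ⟨i, hi, Or.inr rfl⟩
          · exact Or.inl (Or.inl h)
          · exact Or.inl (Or.inr h)
          · exact Or.inr ⟨j, hj.2, h⟩
        · rintro ((h | h) | ⟨j, hj, h⟩)
          · exact Or.inr (Or.inr (Or.inl (Or.inl h)))
          · exact Or.inr (Or.inr (Or.inl (Or.inr h)))
          · by_cases hji : j = i
            · subst hji
              rcases h with h | h
              · exact Or.inl h
              · exact Or.inr (Or.inl h)
            · exact Or.inr (Or.inr (Or.inr ⟨j, ⟨hji, hj⟩, h⟩))
      have h2 := h1.unsubdivide (hab i) (fun h => (hfst _ h).1 rfl) (fun h => (hfst _ h).2 rfl)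
        (hmem i)
      convert h2 using 1
      ext e
      simp only [hE', Set.mem_insert_iff, Set.mem_union, Set.mem_ofPred_eq, Finset.mem_insert,
        not_or]
      constructor
      · rintro ((h | ⟨j, rfl | hj, h⟩) | h)
        · exact Or.inr (Or.inl (Or.inl h))
        · exact Or.inl h
        · exact Or.inr (Or.inl (Or.inr ⟨j, hj, h⟩))
        · exact Or.inr (Or.inr h)
      · rintro (h | (h | ⟨j, hj, h⟩) | h)
        · exact Or.inl (Or.inr ⟨i, Or.inl rfl, h⟩)
        · exact Or.inl (Or.inl h)
        · exact Or.inl (Or.inr ⟨j, Or.inr hj, h⟩)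
        · exact Or.inr h
  simpa using key Finset.univ

section Collapse

variable {ι : Type*} (σ : Equiv.Perm ι) (X P L ε : ι → ℝ)

/-- The deformation of the link of a grid diagram (`t = 0`) to the stack of its bends (`t = 1`).
The segment in column `X i` runs from row `P i` to row `P (σ i)`, its level in the stack is
`L i`, and `ε i` is the sign of `P (σ i) - P i`. -/
noncomputable def collapsePath (t : ℝ) : ι × Fin 4 → Point3
  | (i, 0) => ![X i, P i, t * L i]
  | (i, 1) => ![X i, P i + t * ε i / 2, (1 - t) + t * L i]
  | (i, 2) => ![X i, P (σ i) - t * (1 - t) * ε i / 2, (1 - t) + t * L i]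
  | (i, 3) => ![X i, P (σ i), t * L (σ i)]

variable {σ X P L ε}

/-- The deformation to the stack avoids self-intersections if the vertical segment of a bend `k`
lies above every horizontal segment that it crosses: the latter is at the height `t * L (σ i)`,
and the former at the height `(1 - t) + t * L k`. -/
theorem simpleLoop_collapsePath (hσ : ∀ i, σ i ≠ i) (hX : Function.Injective X)
    (hP : ∀ i j, i ≠ j → P i + 1 ≤ P j ∨ P j + 1 ≤ P i) (hL : Function.Injective L)
    (hε : ∀ i, (ε i = 1 ∧ P i + 1 ≤ P (σ i)) ∨ (ε i = -1 ∧ P (σ i) + 1 ≤ P i))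
    {t : ℝ} (ht : t ∈ Set.Icc (0 : ℝ) 1)
    (hcross : 0 < t → ∀ i k,
      ((P k < P (σ i) ∧ P (σ i) < P (σ k)) ∨ (P (σ k) < P (σ i) ∧ P (σ i) < P k)) →
      ((X i < X k ∧ X k < X (σ i)) ∨ (X (σ i) < X k ∧ X k < X i)) → L (σ i) < L k) :
    SimpleLoop (gridNext σ) (collapsePath σ X P L ε t) := by
  obtain ⟨ht0, ht1⟩ := ht
  have hXσ : ∀ i, X i ≠ X (σ i) := fun i h => hσ i (hX h).symm
  have hLσ : ∀ i, L i ≠ L (σ i) := fun i h => hσ i (hL h).symm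
  have htt : 0 ≤ t * (1 - t) := mul_nonneg ht0 (sub_nonneg.2 ht1)
  have htt' : t + t * (1 - t) ≤ 1 := by nlinarith [sq_nonneg (1 - t)]
  have hεP : ∀ i, ε i * P i + 1 ≤ ε i * P (σ i) ∧ ε i * ε i = 1 := by
    intro i
    rcases hε i with ⟨h, h'⟩ | ⟨h, h'⟩ <;> rw [h] <;> constructor <;> linarith
  have hend : ∀ i, t = 0 ∨ t = 1 → (1 - t) + t * L i ≠ t * L (σ i) := by
    rintro i (rfl | rfl)
    · norm_num
    · simpa using hLσ i
  -- the rows are at distance at least one, so the slanted parts, which extend over half a row, keep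
  -- away from the other rows
  have hsp : ∀ i j y, y = P j → ε i * P i ≤ ε i * y → ε i * y ≤ ε i * P i + 1 / 2 → i = j := by
    intro i j y hy h1 h2
    by_contra hne
    subst hy
    rcases hε i with ⟨h, -⟩ | ⟨h, -⟩ <;> rw [h] at h1 h2 <;> rcases hP i j hne with h' | h' <;>
      linarith
  have hsp' : ∀ i j y, y = P (σ j) → ε i * P (σ i) - 1 / 2 ≤ ε i * y → ε i * y ≤ ε i * P (σ i) →
      i = j := by
    intro i j y hy h1 h2
    by_contra hne
    subst hy
    rcases hε i with ⟨h, -⟩ | ⟨h, -⟩ <;> rw [h] at h1 h2 <;>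
      rcases hP (σ i) (σ j) (fun h => hne (σ.injective h)) with h' | h' <;> linarith
  set f := collapsePath σ X P L ε t with hf
  -- constraints on the points of the four half-open segments at `i`: upwards at the first marking,
  -- along the column, downwards at the second marking, and along the row
  have eA : ∀ i p, p ∈ halfOpen (f (i, 0)) (f (gridNext σ (i, 0))) → p 0 = X i ∧
      ε i * P i ≤ ε i * p 1 ∧ ε i * p 1 ≤ ε i * P i + t / 2 ∧
      (p 2 = (1 - t) + t * L i → ε i * p 1 < ε i * P i + t / 2) := by
    intro i p h
    have h1 : ε i * (f (i, 0)) 1 = ε i * P i := rfl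
    have h2 : ε i * (f (i, 1)) 1 = ε i * P i + t / 2 := by
      change ε i * (P i + t * ε i / 2) = _
      linear_combination t / 2 * (hεP i).2
    have h3 : ε i * P i ≤ ε i * p 1 ∧ ε i * p 1 ≤ ε i * P i + t / 2 := by
      obtain ⟨τ, hτ0, hτ1, rfl⟩ := h
      have h4 : ε i * ((1 - τ) • f (i, 0) + τ • f (gridNext σ (i, 0))) 1 =
          ε i * P i + τ * (t / 2) := by
        change ε i * ((1 - τ) * f (i, 0) 1 + τ * f (i, 1) 1) = _
        linear_combination (1 - τ) * h1 + τ * h2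
      rw [h4]
      constructor <;> nlinarith
    refine ⟨halfOpen_const h 0 rfl, h3.1, h3.2, fun h4 => ?_⟩
    rcases eq_or_lt_of_le ht0 with h5 | h5
    · exact absurd h4 (halfOpen_ne h 2 (by
        change t * L i ≠ (1 - t) + t * L i
        intro h
        linarith))
    · rw [← h2]
      refine halfOpen_mul_lt h 1 ?_
      change ε i * (f (i, 0)) 1 < ε i * (f (i, 1)) 1
      rw [h1, h2]
      linarith
  have eB : ∀ i p, p ∈ halfOpen (f (i, 1)) (f (gridNext σ (i, 1))) → p 0 = X i ∧
      ε i * P i + t / 2 ≤ ε i * p 1 ∧ ε i * p 1 < ε i * P (σ i) - t * (1 - t) / 2 ∧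
      p 2 = (1 - t) + t * L i := by
    intro i p h
    have h1 : ε i * (f (i, 1)) 1 = ε i * P i + t / 2 := by
      change ε i * (P i + t * ε i / 2) = _
      linear_combination t / 2 * (hεP i).2
    have h2 : ε i * (f (i, 2)) 1 = ε i * P (σ i) - t * (1 - t) / 2 := by
      change ε i * (P (σ i) - t * (1 - t) * ε i / 2) = _
      linear_combination -t * (1 - t) / 2 * (hεP i).2
    have h3 : ε i * (f (i, 1)) 1 < ε i * (f (i, 2)) 1 := by
      rw [h1, h2]
      linarith [(hεP i).1]
    refine ⟨halfOpen_const h 0 rfl, ?_, ?_, halfOpen_const h 2 rfl⟩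
    · rw [← h1]
      exact halfOpen_mul_le h 1 h3.le
    · rw [← h2]
      exact halfOpen_mul_lt h 1 h3
  have eC : ∀ i p, p ∈ halfOpen (f (i, 2)) (f (gridNext σ (i, 2))) → p 0 = X i ∧
      ε i * P (σ i) - t * (1 - t) / 2 ≤ ε i * p 1 ∧ ε i * p 1 ≤ ε i * P (σ i) ∧
      (p 1 = P (σ i) → p 2 ≠ t * L (σ i)) := by
    intro i p h
    have h1 : ε i * (f (i, 2)) 1 = ε i * P (σ i) - t * (1 - t) / 2 := by
      change ε i * (P (σ i) - t * (1 - t) * ε i / 2) = _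
      linear_combination -t * (1 - t) / 2 * (hεP i).2
    have h2 : ε i * (f (i, 3)) 1 = ε i * P (σ i) := rfl
    have h3 : ε i * P (σ i) - t * (1 - t) / 2 ≤ ε i * p 1 ∧ ε i * p 1 ≤ ε i * P (σ i) := by
      obtain ⟨τ, hτ0, hτ1, rfl⟩ := h
      have h4 : ε i * ((1 - τ) • f (i, 2) + τ • f (gridNext σ (i, 2))) 1 =
          ε i * P (σ i) - (1 - τ) * (t * (1 - t) / 2) := by
        change ε i * ((1 - τ) * f (i, 2) 1 + τ * f (i, 3) 1) = _
        linear_combination (1 - τ) * h1 + τ * h2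
      rw [h4]
      constructor <;> nlinarith
    refine ⟨halfOpen_const h 0 rfl, h3.1, h3.2, fun h4 => ?_⟩
    by_cases h5 : t = 0 ∨ t = 1
    · exact halfOpen_ne h 2 (hend i h5)
    · rw [not_or] at h5
      have h6 : 0 < t * (1 - t) :=
        mul_pos (lt_of_le_of_ne ht0 (Ne.symm h5.1)) (sub_pos.2 (lt_of_le_of_ne ht1 h5.2))
      have h7 : ε i * p 1 < ε i * (f (i, 3)) 1 := halfOpen_mul_lt h 1 (by
        change ε i * (f (i, 2)) 1 < ε i * (f (i, 3)) 1
        rw [h1, h2]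
        linarith)
      rw [h2, h4] at h7
      exact absurd h7 (lt_irrefl _)
  have eD : ∀ i p, p ∈ halfOpen (f (i, 3)) (f (gridNext σ (i, 3))) → p 1 = P (σ i) ∧
      p 2 = t * L (σ i) ∧ p 0 ≠ X (σ i) ∧ p 0 ∈ Set.uIcc (X i) (X (σ i)) := fun i p h =>
    ⟨halfOpen_const h 1 rfl, halfOpen_const h 2 rfl, halfOpen_ne h 0 (hXσ i),
      halfOpen_mem_uIcc h 0⟩
  have nAB : ∀ i j p, p ∈ halfOpen (f (i, 0)) (f (gridNext σ (i, 0))) →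
      p ∉ halfOpen (f (j, 1)) (f (gridNext σ (j, 1))) := by
    intro i j p hi hj
    have hi' := eA i p hi
    have hj' := eB j p hj
    obtain rfl := hX (hi'.1.symm.trans hj'.1)
    linarith [hi'.2.2.2 hj'.2.2.2, hj'.2.1]
  have nAC : ∀ i j p, p ∈ halfOpen (f (i, 0)) (f (gridNext σ (i, 0))) →
      p ∉ halfOpen (f (j, 2)) (f (gridNext σ (j, 2))) := by
    intro i j p hi hj
    have hi' := eA i p hi
    have hj' := eC j p hj
    obtain rfl := hX (hi'.1.symm.trans hj'.1)
    linarith [hi'.2.2.1, hj'.2.1, (hεP i).1]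
  have nBC : ∀ i j p, p ∈ halfOpen (f (i, 1)) (f (gridNext σ (i, 1))) →
      p ∉ halfOpen (f (j, 2)) (f (gridNext σ (j, 2))) := by
    intro i j p hi hj
    have hi' := eB i p hi
    have hj' := eC j p hj
    obtain rfl := hX (hi'.1.symm.trans hj'.1)
    linarith [hi'.2.2.1, hj'.2.1]
  have nAD : ∀ i j p, p ∈ halfOpen (f (i, 0)) (f (gridNext σ (i, 0))) →
      p ∉ halfOpen (f (j, 3)) (f (gridNext σ (j, 3))) := by
    intro i j p hi hj
    have hi' := eA i p hi
    have hj' := eD j p hj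
    obtain rfl := hsp i (σ j) (p 1) hj'.1 hi'.2.1 (by linarith [hi'.2.2.1])
    exact hj'.2.2.1 hi'.1
  have nBD : ∀ i j p, p ∈ halfOpen (f (i, 1)) (f (gridNext σ (i, 1))) →
      p ∉ halfOpen (f (j, 3)) (f (gridNext σ (j, 3))) := by
    intro k i p hk hi
    obtain ⟨k0, k1, k1', k2⟩ := eB k p hk
    obtain ⟨i1, i2, i0, i0'⟩ := eD i p hi
    rw [i1] at k1 k1'
    rw [k0] at i0 i0'
    have h1 : P (σ i) ≠ P k := by
      intro h
      exact i0 (by rw [hsp k (σ i) _ rfl (by rw [h]) (by rw [h]; linarith)])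
    have h2 : k ≠ i := by
      rintro rfl
      linarith
    have h3 : X k ≠ X i := hX.ne h2
    have h4 : (P k < P (σ i) ∧ P (σ i) < P (σ k)) ∨ (P (σ k) < P (σ i) ∧ P (σ i) < P k) := by
      rcases hε k with ⟨h, -⟩ | ⟨h, -⟩
      · rw [h] at k1 k1'
        exact Or.inl ⟨lt_of_le_of_ne (by linarith) h1.symm, by linarith⟩
      · rw [h] at k1 k1'
        exact Or.inr ⟨by linarith, lt_of_le_of_ne (by linarith) h1⟩
    have h5 : (X i < X k ∧ X k < X (σ i)) ∨ (X (σ i) < X k ∧ X k < X i) := by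
      rcases Set.mem_uIcc.1 i0' with ⟨h, h'⟩ | ⟨h, h'⟩
      · exact Or.inl ⟨lt_of_le_of_ne h h3.symm, lt_of_le_of_ne h' i0⟩
      · exact Or.inr ⟨lt_of_le_of_ne h i0.symm, lt_of_le_of_ne h' h3⟩
    have h7 : (1 - t) + t * L k = t * L (σ i) := k2.symm.trans i2
    rcases eq_or_lt_of_le ht0 with h8 | h8
    · rw [← h8] at h7
      linarith
    · have := mul_lt_mul_of_pos_left (hcross h8 i k h4 h5) h8
      linarith
  have nCD : ∀ i j p, p ∈ halfOpen (f (i, 2)) (f (gridNext σ (i, 2))) →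
      p ∉ halfOpen (f (j, 3)) (f (gridNext σ (j, 3))) := by
    intro i j p hi hj
    have hi' := eC i p hi
    have hj' := eD j p hj
    obtain rfl := hsp' i j (p 1) hj'.1 (by linarith [hi'.2.1]) hi'.2.2.1
    exact hi'.2.2.2 hj'.1 hj'.2.1
  refine SimpleLoop.of_halfOpen ?_ ?_
  · rintro ⟨i, a⟩ h
    have h0 := congrFun h 0
    have h1 := congrFun h 1
    have h2 := congrFun h 2
    fin_cases a
    · change P i = P i + t * ε i / 2 at h1
      change t * L i = (1 - t) + t * L i at h2
      have : t = 1 := by linarith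
      rw [this] at h1
      have := (hεP i).2
      rw [show ε i = 0 by linarith] at this
      norm_num at this
    · change P i + t * ε i / 2 = P (σ i) - t * (1 - t) * ε i / 2 at h1
      have h3 : ε i * (P i + t * ε i / 2) = ε i * (P (σ i) - t * (1 - t) * ε i / 2) := by rw [h1]
      have h4 : ε i * P i + t / 2 = ε i * P (σ i) - t * (1 - t) / 2 := by
        linear_combination h3 - (t / 2 + t * (1 - t) / 2) * (hεP i).2
      linarith [(hεP i).1]
    · change P (σ i) - t * (1 - t) * ε i / 2 = P (σ i) at h1
      change (1 - t) + t * L i = t * L (σ i) at h2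
      have h3 : t * (1 - t) = 0 := by
        have : t * (1 - t) * ε i = 0 := by linarith
        have h4 : t * (1 - t) * (ε i * ε i) = 0 := by rw [← mul_assoc, this, zero_mul]
        rwa [(hεP i).2, mul_one] at h4
      rcases mul_eq_zero.1 h3 with h4 | h4
      · exact hend i (Or.inl h4) h2
      · exact hend i (Or.inr (by linarith)) h2
    · exact hXσ i h0
  · rintro ⟨i, a⟩ ⟨j, b⟩ p ha hb
    fin_cases a <;> fin_cases b
    · rw [hX ((eA i p ha).1.symm.trans (eA j p hb).1)]
    · exact absurd hb (nAB i j p ha)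
    · exact absurd hb (nAC i j p ha)
    · exact absurd hb (nAD i j p ha)
    · exact absurd ha (nAB j i p hb)
    · rw [hX ((eB i p ha).1.symm.trans (eB j p hb).1)]
    · exact absurd hb (nBC i j p ha)
    · exact absurd hb (nBD i j p ha)
    · exact absurd ha (nAC j i p hb)
    · exact absurd ha (nBC j i p hb)
    · rw [hX ((eC i p ha).1.symm.trans (eC j p hb).1)]
    · exact absurd hb (nCD i j p ha)
    · exact absurd ha (nAD j i p hb)
    · exact absurd ha (nBD j i p hb)
    · exact absurd ha (nCD j i p hb)
    · have h1 : P (σ i) = P (σ j) := (eD i p ha).1.symm.trans (eD j p hb).1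
      have h2 : σ i = σ j := by
        by_contra hne
        rcases hP _ _ hne with h | h <;> linarith
      rw [σ.injective h2]

/-- At the end of the deformation, the first two segments at `i` are parts of one segment along
the column; the vertex between them is removed. -/
theorem stairRepresents_of_collapsePath [Fintype ι] (hσ : ∀ i, σ i ≠ i)
    (hX : Function.Injective X) (hP : ∀ i j, i ≠ j → P i + 1 ≤ P j ∨ P j + 1 ≤ P i)
    (hL : Function.Injective L)
    (hε : ∀ i, (ε i = 1 ∧ P i + 1 ≤ P (σ i)) ∨ (ε i = -1 ∧ P (σ i) + 1 ≤ P i))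
    (hcross : ∀ i k, ((P k < P (σ i) ∧ P (σ i) < P (σ k)) ∨ (P (σ k) < P (σ i) ∧ P (σ i) < P k)) →
      ((X i < X k ∧ X k < X (σ i)) ∨ (X (σ i) < X k ∧ X k < X i)) → L (σ i) < L k)
    {K : PolygonalKnot}
    (h : EdgesRepresent (loopEdges (gridNext σ) (collapsePath σ X P L ε 0)) K) :
    StairRepresents σ X (fun i => P (σ i)) L K := by
  have hs : ∀ t ∈ Set.Icc (0 : ℝ) 1, SimpleLoop (gridNext σ) (collapsePath σ X P L ε t) :=
    fun t ht => simpleLoop_collapsePath hσ hX hP hL hε ht fun _ => hcross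
  have h1 := EdgesRepresent.of_path (gridNext_injective σ) (f := collapsePath σ X P L ε) (K := K)
    (by
      refine continuous_pi fun ⟨i, a⟩ => continuous_pi fun d => ?_
      fin_cases a <;> fin_cases d <;> simp [collapsePath] <;> fun_prop) hs h
  set f := collapsePath σ X P L ε 1 with hf
  have hinj : Function.Injective f :=
    ((hs 1 (by simp)).robust (gridNext_injective σ)).injective
  have hne : ∀ i j (a b : Fin 4), a ≠ b → f (i, a) ≠ f (j, b) := fun i j a b hab h =>
    hab (congrArg Prod.snd (hinj h))
  have h2 : EdgesRepresent ({e | ∃ i, e = (f (i, 2), f (i, 3)) ∨ e = (f (i, 3), f (σ i, 0))} ∪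
      {e | ∃ i, e = (f (i, 0), f (i, 1)) ∨ e = (f (i, 1), f (i, 2))}) K := by
    convert h1 using 1
    ext e
    constructor
    · rintro (⟨i, rfl | rfl⟩ | ⟨i, rfl | rfl⟩)
      · exact ⟨(i, 2), rfl⟩
      · exact ⟨(i, 3), rfl⟩
      · exact ⟨(i, 0), rfl⟩
      · exact ⟨(i, 1), rfl⟩
    · rintro ⟨⟨i, a⟩, rfl⟩
      fin_cases a
      · exact Or.inr ⟨i, Or.inl rfl⟩
      · exact Or.inr ⟨i, Or.inr rfl⟩
      · exact Or.inl ⟨i, Or.inl rfl⟩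
      · exact Or.inl ⟨i, Or.inr rfl⟩
  have h3 := h2.unsubdivide_all (fun i j h => by simpa using hinj h)
    (fun i j h => by simpa using hinj h) (fun i j h => by simpa using hinj h)
    (by
      rintro e ⟨i, rfl | rfl⟩ j
      · exact ⟨hne i j 2 0 (by decide), hne i j 2 1 (by decide)⟩
      · exact ⟨hne i j 3 0 (by decide), hne i j 3 1 (by decide)⟩)
    (fun i h => by simpa using hinj h)
    (fun i => by
      have key : ∃ τ : ℝ, 0 < τ ∧ τ < 1 ∧ ε i / 2 = τ * (P (σ i) - P i) := by
        rcases hε i with ⟨h, h'⟩ | ⟨h, h'⟩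
        · have : 0 < P (σ i) - P i := by linarith
          refine ⟨1 / 2 / (P (σ i) - P i), by positivity, ?_, ?_⟩
          · rw [div_lt_one this]
            linarith
          · rw [div_mul_cancel₀ _ this.ne', h]
        · have : 0 < P i - P (σ i) := by linarith
          refine ⟨1 / 2 / (P i - P (σ i)), by positivity, ?_, ?_⟩
          · rw [div_lt_one this]
            linarith
          · rw [h]
            field_simp
            ring
      obtain ⟨τ, hτ0, hτ1, hτ⟩ := key
      refine ⟨1 - τ, τ, by linarith, hτ0, by ring, ?_⟩
      ext d
      fin_cases d
      · simp [hf, collapsePath]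
        ring
      · simp [hf, collapsePath]
        linear_combination -hτ
      · simp [hf, collapsePath]
        ring)
  unfold StairRepresents
  convert h3 using 1
  ext e
  constructor
  · rintro ⟨⟨i, a⟩, rfl⟩
    fin_cases a
    · exact Or.inl ⟨i, Or.inl (by simp [hf, stair, stairNext, collapsePath])⟩
    · exact Or.inl ⟨i, Or.inr (by simp [hf, stair, stairNext, collapsePath])⟩
    · exact Or.inr ⟨σ i, by simp [hf, stair, stairNext, collapsePath]⟩
  · rintro (⟨i, rfl | rfl⟩ | ⟨i, rfl⟩)
    · exact ⟨(i, 0), by simp [hf, stair, stairNext, collapsePath]⟩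
    · exact ⟨(i, 1), by simp [hf, stair, stairNext, collapsePath]⟩
    · exact ⟨(σ.symm i, 2), by simp [hf, stair, stairNext, collapsePath]⟩

end Collapse

/-! ### Grid diagrams and their stacks -/

theorem strictlyBetween_comm {n : ℕ} {k i j : Fin n} :
    StrictlyBetween k i j ↔ StrictlyBetween k j i := or_comm

namespace GridDiagram

variable {n : ℕ}

theorem mark_ne (G : GridDiagram n) (p : Marker) (i : Fin n) : G.mark p i ≠ G.mark p.other i := by
  cases p
  · exact G.ne i
  · exact (G.ne i).symm

/-- The vertices of the link of a grid diagram with markings in the rows `v i` and `w i` of column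
`i`: the link passes upwards through the first marking and downwards through the second one. -/
noncomputable def gridLoop (v w : Fin n → Fin n) : Fin n × Fin 4 → Point3
  | (i, 0) => cell i (v i) 0
  | (i, 1) => cell i (v i) 1
  | (i, 2) => cell i (w i) 1
  | (i, 3) => cell i (w i) 0

/-- The map which assigns to a column `i` the column of the marking of kind `p` in the row of the
other marking of column `i`. -/
def next (G : GridDiagram n) (p : Marker) : Equiv.Perm (Fin n) :=
  (G.mark p.other).trans (G.mark p).symm

theorem mark_next (G : GridDiagram n) (p : Marker) (i : Fin n) :
    G.mark p (G.next p i) = G.mark p.other i := by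
  simp [next]

theorem next_ne (G : GridDiagram n) (p : Marker) (i : Fin n) : G.next p i ≠ i := by
  intro h
  have := G.mark_next p i
  rw [h] at this
  exact G.mark_ne p i this

/-- The bends with vertices of kind `p` are traversed from the horizontal to the vertical segment;
for `p = O` this is the opposite orientation. -/
theorem represents_iff (G : GridDiagram n) (p : Marker) {K : PolygonalKnot} :
    G.Represents K ↔ EdgesRepresent (loopEdges (gridNext (G.next p))
      (gridLoop (G.mark p) (G.mark p.other))) (p.orient K) := by
  cases p
  · have hE : G.edges = loopEdges (gridNext (G.next .X)) (gridLoop G.X G.O) := by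
      ext e
      constructor
      · rintro (((⟨i, rfl⟩ | ⟨i, rfl⟩) | ⟨j, rfl⟩) | ⟨i, rfl⟩)
        · exact ⟨(i, 1), rfl⟩
        · exact ⟨(i, 2), rfl⟩
        · refine ⟨(G.O.symm j, 3), ?_⟩
          simp [gridNext, gridLoop, next, mark, Marker.other]
        · exact ⟨(i, 0), rfl⟩
      · rintro ⟨⟨i, a⟩, rfl⟩
        fin_cases a
        · exact Or.inr ⟨i, rfl⟩
        · exact Or.inl (Or.inl (Or.inl ⟨i, rfl⟩))
        · exact Or.inl (Or.inl (Or.inr ⟨i, rfl⟩))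
        · refine Or.inl (Or.inr ⟨G.O i, ?_⟩)
          simp [gridNext, gridLoop, next, mark, Marker.other]
    unfold Represents
    rw [hE]
    rfl
  · have hE : G.edges = Prod.swap ⁻¹' loopEdges (gridNext (G.next .O)) (gridLoop G.O G.X) := by
      ext ⟨u, v⟩
      constructor
      · rintro (((⟨i, h⟩ | ⟨i, h⟩) | ⟨j, h⟩) | ⟨i, h⟩) <;>
          obtain ⟨rfl, rfl⟩ := Prod.mk.inj h
        · exact ⟨(i, 1), rfl⟩
        · exact ⟨(i, 0), rfl⟩
        · refine ⟨(G.X.symm j, 3), ?_⟩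
          simp [gridNext, gridLoop, next, mark, Marker.other]
        · exact ⟨(i, 2), rfl⟩
      · rintro ⟨⟨i, a⟩, h⟩
        obtain ⟨rfl, rfl⟩ := Prod.mk.inj h
        fin_cases a
        · exact Or.inl (Or.inl (Or.inr ⟨i, rfl⟩))
        · exact Or.inl (Or.inl (Or.inl ⟨i, rfl⟩))
        · exact Or.inr ⟨i, rfl⟩
        · refine Or.inl (Or.inr ⟨G.X i, ?_⟩)
          simp [gridNext, gridLoop, next, mark, Marker.other]
    unfold Represents
    rw [hE]
    constructor
    · intro h
      have := h.reverse
      rwa [← Set.preimage_comp, Prod.swap_swap_eq, Set.preimage_id] at this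
    · intro h
      have := h.reverse
      rwa [Marker.orient, reverse_reverse] at this

theorem crossing_iff (G : GridDiagram n) (p : Marker) (i j : Fin n) : G.Crossing i j ↔
    StrictlyBetween j (G.mark p i) (G.mark p.other i) ∧
      StrictlyBetween i ((G.mark p).symm j) ((G.mark p.other).symm j) := by
  cases p
  · rfl
  · exact and_congr strictlyBetween_comm strictlyBetween_comm

/-- The crossing of the vertical segment of bend `k` over the horizontal segment that ends at the
vertex of bend `next i`. -/
theorem crossing_next_iff (G : GridDiagram n) (p : Marker) (i k : Fin n) :
    G.Crossing k (G.mark p (G.next p i)) ↔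
      StrictlyBetween (G.mark p.other i) (G.mark p k) (G.mark p.other k) ∧
        StrictlyBetween k i (G.next p i) := by
  rw [crossing_iff G p, Equiv.symm_apply_apply, mark_next, Equiv.symm_apply_apply,
    strictlyBetween_comm (k := k)]

/-- The stack as the marked cube of a lattice link, whose points are the free ends of the vertical
segments of the bends. -/
theorem stack_eq (G : GridDiagram n) (p : Marker) (ζ : Equiv.Perm (Fin n)) :
    G.stack p ζ = MarkedCube.ofEquiv (G.next p) (G.next_ne p) (Equiv.refl _) (G.mark p.other) ζ := by
  have h : (G.stack p ζ).mark =
      (MarkedCube.ofEquiv (G.next p) (G.next_ne p) (Equiv.refl _) (G.mark p.other) ζ).mark := by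
    funext l
    ext u
    fin_cases l
    · rfl
    · constructor
      · rintro ⟨c, rfl⟩
        exact ⟨(G.next p).symm c, by simp [next]⟩
      · rintro ⟨i, rfl⟩
        exact ⟨G.next p i, by simp [next]⟩
    · constructor
      · rintro ⟨c, rfl⟩
        exact ⟨(G.next p).symm c, by simp [next]⟩
      · rintro ⟨i, rfl⟩
        exact ⟨G.next p i, by simp [next]⟩
  revert h
  cases G.stack p ζ
  cases MarkedCube.ofEquiv (G.next p) (G.next_ne p) (Equiv.refl _) (G.mark p.other) ζ
  rintro ⟨⟩
  rfl

theorem fin_add_one_le_or {i j : Fin n} (h : i ≠ j) :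
    (i : ℝ) + 1 ≤ j ∨ (j : ℝ) + 1 ≤ i := by
  rcases lt_or_gt_of_ne h with h | h
  · exact Or.inl (by exact_mod_cast h)
  · exact Or.inr (by exact_mod_cast h)

/-- The stack of the bends of a grid diagram represents the same knot. The points of the lattice
link are the `X` markings of the stack. -/
theorem represents_stack (G : GridDiagram n) (p : Marker) {ζ : Equiv.Perm (Fin n)}
    (hζ : G.IsStacking p ζ) {K : PolygonalKnot} (h : G.Represents K) :
    (LatticeLink.ofEquiv (G.next p) (G.next_ne p) (Equiv.refl _) (G.mark p.other) ζ).Represents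
      (p.orient K) := by
  rw [represents_iff G p] at h
  have hlt : ∀ i j : Fin n, (i : ℝ) + 1 / 2 < (j : ℝ) + 1 / 2 ↔ i < j := fun i j => by simp
  have hinj : ∀ e : Equiv.Perm (Fin n), Function.Injective fun i => (e i : ℝ) := fun e i j h =>
    e.injective (Fin.ext (by simpa using h))
  have hinj' : ∀ e : Equiv.Perm (Fin n), Function.Injective fun i => (e i : ℝ) + 1 / 2 :=
    fun e i j h => hinj e (add_right_cancel h)
  have hs := stairRepresents_of_collapsePath (σ := G.next p) (X := fun i => (i : ℝ) + 1 / 2)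
    (P := fun i => (G.mark p i : ℝ) + 1 / 2) (L := fun i => (ζ i : ℝ))
    (ε := fun i => if G.mark p i < G.mark p.other i then 1 else -1) (K := p.orient K)
    (G.next_ne p) (hinj' (Equiv.refl _))
    (fun i j hij => by
      rcases fin_add_one_le_or ((G.mark p).injective.ne hij) with h | h
      · left; linarith
      · right; linarith)
    (hinj ζ)
    (fun i => by
      have hne := G.mark_ne p i
      rw [mark_next]
      split_ifs with h
      · have : (G.mark p i : ℝ) + 1 ≤ G.mark p.other i := by exact_mod_cast h
        exact Or.inl ⟨rfl, by linarith⟩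
      · have h' : G.mark p.other i < G.mark p i := lt_of_le_of_ne (not_lt.1 h) hne.symm
        have : (G.mark p.other i : ℝ) + 1 ≤ G.mark p i := by exact_mod_cast h'
        exact Or.inr ⟨rfl, by linarith⟩)
    (fun i k h1 h2 => by
      simp only [hlt] at h1 h2
      have h3 := hζ k (G.next p i) ((G.crossing_next_iff p i k).2 ⟨by
        simpa only [StrictlyBetween, mark_next] using h1, h2⟩)
      exact_mod_cast h3)
    (by
      convert h using 2
      funext ⟨i, a⟩
      fin_cases a <;> simp [collapsePath, gridLoop, cell, mark_next])
  simp only [mark_next] at hs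
  exact StairRepresents.congr (G.next_ne p) (hinj' (Equiv.refl _)) (hinj' _) (hinj ζ)
    (by simp) (by simp) (by simp) hs

theorem crossingCondition_stack (G : GridDiagram n) (p : Marker) {ζ : Equiv.Perm (Fin n)}
    (hζ : G.IsStacking p ζ) : (G.stack p ζ).CrossingCondition 2 := by
  rw [stack_eq]
  intro u v u' v' hc
  by_contra hlt
  obtain ⟨l, k, hlk, -⟩ := (MarkedCube.cross_two _ _ _ _ _).1 ⟨hc, hlt⟩
  obtain ⟨h1, h2, h3⟩ := (MarkedCube.bad2_iff _ _ _ _ _).1 hlk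
  refine h3 (hζ (G.next p k) (G.next p l) ?_)
  rw [crossing_next_iff, mark_next]
  exact ⟨h1, h2⟩

/-- A stack of the bends of a diagram of `K` with `b` bad crossings gives a cube diagram of `K`. -/
theorem exists_isCubeDiagram_of_stack {n : ℕ} (G : GridDiagram n) (p : Marker)
    {ζ : Equiv.Perm (Fin n)} (hζ : G.IsStacking p ζ) {K : PolygonalKnot} (h : G.Represents K) :
    ∃ (N : ℕ) (C : MarkedCube N), C.IsCubeDiagram ∧ C.Represents K ∧
      N ≤ n + 2 * ((G.stack p ζ).numBad 0 + (G.stack p ζ).numBad 1) := by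
  have hS := G.represents_stack p hζ h
  have h2 := G.crossingCondition_stack p hζ
  rw [G.stack_eq] at h2 ⊢
  rw [MarkedCube.numBad_zero_ofEquiv, MarkedCube.numBad_one_ofEquiv]
  have h3 := MarkedCube.crossingCondition_two_ofEquiv _ _ _ _ _ h2
  obtain ⟨κ, _, T, hT, hgood, hle⟩ := LatticeLink.exists_isGood _ _ hS le_rfl
  rw [LatticeLink.numBad, h3, Set.ncard_empty, add_zero, Fintype.card_fin] at hle
  obtain ⟨T', hT', hgood'⟩ : ∃ T' : LatticeLink κ, T'.Represents K ∧ T'.IsGood := by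
    cases p
    · exact ⟨T, hT, hgood⟩
    · refine ⟨T.reverse, ?_, hgood.reverse⟩
      have := hT.reverse
      rwa [Marker.orient, reverse_reverse] at this
  obtain ⟨C, hC, hC'⟩ := hT'.exists_isCubeDiagram hgood'
  exact ⟨_, C, hC, hC', hle⟩

end GridDiagram

/-! ### Invariance under stabilization -/

section Stabilization

variable {κ : Type*} [DecidableEq κ]

/-- The point between `(X a, P a, 0)` and `(X b, P b, 1)` with the given barycentric coordinates in
each direction. -/
def boxPoint (X P : κ → ℝ) (a b : κ) (α β γ : ℝ) : Point3 :=
  ![X a + α * (X b - X a), P a + β * (P b - P a), γ]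

/-- The deformation of the link of a stabilized grid diagram, for which the columns (in the positions
`X i`) and the rows (in the positions `P i`) of the markings `a` and `σ a` are merged at
the time `t = 1`. The path of five segments between `(X a, P a, 0)` and
`(X (σ a), P (σ a), 1)` is straightened at the same time. -/
noncomputable def mergeLoop (σ : Equiv.Perm κ) (X P : κ → ℝ) (a : κ) (t : ℝ) : κ × Fin 4 → Point3
  | (i, 0) => if i = σ a then
      boxPoint X P a (σ a) (1 - t + t * (4 / 5)) (1 - t + t * (4 / 5)) (t * (4 / 5))
    else ![X i, P i, 0]
  | (i, 1) => if i = a then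
      boxPoint X P a (σ a) (t * (1 / 5)) (t * (1 / 5)) (1 - t + t * (1 / 5))
    else ![X i, P i, 1]
  | (i, 2) => if i = a then
      boxPoint X P a (σ a) (t * (2 / 5)) (1 - t + t * (2 / 5)) (1 - t + t * (2 / 5))
    else ![X i, P (σ i), 1]
  | (i, 3) => if i = a then
      boxPoint X P a (σ a) (t * (3 / 5)) (1 - t + t * (3 / 5)) (t * (3 / 5))
    else ![X i, P (σ i), 0]

/-- Up to the time `t = 1` inclusively, no self-intersection arises when the columns and rows of
the block are merged, since no other column or row lies between them. For `t < 1` the five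
segments of the block are kept apart by their `x`-coordinates, for `t = 1` by their heights. -/
theorem simpleLoop_mergeLoop {σ : Equiv.Perm κ} {X P : κ → ℝ} {a : κ} {t : ℝ} (hσ : ∀ i, σ i ≠ i)
    (hσa : σ (σ a) ≠ a) (ht0 : 0 < t) (ht1 : t ≤ 1) (hXa : t < 1 → X a ≠ X (σ a))
    (hX : ∀ i j, i ≠ a → X i = X j → i = j ∨ j = a)
    (hP : ∀ i j, i ≠ a → i ≠ σ a → P i = P j → i = j)
    (hXbox : ∀ k, k ≠ a → k ≠ σ a → X k ∉ Set.uIcc (X a) (X (σ a)))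
    (hPbox : ∀ k, k ≠ a → k ≠ σ a → P k ∉ Set.uIcc (P a) (P (σ a))) :
    SimpleLoop (gridNext σ) (mergeLoop σ X P a t) := by
  have hX' : ∀ i j, i ≠ a → j ≠ a → X i = X j → i = j := fun i j hi hj h =>
    (hX i j hi h).resolve_right hj
  have hPσ : ∀ k, k ≠ a → P k ≠ P (σ k) := by
    intro k hk h
    by_cases hk' : k = σ a
    · subst hk'
      exact hσ _ (hP _ _ hσa (hσ _) h.symm)
    · exact hσ _ (hP _ _ hk hk' h).symm
  have hXσ : ∀ k, k ≠ a → X k ≠ X (σ k) := by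
    intro k hk h
    rcases hX _ _ hk h with h' | h'
    · exact hσ _ h'.symm
    · have hk' : k ≠ σ a := fun h'' => hσa (by rw [← h'', h'])
      exact hXbox k hk hk' (by rw [h, h']; exact Set.left_mem_uIcc)
  set f := mergeLoop σ X P a t with hf
  -- the points on the path from `(X a, P a, 0)` to `(X (σ a), P (σ a), 1)`
  let α : ℕ → ℝ := fun k => match k with
    | 0 => 0
    | 1 => t * (1 / 5)
    | 2 => t * (2 / 5)
    | 3 => t * (3 / 5)
    | 4 => 1 - t + t * (4 / 5)
    | _ => 1
  let β : ℕ → ℝ := fun k => match k with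
    | 0 => 0
    | 1 => t * (1 / 5)
    | 2 => 1 - t + t * (2 / 5)
    | 3 => 1 - t + t * (3 / 5)
    | 4 => 1 - t + t * (4 / 5)
    | _ => 1
  let γ : ℕ → ℝ := fun k => match k with
    | 0 => 0
    | 1 => 1 - t + t * (1 / 5)
    | 2 => 1 - t + t * (2 / 5)
    | 3 => t * (3 / 5)
    | 4 => t * (4 / 5)
    | _ => 1
  let idx : ℕ → κ × Fin 4 := fun k => match k with
    | 0 => (a, 0)
    | 1 => (a, 1)
    | 2 => (a, 2)
    | 3 => (a, 3)
    | 4 => (σ a, 0)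
    | _ => (σ a, 1)
  have hidx : ∀ k ≤ 5, f (idx k) = boxPoint X P a (σ a) (α k) (β k) (γ k) := by
    intro k hk
    interval_cases k <;> simp [f, mergeLoop, idx, α, β, γ, hσ, (hσ _).symm, boxPoint]
  have hnext : ∀ k < 5, gridNext σ (idx k) = idx (k + 1) := by
    intro k hk
    interval_cases k <;> rfl
  have hα : ∀ k < 5, α k < α (k + 1) := by
    intro k hk
    interval_cases k <;> simp only [α] <;> linarith
  have hαmem : ∀ k ≤ 5, 0 ≤ α k ∧ α k ≤ 1 := by
    intro k hk
    interval_cases k <;> simp only [α] <;> constructor <;> linarith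
  have hβmem : ∀ k ≤ 5, 0 ≤ β k ∧ β k ≤ 1 := by
    intro k hk
    interval_cases k <;> simp only [β] <;> constructor <;> linarith
  have hγpos : ∀ k ≤ 5, 1 ≤ k → 0 < γ k := by
    intro k hk hk'
    interval_cases k <;> simp only [γ] <;> linarith
  have hγ1 : t = 1 → ∀ k ≤ 5, γ k = k / 5 := by
    intro h k hk
    interval_cases k <;> simp only [γ, h] <;> norm_num
  set e : ℝ := X (σ a) - X a with he
  -- constraints on the points of the five segments of the path and of the segments outside the block
  have eE : ∀ k < 5, ∀ p, p ∈ halfOpen (f (idx k)) (f (gridNext σ (idx k))) →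
      p 0 ∈ Set.uIcc (X a) (X (σ a)) ∧ p 1 ∈ Set.uIcc (P a) (P (σ a)) ∧ (p 2 = 0 → p 0 = X a) ∧
      (t < 1 → e * (X a + α k * e) ≤ e * p 0 ∧ e * p 0 < e * (X a + α (k + 1) * e)) ∧
      (t = 1 → (k : ℝ) / 5 ≤ p 2 ∧ p 2 < ((k : ℝ) + 1) / 5) := by
    intro k hk p hp
    rw [hnext k hk, hidx k hk.le, hidx (k + 1) hk] at hp
    refine ⟨?_, ?_, ?_, ?_, ?_⟩
    · obtain ⟨τ, hτ0, hτ1, rfl⟩ := hp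
      rw [← segment_eq_uIcc]
      obtain ⟨h1, h2⟩ := hαmem k hk.le
      obtain ⟨h3, h4⟩ := hαmem (k + 1) hk
      refine ⟨1 - ((1 - τ) * α k + τ * α (k + 1)), (1 - τ) * α k + τ * α (k + 1), by nlinarith,
        by nlinarith, by ring, ?_⟩
      simp [boxPoint]
      ring
    · obtain ⟨τ, hτ0, hτ1, rfl⟩ := hp
      rw [← segment_eq_uIcc]
      obtain ⟨h1, h2⟩ := hβmem k hk.le
      obtain ⟨h3, h4⟩ := hβmem (k + 1) hk
      refine ⟨1 - ((1 - τ) * β k + τ * β (k + 1)), (1 - τ) * β k + τ * β (k + 1), by nlinarith,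
        by nlinarith, by ring, ?_⟩
      simp [boxPoint]
      ring
    · intro h
      rcases Nat.eq_zero_or_pos k with rfl | hk'
      · have := halfOpen_eq_left hp 2 (hγpos 1 (by norm_num) le_rfl).ne h
        rw [this]
        simp [boxPoint, α]
      · obtain ⟨τ, hτ0, hτ1, rfl⟩ := hp
        have h1 := hγpos k hk.le hk'
        have h2 := hγpos (k + 1) hk (by omega)
        have h3 : (1 - τ) * γ k + τ * γ (k + 1) = 0 := h
        have := mul_pos (sub_pos.2 hτ1) h1
        have := mul_nonneg hτ0 h2.le
        linarith
    · intro h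
      have he0 : 0 < e * e := mul_self_pos.2 (sub_ne_zero.2 (hXa h).symm)
      have h1 : e * (X a + α k * e) < e * (X a + α (k + 1) * e) := by
        have := mul_lt_mul_of_pos_right (hα k hk) he0
        linarith
      exact ⟨halfOpen_mul_le hp 0 h1.le, halfOpen_mul_lt hp 0 h1⟩
    · intro h
      have h1 := hγ1 h k hk.le
      have h2 := hγ1 h (k + 1) hk
      push_cast at h2
      have h3 : 1 * γ k < 1 * γ (k + 1) := by
        rw [h1, h2]
        linarith
      have h4 := halfOpen_mul_le hp 2 h3.le
      have h5 := halfOpen_mul_lt hp 2 h3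
      change 1 * γ k ≤ 1 * p 2 at h4
      change 1 * p 2 < 1 * γ (k + 1) at h5
      constructor <;> linarith
  have eA : ∀ k p, k ≠ a → k ≠ σ a → p ∈ halfOpen (f (k, 0)) (f (gridNext σ (k, 0))) →
      p 0 = X k ∧ p 1 = P k ∧ p 2 ≠ 1 := by
    intro k p hk hk' hp
    simp only [f, mergeLoop, gridNext, hk, hk', if_false] at hp
    exact ⟨halfOpen_const hp 0 rfl, halfOpen_const hp 1 rfl, halfOpen_ne hp 2 (by simp)⟩
  have eB : ∀ k p, k ≠ a → p ∈ halfOpen (f (k, 1)) (f (gridNext σ (k, 1))) →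
      p 0 = X k ∧ p 1 ≠ P (σ k) ∧ p 2 = 1 := by
    intro k p hk hp
    simp only [f, mergeLoop, gridNext, hk, if_false] at hp
    exact ⟨halfOpen_const hp 0 rfl, halfOpen_ne hp 1 (hPσ k hk), halfOpen_const hp 2 rfl⟩
  have eC : ∀ k p, k ≠ a → p ∈ halfOpen (f (k, 2)) (f (gridNext σ (k, 2))) →
      p 0 = X k ∧ p 1 = P (σ k) ∧ p 2 ≠ 0 := by
    intro k p hk hp
    simp only [f, mergeLoop, gridNext, hk, if_false] at hp
    exact ⟨halfOpen_const hp 0 rfl, halfOpen_const hp 1 rfl, halfOpen_ne hp 2 (by simp)⟩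
  have eD : ∀ k p, k ≠ a → p ∈ halfOpen (f (k, 3)) (f (gridNext σ (k, 3))) →
      p 0 ≠ X (σ k) ∧ p 1 = P (σ k) ∧ p 2 = 0 := by
    intro k p hk hp
    have hk' : σ k ≠ σ a := fun h => hk (σ.injective h)
    simp only [f, mergeLoop, gridNext, hk, hk', if_false] at hp
    exact ⟨halfOpen_ne hp 0 (hXσ k hk), halfOpen_const hp 1 rfl, halfOpen_const hp 2 rfl⟩
  have cases : ∀ b : κ × Fin 4, (∃ k < 5, b = idx k) ∨ (∃ k, k ≠ a ∧ k ≠ σ a ∧ b = (k, 0)) ∨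
      (∃ k, k ≠ a ∧ b = (k, 1)) ∨ (∃ k, k ≠ a ∧ b = (k, 2)) ∨ (∃ k, k ≠ a ∧ b = (k, 3)) := by
    rintro ⟨k, b⟩
    by_cases hk : k = a
    · subst hk
      left
      fin_cases b
      · exact ⟨0, by norm_num, rfl⟩
      · exact ⟨1, by norm_num, rfl⟩
      · exact ⟨2, by norm_num, rfl⟩
      · exact ⟨3, by norm_num, rfl⟩
    · fin_cases b
      · by_cases hk' : k = σ a
        · subst hk'
          exact Or.inl ⟨4, by norm_num, rfl⟩
        · exact Or.inr (Or.inl ⟨k, hk, hk', rfl⟩)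
      · exact Or.inr (Or.inr (Or.inl ⟨k, hk, rfl⟩))
      · exact Or.inr (Or.inr (Or.inr (Or.inl ⟨k, hk, rfl⟩)))
      · exact Or.inr (Or.inr (Or.inr (Or.inr ⟨k, hk, rfl⟩)))
  -- segments of different kinds are disjoint
  have nEE : ∀ k l, k < l → l < 5 → ∀ p, p ∈ halfOpen (f (idx k)) (f (gridNext σ (idx k))) →
      p ∉ halfOpen (f (idx l)) (f (gridNext σ (idx l))) := by
    intro k l hkl hl p hk hl'
    obtain ⟨-, -, -, h1, h1'⟩ := eE k (hkl.trans hl) p hk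
    obtain ⟨-, -, -, h2, h2'⟩ := eE l hl p hl'
    rcases lt_or_eq_of_le ht1 with h | h
    · have hmono : α (k + 1) ≤ α l := by
        have : ∀ m, k + 1 + m < 5 → α (k + 1) ≤ α (k + 1 + m) := by
          intro m
          induction m with
          | zero => intro _; exact le_rfl
          | succ m ih => intro hm; exact (ih (by omega)).trans (hα _ (by omega)).le
        have := this (l - (k + 1)) (by omega)
        rwa [show k + 1 + (l - (k + 1)) = l by omega] at this
      have h3 := mul_le_mul_of_nonneg_right hmono (mul_self_nonneg e)
      have := (h1 h).2
      have := (h2 h).1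
      linarith
    · have h3 := (h1' h).2
      have h4 := (h2' h).1
      have h5 : (k : ℝ) + 1 ≤ l := by exact_mod_cast hkl
      linarith
  have nEA : ∀ k < 5, ∀ i, i ≠ a → i ≠ σ a → ∀ p,
      p ∈ halfOpen (f (idx k)) (f (gridNext σ (idx k))) →
      p ∉ halfOpen (f (i, 0)) (f (gridNext σ (i, 0))) := by
    intro k hk i hi hi' p h1 h2
    have := (eE k hk p h1).1
    rw [(eA i p hi hi' h2).1] at this
    exact hXbox i hi hi' this
  have nEB : ∀ k < 5, ∀ i, i ≠ a → ∀ p,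
      p ∈ halfOpen (f (idx k)) (f (gridNext σ (idx k))) →
      p ∉ halfOpen (f (i, 1)) (f (gridNext σ (i, 1))) := by
    intro k hk i hi p h1 h2
    obtain ⟨h3, -, -, h4, h5⟩ := eE k hk p h1
    obtain ⟨h6, -, h7⟩ := eB i p hi h2
    by_cases hi' : i = σ a
    · subst hi'
      rcases lt_or_eq_of_le ht1 with h | h
      · have h8 := (h4 h).2
        have h9 := mul_le_mul_of_nonneg_right (hαmem (k + 1) hk).2 (mul_self_nonneg e)
        rw [h6] at h8
        have : e * X (σ a) = e * X a + e * e := by rw [he]; ring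
        linarith
      · have h8 := (h5 h).2
        have h9 : (k : ℝ) + 1 ≤ 5 := by exact_mod_cast hk
        linarith
    · rw [h6] at h3
      exact hXbox i hi hi' h3
  have nEC : ∀ k < 5, ∀ i, i ≠ a → ∀ p,
      p ∈ halfOpen (f (idx k)) (f (gridNext σ (idx k))) →
      p ∉ halfOpen (f (i, 2)) (f (gridNext σ (i, 2))) := by
    intro k hk i hi p h1 h2
    obtain ⟨h3, h4, -⟩ := eE k hk p h1
    obtain ⟨h6, h7, -⟩ := eC i p hi h2
    by_cases hi' : i = σ a
    · subst hi'
      rw [h7] at h4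
      exact hPbox _ hσa (hσ _) h4
    · rw [h6] at h3
      exact hXbox i hi hi' h3
  have nED : ∀ k < 5, ∀ i, i ≠ a → ∀ p,
      p ∈ halfOpen (f (idx k)) (f (gridNext σ (idx k))) →
      p ∉ halfOpen (f (i, 3)) (f (gridNext σ (i, 3))) := by
    intro k hk i hi p h1 h2
    obtain ⟨-, h4, h5, -⟩ := eE k hk p h1
    obtain ⟨h6, h7, h8⟩ := eD i p hi h2
    by_cases hi' : σ i = a
    · exact h6 (by rw [hi', h5 h8])
    · rw [h7] at h4
      exact hPbox _ hi' (fun h => hi (σ.injective h)) h4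
  have nAB : ∀ i j, i ≠ a → i ≠ σ a → j ≠ a → ∀ p,
      p ∈ halfOpen (f (i, 0)) (f (gridNext σ (i, 0))) →
      p ∉ halfOpen (f (j, 1)) (f (gridNext σ (j, 1))) := by
    intro i j hi hi' hj p h1 h2
    exact (eA i p hi hi' h1).2.2 (eB j p hj h2).2.2
  have nAC : ∀ i j, i ≠ a → i ≠ σ a → j ≠ a → ∀ p,
      p ∈ halfOpen (f (i, 0)) (f (gridNext σ (i, 0))) →
      p ∉ halfOpen (f (j, 2)) (f (gridNext σ (j, 2))) := by
    intro i j hi hi' hj p h1 h2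
    have h3 := eA i p hi hi' h1
    have h4 := eC j p hj h2
    obtain rfl := hX' i j hi hj (h3.1.symm.trans h4.1)
    exact hPσ i hi (h3.2.1.symm.trans h4.2.1)
  have nAD : ∀ i j, i ≠ a → i ≠ σ a → j ≠ a → ∀ p,
      p ∈ halfOpen (f (i, 0)) (f (gridNext σ (i, 0))) →
      p ∉ halfOpen (f (j, 3)) (f (gridNext σ (j, 3))) := by
    intro i j hi hi' hj p h1 h2
    have h3 := eA i p hi hi' h1
    have h4 := eD j p hj h2
    obtain rfl := hP i (σ j) hi hi' (h3.2.1.symm.trans h4.2.1)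
    exact h4.1 h3.1
  have nBC : ∀ i j, i ≠ a → j ≠ a → ∀ p,
      p ∈ halfOpen (f (i, 1)) (f (gridNext σ (i, 1))) →
      p ∉ halfOpen (f (j, 2)) (f (gridNext σ (j, 2))) := by
    intro i j hi hj p h1 h2
    have h3 := eB i p hi h1
    have h4 := eC j p hj h2
    obtain rfl := hX' i j hi hj (h3.1.symm.trans h4.1)
    exact h3.2.1 h4.2.1
  have nBD : ∀ i j, i ≠ a → j ≠ a → ∀ p,
      p ∈ halfOpen (f (i, 1)) (f (gridNext σ (i, 1))) →
      p ∉ halfOpen (f (j, 3)) (f (gridNext σ (j, 3))) := by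
    intro i j hi hj p h1 h2
    have h3 := (eB i p hi h1).2.2
    rw [(eD j p hj h2).2.2] at h3
    exact zero_ne_one h3
  have nCD : ∀ i j, i ≠ a → j ≠ a → ∀ p,
      p ∈ halfOpen (f (i, 2)) (f (gridNext σ (i, 2))) →
      p ∉ halfOpen (f (j, 3)) (f (gridNext σ (j, 3))) := by
    intro i j hi hj p h1 h2
    exact (eC i p hi h1).2.2 (eD j p hj h2).2.2
  refine SimpleLoop.of_halfOpen ?_ ?_
  · intro b h
    rcases cases b with ⟨k, hk, rfl⟩ | ⟨k, hk, hk', rfl⟩ | ⟨k, hk, rfl⟩ | ⟨k, hk, rfl⟩ |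
      ⟨k, hk, rfl⟩
    · have hmem : f (idx k) ∈ halfOpen (f (idx k)) (f (gridNext σ (idx k))) :=
        ⟨0, le_rfl, zero_lt_one, by simp⟩
      obtain ⟨-, -, -, h1, h2⟩ := eE k hk _ hmem
      rw [hnext k hk] at h
      rcases lt_or_eq_of_le ht1 with h3 | h3
      · have h4 := (h1 h3).2
        rw [h, hidx (k + 1) hk] at h4
        exact lt_irrefl _ h4
      · have h4 := (h2 h3).2
        rw [h, hidx (k + 1) hk] at h4
        change γ (k + 1) < _ at h4
        rw [hγ1 h3 (k + 1) hk] at h4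
        push_cast at h4
        exact lt_irrefl _ h4
    · have h2 := congrFun h 2
      simp [f, mergeLoop, gridNext, hk, hk'] at h2
    · have h1 := congrFun h 1
      simp only [f, mergeLoop, gridNext, hk, if_false] at h1
      exact hPσ k hk h1
    · have h2 := congrFun h 2
      simp [f, mergeLoop, gridNext, hk] at h2
    · have hk' : σ k ≠ σ a := fun h => hk (σ.injective h)
      have h0 := congrFun h 0
      simp only [f, mergeLoop, gridNext, hk, hk', if_false] at h0
      exact hXσ k hk h0
  · intro b c p hb hc
    rcases cases b with ⟨k, hk, rfl⟩ | ⟨k, hk, hk', rfl⟩ | ⟨k, hk, rfl⟩ | ⟨k, hk, rfl⟩ |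
        ⟨k, hk, rfl⟩ <;>
      rcases cases c with ⟨l, hl, rfl⟩ | ⟨l, hl, hl', rfl⟩ | ⟨l, hl, rfl⟩ | ⟨l, hl, rfl⟩ |
        ⟨l, hl, rfl⟩
    · rcases lt_trichotomy k l with h | rfl | h
      · exact absurd hc (nEE k l h hl p hb)
      · rfl
      · exact absurd hb (nEE l k h hk p hc)
    · exact absurd hc (nEA k hk l hl hl' p hb)
    · exact absurd hc (nEB k hk l hl p hb)
    · exact absurd hc (nEC k hk l hl p hb)
    · exact absurd hc (nED k hk l hl p hb)
    · exact absurd hb (nEA l hl k hk hk' p hc)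
    · rw [hX' k l hk hl ((eA k p hk hk' hb).1.symm.trans (eA l p hl hl' hc).1)]
    · exact absurd hc (nAB k l hk hk' hl p hb)
    · exact absurd hc (nAC k l hk hk' hl p hb)
    · exact absurd hc (nAD k l hk hk' hl p hb)
    · exact absurd hb (nEB l hl k hk p hc)
    · exact absurd hb (nAB l k hl hl' hk p hc)
    · rw [hX' k l hk hl ((eB k p hk hb).1.symm.trans (eB l p hl hc).1)]
    · exact absurd hc (nBC k l hk hl p hb)
    · exact absurd hc (nBD k l hk hl p hb)
    · exact absurd hb (nEC l hl k hk p hc)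
    · exact absurd hb (nAC l k hl hl' hk p hc)
    · exact absurd hb (nBC l k hl hk p hc)
    · rw [hX' k l hk hl ((eC k p hk hb).1.symm.trans (eC l p hl hc).1)]
    · exact absurd hc (nCD k l hk hl p hb)
    · exact absurd hb (nED l hl k hk p hc)
    · exact absurd hb (nAD l k hl hl' hk p hc)
    · exact absurd hb (nBD l k hl hk p hc)
    · exact absurd hb (nCD l k hl hk p hc)
    · have h1 := (eD k p hk hb).2.1.symm.trans (eD l p hl hc).2.1
      by_cases hk' : σ k = a
      · by_cases hl' : σ l = a
        · rw [σ.injective (hk'.trans hl'.symm)]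
        · have := hP (σ l) (σ k) hl' (fun h => hl (σ.injective h)) h1.symm
          rw [σ.injective this]
      · rw [σ.injective (hP (σ k) (σ l) hk' (fun h => hk (σ.injective h)) h1)]

end Stabilization

section Merge

variable {n : ℕ}

theorem coe_predAbove (c : Fin n) (i : Fin (n + 1)) :
    (c.predAbove i : ℕ) = if (c : ℕ) < i then (i : ℕ) - 1 else i := by
  unfold Fin.predAbove
  split_ifs with h h' h'
  · simp
  · exact absurd h h'
  · exact absurd h' h
  · simp

theorem predAbove_eq_of_ne {c : Fin n} {i j : Fin (n + 1)} (h : c.predAbove i = c.predAbove j)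
    (hij : i ≠ j) : c.predAbove i = c := by
  rw [Fin.ext_iff, coe_predAbove, coe_predAbove] at h
  rw [Fin.ext_iff, coe_predAbove]
  have : (i : ℕ) ≠ j := fun h => hij (Fin.ext h)
  split_ifs at h ⊢ <;> omega

theorem eq_or_eq_of_predAbove {c : Fin n} {a b i : Fin (n + 1)} (ha : c.predAbove a = c)
    (hb : c.predAbove b = c) (hab : a ≠ b) (hi : c.predAbove i = c) : i = a ∨ i = b := by
  rw [Fin.ext_iff, coe_predAbove] at ha hb hi
  have : (a : ℕ) ≠ b := fun h => hab (Fin.ext h)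
  rw [Fin.ext_iff, Fin.ext_iff]
  split_ifs at ha hb hi <;> omega

theorem lt_of_predAbove_lt {c : Fin n} {i j : Fin (n + 1)} (h : c.predAbove i < c.predAbove j) :
    i < j := by
  by_contra hij
  exact absurd (Fin.predAbove_right_monotone c (not_lt.1 hij)) (not_le.2 h)

/-- The position at the time `t` of column (or row) `i` while the columns (or rows) `c` and `c + 1`
are merged. -/
noncomputable def mergePos (c : Fin n) (t : ℝ) (i : Fin (n + 1)) : ℝ :=
  (1 - t) * i + t * (c.predAbove i : ℕ) + 1 / 2

theorem mergePos_lt {c : Fin n} {t : ℝ} (ht : t ∈ Set.Icc (0 : ℝ) 1) {i j : Fin (n + 1)}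
    (h : c.predAbove i < c.predAbove j) : mergePos c t i < mergePos c t j := by
  have h1 : ((i : ℕ) : ℝ) < (j : ℕ) := by exact_mod_cast lt_of_predAbove_lt h
  have h2 : ((c.predAbove i : ℕ) : ℝ) < (c.predAbove j : ℕ) := by exact_mod_cast h
  have := lineMap_lt_lineMap ht h1 h2
  unfold mergePos
  linarith

theorem mergePos_eq {c : Fin n} {t : ℝ} (ht : t ∈ Set.Icc (0 : ℝ) 1) {i j : Fin (n + 1)}
    (h : mergePos c t i = mergePos c t j) : c.predAbove i = c.predAbove j := by
  by_contra hne
  rcases lt_or_gt_of_ne hne with h' | h'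
  · exact (mergePos_lt ht h').ne h
  · exact (mergePos_lt ht h').ne h.symm

theorem mergePos_notMem_uIcc {c : Fin n} {t : ℝ} (ht : t ∈ Set.Icc (0 : ℝ) 1)
    {a b i : Fin (n + 1)} (ha : c.predAbove a = c) (hb : c.predAbove b = c)
    (hi : c.predAbove i ≠ c) : mergePos c t i ∉ Set.uIcc (mergePos c t a) (mergePos c t b) := by
  rw [Set.mem_uIcc]
  rcases lt_or_gt_of_ne hi with h | h
  · have h1 := mergePos_lt ht (h.trans_eq ha.symm)
    have h2 := mergePos_lt ht (h.trans_eq hb.symm)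
    rintro (⟨h3, -⟩ | ⟨h3, -⟩) <;> linarith
  · have h1 := mergePos_lt ht (ha.trans_lt h)
    have h2 := mergePos_lt ht (hb.trans_lt h)
    rintro (⟨-, h3⟩ | ⟨-, h3⟩) <;> linarith

end Merge

namespace GridDiagram

variable {n : ℕ}

/-- The columns of the block of a stabilization: `a` contains the marking of the other kind. -/
theorem IsStabilization.exists_column {G : GridDiagram n} {p : Marker} {c : Fin n}
    {G' : GridDiagram (n + 1)} (h : G.IsStabilization p c G') :
    ∃ a, c.predAbove a = c ∧ c.predAbove (G'.next p a) = c ∧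
      (∀ i, c.predAbove i = c → i = a ∨ i = G'.next p a) ∧
      G'.next p (G'.next p a) ≠ a ∧
      (∀ i, i ≠ a → c.predAbove (G'.next p i) = G.next p (c.predAbove i)) ∧
      (∀ i, i ≠ a →
        (G.mark p c).predAbove (G'.mark p.other i) = G.mark p.other (c.predAbove i)) := by
  obtain ⟨hv, a, ha, hwa, hw⟩ := h
  have ha' : c.predAbove (G'.next p a) = c := by
    apply (G.mark p).injective
    rw [← hv, mark_next, hwa]
  have hnext : ∀ i, i ≠ a → c.predAbove (G'.next p i) = G.next p (c.predAbove i) := by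
    intro i hi
    apply (G.mark p).injective
    rw [← hv, mark_next, mark_next, hw i hi]
  refine ⟨a, ha, ha', fun i => eq_or_eq_of_predAbove ha ha' (G'.next_ne p a).symm, ?_, hnext, hw⟩
  intro h
  have := hnext _ (G'.next_ne p a)
  rw [h, ha, ha'] at this
  exact G.next_ne p c this.symm

theorem simpleLoop_gridLoop (G : GridDiagram n) (p : Marker) :
    SimpleLoop (gridNext (G.next p)) (gridLoop (G.mark p) (G.mark p.other)) := by
  have hinj : ∀ e : Equiv.Perm (Fin n), Function.Injective fun i => (e i : ℝ) + 1 / 2 :=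
    fun e i j h => e.injective (Fin.ext (by simpa using h))
  have h := simpleLoop_collapsePath (σ := G.next p) (X := fun i => (i : ℝ) + 1 / 2)
    (P := fun i => (G.mark p i : ℝ) + 1 / 2) (L := fun i => (i : ℝ) + 1 / 2)
    (ε := fun i => if G.mark p i < G.mark p.other i then 1 else -1)
    (G.next_ne p) (hinj (Equiv.refl _))
    (fun i j hij => by
      rcases fin_add_one_le_or ((G.mark p).injective.ne hij) with h | h
      · left; linarith
      · right; linarith)
    (hinj (Equiv.refl _))
    (fun i => by
      have hne := G.mark_ne p i
      rw [mark_next]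
      split_ifs with h
      · have : (G.mark p i : ℝ) + 1 ≤ G.mark p.other i := by exact_mod_cast h
        exact Or.inl ⟨rfl, by linarith⟩
      · have h' : G.mark p.other i < G.mark p i := lt_of_le_of_ne (not_lt.1 h) hne.symm
        have : (G.mark p.other i : ℝ) + 1 ≤ G.mark p i := by exact_mod_cast h'
        exact Or.inr ⟨rfl, by linarith⟩)
    (t := 0) (by simp) (fun h => absurd h (lt_irrefl _))
  convert h using 1
  funext ⟨i, a⟩
  fin_cases a <;> simp [collapsePath, gridLoop, cell, mark_next]

/-- Stabilization does not change the knot: the deformation that merges the doubled columns and rows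
ends in the old link, with four additional vertices on the vertical segment at the marking. -/
theorem IsStabilization.represents {G : GridDiagram n} {p : Marker} {c : Fin n}
    {G' : GridDiagram (n + 1)} (h : G.IsStabilization p c G') {K : PolygonalKnot}
    (hG : G.Represents K) : G'.Represents K := by
  have hv := h.1
  obtain ⟨a, ha, ha', hfib, hσσ, hnext, hw⟩ := h.exists_column
  rw [represents_iff G p] at hG
  rw [represents_iff G' p]
  set v := G.mark p with hv_def
  set w := G.mark p.other with hw_def
  set v' := G'.mark p with hv'_def
  set σ := G.next p with hσ_def
  set σ' := G'.next p with hσ'_def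
  let X : ℝ → Fin (n + 1) → ℝ := fun t i => mergePos c t i
  let P : ℝ → Fin (n + 1) → ℝ := fun t i => mergePos (v c) t (v' i)
  have hpar : ∀ i j, i ≠ j → c.predAbove i = c.predAbove j → c.predAbove i = c := fun i j hij h =>
    predAbove_eq_of_ne h hij
  have hsimple : ∀ t, 0 < t → t ≤ 1 → SimpleLoop (gridNext σ') (mergeLoop σ' (X t) (P t) a t) := by
    intro t ht0 ht1
    have ht : t ∈ Set.Icc (0 : ℝ) 1 := ⟨ht0.le, ht1⟩
    refine simpleLoop_mergeLoop (G'.next_ne p) hσσ ht0 ht1 ?_ ?_ ?_ ?_ ?_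
    · intro ht h
      have h' : (1 - t) * ((a : ℕ) : ℝ) = (1 - t) * ((σ' a : ℕ) : ℝ) := by
        simp only [X, mergePos, ha, ha'] at h
        linarith
      have h2 := mul_left_cancel₀ (sub_pos.2 ht).ne' h'
      exact G'.next_ne p a (Fin.ext (by exact_mod_cast h2.symm))
    · intro i j hi hij
      have h1 := mergePos_eq ht hij
      by_contra hne
      rw [not_or] at hne
      have h2 := hpar i j hne.1 h1
      rcases hfib i h2 with h3 | h3
      · exact hi h3
      · rcases hfib j (h1.symm.trans h2) with h4 | h4
        · exact hne.2 h4
        · exact hne.1 (h3.trans h4.symm)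
    · intro i j hi hi' hij
      have h1 := mergePos_eq ht hij
      rw [hv, hv] at h1
      by_contra hne
      rcases hfib i (hpar i j hne (v.injective h1)) with h3 | h3
      · exact hi h3
      · exact hi' h3
    · intro k hk hk'
      exact mergePos_notMem_uIcc ht ha ha' fun h => (hfib k h).elim hk hk'
    · intro k hk hk'
      refine mergePos_notMem_uIcc ht (by rw [hv, ha]) (by rw [hv, ha']) fun h => ?_
      rw [hv] at h
      exact (hfib k (v.injective h)).elim hk hk'
  have hzero : mergeLoop σ' (X 0) (P 0) a 0 = gridLoop v' (G'.mark p.other) := by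
    have hX0 : ∀ i, X 0 i = (i : ℝ) + 1 / 2 := fun i => by simp [X, mergePos]
    have hP0 : ∀ i, P 0 i = (v' i : ℝ) + 1 / 2 := fun i => by simp [P, mergePos]
    funext ⟨i, b⟩
    fin_cases b
    · simp only [mergeLoop, gridLoop]
      split_ifs with h
      · subst h
        simp [boxPoint, cell, hX0, hP0]
        constructor <;> ring
      · simp [cell, hX0, hP0]
    all_goals
      simp only [mergeLoop, gridLoop]
      split_ifs with h
      · subst h
        simp [boxPoint, cell, hX0, hP0, hσ'_def, hv'_def, mark_next]
        try ring
      · simp [cell, hX0, hP0, hσ'_def, hv'_def, mark_next]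
  have hX1 : ∀ i, X 1 i = (c.predAbove i : ℝ) + 1 / 2 := fun i => by simp [X, mergePos]
  have hP1 : ∀ i, P 1 i = (v (c.predAbove i) : ℝ) + 1 / 2 := fun i => by
    simp [P, mergePos, hv]
  set f := mergeLoop σ' (X 1) (P 1) a 1 with hf
  set g := gridLoop v w with hg
  -- the additional vertices on the vertical segment at the marking
  let q : ℝ → Point3 := fun γ => ![(c : ℝ) + 1 / 2, (v c : ℝ) + 1 / 2, γ]
  have hbox : ∀ α β γ, boxPoint (X 1) (P 1) a (σ' a) α β γ = q γ := by
    intro α β γ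
    simp [boxPoint, q, hX1, hP1, ha, ha']
  have hfg : ∀ i b, i ≠ a → (b = 0 → i ≠ σ' a) → f (i, b) = g (c.predAbove i, b) := by
    intro i b hi hib
    fin_cases b
    · simp [hf, hg, mergeLoop, gridLoop, cell, hib rfl, hX1, hP1]
    · simp [hf, hg, mergeLoop, gridLoop, cell, hi, hX1, hP1]
    · simp [hf, hg, mergeLoop, gridLoop, cell, hi, hX1, hP1, hnext i hi, hσ_def, hv_def, hw_def,
        mark_next]
    · simp [hf, hg, mergeLoop, gridLoop, cell, hi, hX1, hP1, hnext i hi, hσ_def, hv_def, hw_def,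
        mark_next]
  have hfg' : ∀ i b, i ≠ a → f (gridNext σ' (i, b)) = g (gridNext σ (c.predAbove i, b)) := by
    intro i b hi
    fin_cases b
    · exact hfg i 1 hi (by simp)
    · exact hfg i 2 hi (by simp)
    · exact hfg i 3 hi (by simp)
    · have h1 : σ' i ≠ σ' a := fun h => hi (σ'.injective h)
      change f (σ' i, 0) = g (σ (c.predAbove i), 0)
      rw [← hnext i hi]
      simp [hf, hg, mergeLoop, gridLoop, cell, h1, hX1, hP1]
  have hfa0 : f (a, 0) = q 0 := by
    simp [hf, mergeLoop, q, hX1, hP1, ha, (G'.next_ne p a).symm, hσ'_def]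
  have hfa1 : f (a, 1) = q (1 / 5) := by simp [hf, mergeLoop, hbox]
  have hfa2 : f (a, 2) = q (2 / 5) := by simp [hf, mergeLoop, hbox]
  have hfa3 : f (a, 3) = q (3 / 5) := by simp [hf, mergeLoop, hbox]
  have hfa4 : f (σ' a, 0) = q (4 / 5) := by simp [hf, mergeLoop, hbox]
  have hfa5 : f (σ' a, 1) = q 1 := by
    rw [hfg (σ' a) 1 (G'.next_ne p a) (by simp), ha']
    rfl
  have hone : EdgesRepresent (loopEdges (gridNext σ') f) (p.orient K) := by
    set E₀ : Set (Point3 × Point3) := {e | ∃ b, b ≠ ((c, 0) : Fin n × Fin 4) ∧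
      e = (g b, g (gridNext σ b))} with hE₀
    have hginj : Function.Injective g :=
      ((G.simpleLoop_gridLoop p).robust (gridNext_injective σ)).injective
    have hE₀_fst : ∀ u, (q 0, u) ∉ E₀ := by
      rintro u ⟨b, hb, h⟩
      exact hb (hginj (congrArg Prod.fst h).symm)
    have hq : ∀ (γ : ℝ) (u : Point3) (E : Set (Point3 × Point3)), γ ≠ 0 → (q 0, u) ∉ E →
        ∀ u', (q 0, u) ∉ Insert.insert (q γ, u') E := by
      rintro γ u E hγ hE u' (h | h)
      · exact hγ (congrFun (congrArg Prod.fst h) 2).symm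
      · exact hE h
    have h0 : EdgesRepresent (Insert.insert (q 0, q 1) E₀) (p.orient K) := by
      convert hG using 1
      ext e
      constructor
      · rintro (rfl | ⟨b, -, rfl⟩)
        · exact ⟨(c, 0), rfl⟩
        · exact ⟨b, rfl⟩
      · rintro ⟨b, rfl⟩
        by_cases hb : b = (c, 0)
        · subst hb
          exact Or.inl rfl
        · exact Or.inr ⟨b, hb, rfl⟩
    have h4 := h0.subdivide (hE₀_fst _) (q := q (4 / 5))
      (mem_openSegment_of_third (by norm_num) _ _)
    have h3 := h4.subdivide (hq _ _ _ (by norm_num) (hE₀_fst _) _) (q := q (3 / 5))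
      (mem_openSegment_of_third (by norm_num) _ _)
    have h2 := h3.subdivide (hq _ _ _ (by norm_num) (hq _ _ _ (by norm_num) (hE₀_fst _) _) _)
      (q := q (2 / 5)) (mem_openSegment_of_third (by norm_num) _ _)
    have h1 := h2.subdivide (hq _ _ _ (by norm_num) (hq _ _ _ (by norm_num)
      (hq _ _ _ (by norm_num) (hE₀_fst _) _) _) _)
      (q := q (1 / 5)) (mem_openSegment_of_third (by norm_num) _ _)
    convert h1 using 1
    ext e
    constructor
    · rintro ⟨⟨i, b⟩, rfl⟩
      by_cases hi : i = a
      · subst hi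
        fin_cases b
        · left
          exact Prod.ext hfa0 hfa1
        · right; left
          exact Prod.ext hfa1 hfa2
        · right; right; left
          exact Prod.ext hfa2 hfa3
        · right; right; right; left
          exact Prod.ext hfa3 hfa4
      · by_cases hib : b = 0 ∧ i = σ' a
        · obtain ⟨rfl, rfl⟩ := hib
          right; right; right; right; left
          exact Prod.ext hfa4 hfa5
        · right; right; right; right; right
          refine ⟨(c.predAbove i, b), fun h => ?_, ?_⟩
          · simp only [Prod.mk.injEq] at h
            rcases hfib i h.1 with h' | h'
            · exact hi h'
            · exact hib ⟨h.2, h'⟩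
          · rw [hfg i b hi fun hb hi' => hib ⟨hb, hi'⟩, hfg' i b hi]
    · rintro (rfl | rfl | rfl | rfl | rfl | ⟨⟨k, b⟩, hb, rfl⟩)
      · exact ⟨(a, 0), (Prod.ext hfa0 hfa1).symm⟩
      · exact ⟨(a, 1), (Prod.ext hfa1 hfa2).symm⟩
      · exact ⟨(a, 2), (Prod.ext hfa2 hfa3).symm⟩
      · exact ⟨(a, 3), (Prod.ext hfa3 hfa4).symm⟩
      · exact ⟨(σ' a, 0), (Prod.ext hfa4 hfa5).symm⟩
      · obtain ⟨i, hi, hia⟩ : ∃ i, c.predAbove i = k ∧ i ≠ a := by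
          by_cases hk : k = c
          · exact ⟨σ' a, by rw [ha', hk], G'.next_ne p a⟩
          · obtain ⟨i, rfl⟩ := Fin.predAbove_surjective c k
            exact ⟨i, rfl, fun h => hk (by rw [h, ha])⟩
        subst hi
        refine ⟨(i, b), ?_⟩
        rw [hfg i b hia ?_, hfg' i b hia]
        rintro rfl rfl
        exact hb (by rw [ha'])
  have hpath := EdgesRepresent.of_path (gridNext_injective σ')
    (f := fun t => mergeLoop σ' (X (1 - t)) (P (1 - t)) a (1 - t)) (K := p.orient K)
    (by
      refine continuous_pi fun ⟨i, b⟩ => ?_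
      fin_cases b <;> simp only [mergeLoop] <;>
        split_ifs <;> refine continuous_pi fun d => ?_ <;> fin_cases d <;>
        simp [boxPoint, X, P, mergePos] <;> fun_prop)
    (by
      intro t ht
      rcases eq_or_lt_of_le ht.2 with rfl | ht1
      · rw [sub_self, hzero]
        exact G'.simpleLoop_gridLoop p
      · exact hsimple _ (by linarith) (by linarith [ht.1]))
  simp only [sub_zero, sub_self, hzero] at hpath
  exact hpath hone

end GridDiagram

/-! ### Untwisting the bends -/

namespace GridDiagram

variable {n : ℕ}

theorem strictlyBetween_of_predAbove {c : Fin n} {k i j : Fin (n + 1)}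
    (h : StrictlyBetween (c.predAbove k) (c.predAbove i) (c.predAbove j)) :
    StrictlyBetween k i j :=
  h.imp (fun h => ⟨lt_of_predAbove_lt h.1, lt_of_predAbove_lt h.2⟩)
    fun h => ⟨lt_of_predAbove_lt h.1, lt_of_predAbove_lt h.2⟩

theorem predAbove_strictlyBetween {c : Fin n} {k i j : Fin (n + 1)} (h : StrictlyBetween k i j)
    (hi : c.predAbove k ≠ c.predAbove i) (hj : c.predAbove k ≠ c.predAbove j) :
    StrictlyBetween (c.predAbove k) (c.predAbove i) (c.predAbove j) := by
  have hm := Fin.predAbove_right_monotone c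
  refine h.imp (fun h => ⟨?_, ?_⟩) fun h => ⟨?_, ?_⟩
  · exact lt_of_le_of_ne (hm h.1.le) hi.symm
  · exact lt_of_le_of_ne (hm h.2.le) hj
  · exact lt_of_le_of_ne (hm h.1.le) hj.symm
  · exact lt_of_le_of_ne (hm h.2.le) hi

theorem not_strictlyBetween_of_predAbove_eq {c : Fin n} {k i j : Fin (n + 1)}
    (hi : c.predAbove i = c) (hj : c.predAbove j = c) : ¬ StrictlyBetween k i j := by
  rw [Fin.ext_iff, coe_predAbove] at hi hj
  unfold StrictlyBetween
  simp only [Fin.lt_def]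
  split_ifs at hi hj <;> omega

/-- After a stabilization, the bends outside the block are twisted as before, and the two bends of the
block are not twisted: the vertical segment of one of them joins neighbouring rows and crosses
over nothing, and the horizontal segment of the other one joins neighbouring columns and has
nothing above it. -/
theorem IsStabilization.twisted {G : GridDiagram n} {p : Marker} {c : Fin n}
    {G' : GridDiagram (n + 1)} (h : G.IsStabilization p c G') (i : Fin (n + 1)) :
    G'.Twisted p i ↔ c.predAbove i ≠ c ∧ G.Twisted p (c.predAbove i) := by
  have hv := h.1
  obtain ⟨a, ha, ha', hfib, -, hnext, hw⟩ := h.exists_column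
  have hover : ∀ j, ¬ G'.Crossing a j := by
    intro j hj
    rw [crossing_iff G' p, ← mark_next] at hj
    exact not_strictlyBetween_of_predAbove_eq (c := G.mark p c) (by rw [hv, ha])
      (by rw [hv, ha']) hj.1
  have hunder : ∀ k, ¬ G'.Crossing k (G'.mark p (G'.next p a)) := by
    intro k hk
    rw [crossing_next_iff] at hk
    exact not_strictlyBetween_of_predAbove_eq ha ha' hk.2
  -- away from the block, crossings are neither created nor destroyed
  have hcross : ∀ k j, k ≠ a → j ≠ a → (c.predAbove k ≠ c ∨ c.predAbove (G'.next p j) ≠ c) →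
      (G'.Crossing k (G'.mark p (G'.next p j)) ↔
        G.Crossing (c.predAbove k) (G.mark p (c.predAbove (G'.next p j)))) := by
    intro k j hk hj hc
    rw [hnext j hj, crossing_next_iff, crossing_next_iff, ← hnext j hj, ← hw j hj, ← hw k hk,
      ← hv]
    refine ⟨fun ⟨h1, h2⟩ => ?_, fun h =>
      ⟨strictlyBetween_of_predAbove h.1, strictlyBetween_of_predAbove h.2⟩⟩
    have hkj : c.predAbove k ≠ c.predAbove j := by
      intro h
      have hne : k ≠ j := by
        rintro rfl
        rcases h2 with h2 | h2
        · exact lt_irrefl _ h2.1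
        · exact lt_irrefl _ h2.2
      have h3 := predAbove_eq_of_ne h hne
      exact hne (((hfib k h3).resolve_left hk).trans ((hfib j (h ▸ h3)).resolve_left hj).symm)
    have hkj' : c.predAbove k ≠ c.predAbove (G'.next p j) := by
      intro h
      have hne : k ≠ G'.next p j := by
        rintro rfl
        rcases h2 with h2 | h2
        · exact lt_irrefl _ h2.2
        · exact lt_irrefl _ h2.1
      have h3 := predAbove_eq_of_ne h hne
      exact hc.elim (fun h => h h3) fun h4 => h4 (h ▸ h3)
    refine ⟨predAbove_strictlyBetween h1 ?_ ?_, predAbove_strictlyBetween h2 hkj hkj'⟩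
    · rw [hw j hj, hv, ← mark_next, ← hnext j hj]
      exact (G.mark p).injective.ne hkj'.symm
    · rw [hw j hj, hw k hk]
      exact (G.mark p.other).injective.ne hkj.symm
  have hlift : ∀ k, ∃ i, i ≠ a ∧ c.predAbove i = k := by
    intro k
    by_cases hk : k = c
    · exact ⟨G'.next p a, G'.next_ne p a, by rw [ha', hk]⟩
    · obtain ⟨i, rfl⟩ := Fin.predAbove_surjective c k
      exact ⟨i, fun h => hk (by rw [h, ha]), rfl⟩
  have hrow : ∀ (H : GridDiagram n) j, ∃ l, j = H.mark p (H.next p l) := fun H j =>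
    ⟨(H.next p).symm ((H.mark p).symm j), by simp⟩
  have hrow' : ∀ j, ∃ l, j = G'.mark p (G'.next p l) := fun j =>
    ⟨(G'.next p).symm ((G'.mark p).symm j), by simp⟩
  by_cases hi : c.predAbove i = c
  · refine iff_of_false ?_ fun h => h.1 hi
    rintro ⟨⟨j, hj⟩, k, hk⟩
    rcases hfib i hi with rfl | rfl
    · exact hover j hj
    · exact hunder k hk
  · have hia : i ≠ a := fun h => hi (h ▸ ha)
    rw [and_iff_right hi]
    refine and_congr ⟨?_, ?_⟩ ⟨?_, ?_⟩
    · rintro ⟨j, hj⟩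
      obtain ⟨l, rfl⟩ := hrow' j
      have hl : l ≠ a := fun h => hunder i (h ▸ hj)
      exact ⟨_, (hcross i l hia hl (Or.inl hi)).1 hj⟩
    · rintro ⟨j, hj⟩
      obtain ⟨k, rfl⟩ := hrow G j
      obtain ⟨l, hl, rfl⟩ := hlift k
      rw [← hnext l hl] at hj
      exact ⟨_, (hcross i l hia hl (Or.inl hi)).2 hj⟩
    · rintro ⟨k, hk⟩
      obtain ⟨l, rfl⟩ := (G'.next p).surjective i
      have hka : k ≠ a := fun h => hover _ (h ▸ hk)
      exact ⟨_, (hcross k l hka (fun h => hi (h ▸ ha')) (Or.inr hi)).1 hk⟩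
    · rintro ⟨k, hk⟩
      obtain ⟨l, rfl⟩ := (G'.next p).surjective i
      obtain ⟨k, hka, rfl⟩ := hlift k
      exact ⟨k, (hcross k l hka (fun h => hi (h ▸ ha')) (Or.inr hi)).2 hk⟩

/-- Stabilizing at a twisted bend replaces it by two bends that are not twisted. -/
theorem IsStabilization.numTwisted_add_one {G : GridDiagram n} {p : Marker} {c : Fin n}
    {G' : GridDiagram (n + 1)} (h : G.IsStabilization p c G') (hc : G.Twisted p c) :
    G'.numTwisted p + 1 = G.numTwisted p := by
  have hinj : Set.InjOn c.predAbove {i | G'.Twisted p i} := by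
    intro i hi j _ hij
    by_contra hne
    exact ((h.twisted i).1 hi).1 (predAbove_eq_of_ne hij hne)
  have himage : c.predAbove '' {i | G'.Twisted p i} = {k | G.Twisted p k} \ {c} := by
    ext k
    constructor
    · rintro ⟨i, hi, rfl⟩
      exact ⟨((h.twisted i).1 hi).2, ((h.twisted i).1 hi).1⟩
    · rintro ⟨hk, hkc⟩
      obtain ⟨i, rfl⟩ := Fin.predAbove_surjective c k
      exact ⟨i, (h.twisted i).2 ⟨hkc, hk⟩, rfl⟩
  unfold numTwisted
  rw [← hinj.ncard_image, himage]
  exact Set.ncard_sdiff_singleton_add_one hc (Set.toFinite _)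

/-- The extension of a permutation that maps `x` to `y` and moves the other points as before. -/
def insertPerm (u : Equiv.Perm (Fin n)) (x y : Fin (n + 1)) : Equiv.Perm (Fin (n + 1)) :=
  ((finSuccEquiv' x).trans (Equiv.optionCongr u)).trans (finSuccEquiv' y).symm

theorem insertPerm_self (u : Equiv.Perm (Fin n)) (x y : Fin (n + 1)) : insertPerm u x y x = y := by
  simp [insertPerm]

theorem insertPerm_succAbove (u : Equiv.Perm (Fin n)) (x y : Fin (n + 1)) (i : Fin n) :
    insertPerm u x y (x.succAbove i) = y.succAbove (u i) := by
  simp [insertPerm]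

theorem exists_isStabilization (G : GridDiagram n) (p : Marker) (c : Fin n) :
    ∃ G', G.IsStabilization p c G' := by
  have hsucc : ∀ r k : Fin n, r.predAbove (r.succ.succAbove k) = k := by
    intro r k
    rw [Fin.ext_iff, coe_predAbove]
    rcases lt_or_ge k.castSucc r.succ with h | h
    · rw [Fin.succAbove_of_castSucc_lt _ _ h]
      rw [Fin.lt_def, Fin.val_castSucc, Fin.val_succ] at h
      simp only [Fin.val_castSucc]
      split_ifs <;> omega
    · rw [Fin.succAbove_of_le_castSucc _ _ h]
      rw [Fin.le_def, Fin.val_castSucc, Fin.val_succ] at h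
      simp only [Fin.val_succ]
      split_ifs <;> omega
  -- the `2 × 2` block has the markings of kind `p` on the rising diagonal, and the other marking in
  -- the upper left corner
  set v' := insertPerm (G.mark p) c.castSucc (G.mark p c).castSucc with hv'
  set w' := insertPerm (G.mark p.other) c.castSucc (G.mark p c).succ with hw'
  have hv : ∀ i, (G.mark p c).predAbove (v' i) = G.mark p (c.predAbove i) := by
    intro i
    rcases Fin.eq_self_or_eq_succAbove c.castSucc i with rfl | ⟨k, rfl⟩
    · simp [hv', insertPerm_self]
    · simp [hv', insertPerm_succAbove]
  have hw : ∀ i, i ≠ c.castSucc →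
      (G.mark p c).predAbove (w' i) = G.mark p.other (c.predAbove i) := by
    intro i hi
    rcases Fin.eq_self_or_eq_succAbove c.castSucc i with rfl | ⟨k, rfl⟩
    · exact absurd rfl hi
    · simp [hw', insertPerm_succAbove, hsucc]
  have hne : ∀ i, v' i ≠ w' i := by
    intro i hi
    by_cases hic : i = c.castSucc
    · subst hic
      rw [hv', hw', insertPerm_self, insertPerm_self] at hi
      exact (Fin.castSucc_lt_succ).ne hi
    · have := hw i hic
      rw [← hi, hv] at this
      exact G.mark_ne p _ this
  have hself : (G.mark p c).predAbove (w' c.castSucc) = G.mark p c := by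
    simp [hw', insertPerm_self]
  cases p
  · exact ⟨⟨v', w', hne⟩, hv, c.castSucc, by simp, hself, hw⟩
  · exact ⟨⟨w', v', fun i => (hne i).symm⟩, hv, c.castSucc, by simp, hself, hw⟩

theorem exists_untwists (G : GridDiagram n) (p : Marker) :
    ∃ (m : ℕ) (G' : GridDiagram m), Untwists p G G' := by
  induction h : G.numTwisted p generalizing n with
  | zero =>
    refine ⟨n, G, .done G fun c hc => ?_⟩
    rw [numTwisted, Set.ncard_eq_zero (Set.toFinite _)] at h
    exact h.le hc
  | succ t ih =>
    obtain ⟨c, hc⟩ := Set.nonempty_of_ncard_ne_zero (h.trans_ne t.succ_ne_zero)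
    obtain ⟨G₁, h₁⟩ := G.exists_isStabilization p c
    have := h₁.numTwisted_add_one hc
    obtain ⟨m, G', hG'⟩ := ih G₁ (by omega)
    exact ⟨m, G', .step G G₁ G' c hc h₁ hG'⟩

theorem Untwists.size_eq {p : Marker} {m : ℕ} {G : GridDiagram n} {G' : GridDiagram m}
    (h : Untwists p G G') : m = n + G.numTwisted p := by
  induction h with
  | done G h =>
    have : {c | G.Twisted p c} = ∅ := Set.eq_empty_of_forall_notMem h
    rw [numTwisted, this, Set.ncard_empty, add_zero]
  | step G G₁ G' c hc h₁ h ih =>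
    have := h₁.numTwisted_add_one hc
    omega

theorem Untwists.represents {p : Marker} {m : ℕ} {G : GridDiagram n} {G' : GridDiagram m}
    (h : Untwists p G G') {K : PolygonalKnot} (hG : G.Represents K) : G'.Represents K := by
  induction h with
  | done G h => exact hG
  | step G G₁ G' c hc h₁ h ih => exact ih (h₁.represents hG)

theorem Untwists.not_twisted {p : Marker} {m : ℕ} {G : GridDiagram n} {G' : GridDiagram m}
    (h : Untwists p G G') (c : Fin m) : ¬ G'.Twisted p c := by
  induction h with
  | done G h => exact h c
  | step G G₁ G' c hc h₁ h ih => exact ih _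

/-- When no bend is twisted, the bends that pass over some segment can be put on top of all
others. -/
theorem exists_isStacking (G : GridDiagram n) (p : Marker) (h : ∀ c, ¬ G.Twisted p c) :
    ∃ ζ, G.IsStacking p ζ := by
  classical
  let f : Fin n → ℕ := fun c => if ∃ j, G.Crossing c j then 1 else 0
  refine ⟨(Tuple.sort f).symm, fun c d hcd => ?_⟩
  have hc : f c = 1 := if_pos ⟨_, hcd⟩
  have hd : f d = 0 := if_neg fun hd => h d ⟨hd, c, hcd⟩
  by_contra hlt
  have := Tuple.monotone_sort f (not_lt.1 hlt)
  simp [hc, hd] at this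

end GridDiagram

theorem mainTheorem1 {n : ℕ} (G : GridDiagram n) (K : PolygonalKnot) (hK : G.Represents K)
    (p : Marker) :
    (∃ (m : ℕ) (G' : GridDiagram m), GridDiagram.Untwists p G G') ∧
    ∀ (m : ℕ) (G' : GridDiagram m), GridDiagram.Untwists p G G' →
      m = n + G.numTwisted p ∧ G'.Represents K ∧
      (∃ ζ : Equiv.Perm (Fin m), G'.IsStacking p ζ) ∧
      ∀ ζ : Equiv.Perm (Fin m), G'.IsStacking p ζ →
        (G'.stack p ζ).Represents (p.orient K) ∧
        (G'.stack p ζ).CrossingCondition 2 ∧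
        ∃ (N : ℕ) (C : MarkedCube N), C.IsCubeDiagram ∧ C.Represents K ∧
          N ≤ n + 2 * ((G'.stack p ζ).numBad 0 + (G'.stack p ζ).numBad 1) + G.numTwisted p := by
  refine ⟨G.exists_untwists p, fun m G' h => ?_⟩
  have hK' := h.represents hK
  refine ⟨h.size_eq, hK', G'.exists_isStacking p h.not_twisted, fun ζ hζ => ⟨?_, ?_, ?_⟩⟩
  · rw [GridDiagram.stack_eq]
    exact (MarkedCube.represents_ofEquiv_iff _ _ _ _ _).2 (G'.represents_stack p hζ hK')
  · exact G'.crossingCondition_stack p hζ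
  · obtain ⟨N, C, hC, hCK, hN⟩ := G'.exists_isCubeDiagram_of_stack p hζ hK'
    have := h.size_eq
    exact ⟨N, C, hC, hCK, by omega⟩
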